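/- Let $d\ge 1$, $\mathcal X\subseteq\mathbb R^d$, let $\mu$ be a probability measure on $\mathcal X$ and let $\sigma>0$. For $f\in L^2(\mathcal X,\mu)$ let $\mathrm P_f$ be the law of the data $(\mathbf x,\mathbf y)=((x_i)_{i\le n},(y_i)_{i\le n})$ given by $y_i=f(x_i)+\varepsilon_i$, with $x_i$ i.i.d. from $\mu$ and, independently, $\varepsilon_i$ i.i.d. $N(0,\sigma^2)$; write $\mathrm E_f$ for the expectation under $\mathrm P_f$. Write $\|\cdot\|$ and $\langle\cdot,\cdot\rangle$ for the norm and inner product of $L^2(\mathcal X,\mu)$. Let $k(x,y)=\sum_{j\ge1}\lambda_j\varphi_j(x)\varphi_j(y)$ be a continuous kernel on $\mathcal X$ (the identity holding $\mu\times\mu$-almost everywhere), with $(\lambda_j)$ nonnegative, decreasing and summable and $(\varphi_j)_{j\ge1}$ an orthonormal basis of $L^2(\mathcal X,\mu)$ consisting of functions with $\sup_{j,x}|\varphi_j(x)|<\infty$. Suppose that $\lambda_j\asymp j^{-1-2\alpha/d}$ for some $\alpha>d/2$. Let $\Pi$ be the law on $L^2(\mathcal X,\mu)$ of the centered Gaussian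 process with covariance kernel $k$, and let $\Pi(\cdot\mid\mathbf x,\mathbf y)$ be the posterior, whose density with respect to $\Pi$ is proportional to $f\mapsto\exp\big(-\frac1{2\sigma^2}\sum_{i=1}^n(y_i-f(x_i))^2\big)$, where $f(x)=\sum_j\langle f,\varphi_j\rangle\varphi_j(x)$. For $m\ge0$ put $\mathbf u=(\langle f,\varphi_1\rangle,\dots,\langle f,\varphi_m\rangle)$ and let $\mathcal Q_m$ be the set of all distributions $\int\Pi(\cdot\mid\mathbf u)\,d\Psi_{\mathbf u}(\mathbf u)$, with $\Psi_{\mathbf u}$ a non-degenerate Gaussian distribution on $\mathbb R^m$. For $m=m_n$ the (population spectral features) variational posterior $\Psi(\cdot\mid\mathbf x,\mathbf y)$ is the minimizer of $D_{\mathrm{KL}}(\Psi\,\|\,\Pi(\cdot\mid\mathbf x,\mathbf y))$ over $\Psi\in\mathcal Q_{m_n}$. We say that it contracts around $f_0$ at rate $\epsilon_n$ if $\mathrm E_{f_0}\Psi(\|f-f_0\|\ge M_n\epsilon_n\mid\mathbf x,\mathbf y)\to0$ for every sequence $M_n\to\infty$. For $\beta>0$ let $\mathcal S^\beta=\{f\in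 L^2(\mathcal X,\mu):\|f\|_\beta<\infty\}$, where $\|f\|_\beta^2=\sum_{j\ge1}j^{2\beta/d}\langle f,\varphi_j\rangle^2$. Let $\beta>0$ and $m_n\asymp n^r$ as $n\to\infty$. Then the minimizer $\Psi(\cdot\mid\mathbf x,\mathbf y)$ exists and is unique for all data, and the following hold. 1. If $d/(d+2\alpha)\le r<1/2$, then for every (essentially) bounded $f_0\in\mathcal S^\beta$ the variational posterior contracts around $f_0$ at rate $\epsilon_n=n^{-(\beta\wedge\alpha)/(d+2\alpha)}$. 2. If $\alpha=\beta$, this $\epsilon_n$ is the minimax rate for $\mathcal S^\beta$: for every $R>0$ there are constants $c,C>0$ such that for all $n\ge1$ $$c\,\epsilon_n^2\le\inf_{T}\ \sup_{\|f\|_\beta\le R}\mathrm E_f\|T(\mathbf x,\mathbf y)-f\|^2\le C\,\epsilon_n^2,$$ the infimum being over all estimators, i.e. measurable maps $T$ from the data to $L^2(\mathcal X,\mu)$. 3. If $\alpha=\beta$ and $r<d/(d+2\alpha)$, then there are a bounded $f_0\in\mathcal S^\beta$ and a $p<\beta/(d+2\beta)$ such that $\mathrm E_{f_0}\Psi(\|f-f_0\|\le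 M n^{-p}\mid\mathbf x,\mathbf y)\to0$ for every $M>0$; moreover every sequence $\epsilon_n$ at which the variational posterior contracts around $f_0$ satisfies $n^{-p}=O(\epsilon_n)$. -/

import Mathlib

open MeasureTheory ProbabilityTheory Filter Asymptotics InformationTheory
open scoped Topology ENNReal NNReal

noncomputable section

namespace SparseGP

/-! ### The function space `L²(𝒳, μ)` -/

/-- The Hilbert space `L²(𝒳, μ)`. -/
abbrev L2 {𝒳 : Type*} [MeasurableSpace 𝒳] (μ : Measure 𝒳) : Type _ := Lp ℝ 2 μ

/-- `L²(𝒳, μ)` carries its Borel σ-algebra. -/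
instance instMeasurableSpaceL2 {𝒳 : Type*} [MeasurableSpace 𝒳] (μ : Measure 𝒳) :
    MeasurableSpace (Lp ℝ 2 μ) := borel _

instance instBorelSpaceL2 {𝒳 : Type*} [MeasurableSpace 𝒳] (μ : Measure 𝒳) :
    BorelSpace (Lp ℝ 2 μ) := ⟨rfl⟩

instance instStandardBorelSpaceL2 {𝒳 : Type*} [MeasurableSpace 𝒳] (μ : Measure 𝒳)
    [IsSeparable μ] : StandardBorelSpace (Lp ℝ 2 μ) := by
  have : Fact ((2 : ℝ≥0∞) ≠ ∞) := ⟨by norm_num⟩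
  have : SecondCountableTopology (Lp ℝ 2 μ) := Lp.SecondCountableTopology
  infer_instance

/-- `f ∈ L²(𝒳, μ)` is (essentially) bounded. -/
def IsBoundedFun {𝒳 : Type*} [MeasurableSpace 𝒳] {μ : Measure 𝒳} (f : L2 μ) : Prop :=
  ∃ K : ℝ, ∀ᵐ x ∂μ, |f x| ≤ K

/-! ### The covariance kernel -/

/-- A continuous covariance kernel `k` on `𝒳` with its Mercer decomposition
`k(x,y) = ∑ⱼ λⱼ φⱼ(x) φⱼ(y)`, where `(λⱼ)` is a decreasing summable sequence of nonnegative
numbers and `(φⱼ)` is an orthonormal basis of `L²(𝒳, μ)`.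
All sequences are indexed from `0`: `lam j` and `φ j` are the `(j+1)`-st eigenvalue and
eigenfunction. The `φ j` are actual functions on `𝒳`; `basis j` is the class of `φ j`. -/
structure MercerKernel {𝒳 : Type*} [TopologicalSpace 𝒳] [MeasurableSpace 𝒳]
    (μ : Measure 𝒳) where
  k : 𝒳 → 𝒳 → ℝ
  continuous_k : Continuous (Function.uncurry k)
  lam : ℕ → ℝ
  lam_nonneg : ∀ j, 0 ≤ lam j
  lam_antitone : Antitone lam
  lam_summable : Summable lam
  φ : ℕ → 𝒳 → ℝ
  φ_measurable : ∀ j, Measurable (φ j)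
  basis : HilbertBasis ℕ ℝ (L2 μ)
  basis_ae_eq : ∀ j, basis j =ᵐ[μ] φ j
  mercer : ∀ᵐ p ∂(μ.prod μ), HasSum (fun j => lam j * φ j p.1 * φ j p.2) (k p.1 p.2)

section Model

variable {𝒳 : Type*} [TopologicalSpace 𝒳] [MeasurableSpace 𝒳] {μ : Measure 𝒳}

/-- The coefficient `⟨f, φⱼ⟩`. -/
def MercerKernel.coeff (S : MercerKernel μ) (f : L2 μ) (j : ℕ) : ℝ :=
  inner ℝ (S.basis j) f

/-- `Π` is the law on `L²(𝒳, μ)` of the centered Gaussian process with covariance kernel `k`: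
a Gaussian measure with mean zero whose covariance operator is the integral operator of `k`,
`E ⟨f,g⟩⟨f,h⟩ = ∫∫ k(x,y) g(x) h(y) dμ(x) dμ(y)`. This determines `Π` uniquely. -/
structure IsGPPrior (S : MercerKernel μ) (Pr : Measure (L2 μ)) : Prop where
  gaussian : IsGaussian Pr
  mean_zero : ∀ g : L2 μ, ∫ f, inner ℝ f g ∂Pr = 0
  covariance : ∀ g h : L2 μ,
    ∫ f, inner ℝ f g * inner ℝ f h ∂Pr = ∫ x, ∫ y, S.k x y * g x * h y ∂μ ∂μ

/-- The point evaluation `f(x) = ∑ⱼ ⟨f,φⱼ⟩ φⱼ(x)`. Under the Gaussian process law with kernel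
`k` this is the version of the process for which `(f(x))ₓ` is centered Gaussian with
`cov (f(x), f(y)) = k(x,y)` and `cov (f(x), ⟨f,φⱼ⟩) = λⱼ φⱼ(x)`. -/
def MercerKernel.eval (S : MercerKernel μ) (f : L2 μ) (x : 𝒳) : ℝ :=
  ∑' j, S.coeff f j * S.φ j x

/-! ### The regression model -/

/-- The data `(𝐱, 𝐲)` of sample size `n`. -/
abbrev Data (𝒳 : Type*) (n : ℕ) : Type _ := (Fin n → 𝒳) × (Fin n → ℝ)

/-- The law of the data `(𝐱, 𝐲)` when `yᵢ = f(xᵢ) + εᵢ`, with `xᵢ` i.i.d. from `μ` and,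
independently, `εᵢ` i.i.d. from `N(0, σ²)`. -/
def dataLaw (σ : ℝ≥0) (f : L2 μ) (n : ℕ) : Measure (Data 𝒳 n) :=
  ((Measure.pi fun _ : Fin n => μ).prod
      (Measure.pi fun _ : Fin n => gaussianReal 0 (σ ^ 2))).map
    fun p => (p.1, fun i => f (p.1 i) + p.2 i)

/-! ### Posterior and variational posterior -/

/-- The posterior of `f` given the data, by Bayes' formula: its density with respect to the
prior is proportional to `exp (-(1/(2σ²)) ∑ᵢ (yᵢ - f(xᵢ))²)`. -/
def posterior (S : MercerKernel μ) (Pr : Measure (L2 μ)) (σ : ℝ≥0) {n : ℕ}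
    (z : Data 𝒳 n) : Measure (L2 μ) :=
  Pr.tilted fun f => -(∑ i, (z.2 i - S.eval f (z.1 i)) ^ 2) / (2 * (σ : ℝ) ^ 2)

/-- The population spectral features `𝐮 = (⟨f,φ₁⟩, …, ⟨f,φ_m⟩)`. -/
def MercerKernel.features (S : MercerKernel μ) (m : ℕ) (f : L2 μ) : Fin m → ℝ :=
  fun j => S.coeff f j

/-- Non-degenerate `m`-dimensional Gaussian distributions. -/
def IsNondegenerateGaussian {m : ℕ} (ν : Measure (Fin m → ℝ)) : Prop :=
  IsGaussian ν ∧
    (Matrix.of fun i j : Fin m => cov[fun u : Fin m → ℝ => u i, fun u => u j; ν]).PosDef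

/-- The variational class: all distributions `Ψ = ∫ Π(· | 𝐮) dΨ_𝐮(𝐮)`, where `Π(· | 𝐮)` is
the conditional law of `f` given `𝐮` under the prior `Π` and `Ψ_𝐮` is a non-degenerate
Gaussian distribution on `ℝᵐ`. -/
def variationalClass [IsSeparable μ] (S : MercerKernel μ) (Pr : Measure (L2 μ))
    [IsFiniteMeasure Pr] (m : ℕ) : Set (Measure (L2 μ)) :=
  {Ψ | ∃ ν : Measure (Fin m → ℝ), IsNondegenerateGaussian ν ∧
    Ψ = ν.bind (condDistrib id (S.features m) Pr)}

/-- `Ψ` minimizes the Kullback-Leibler divergence to the posterior over the variational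
class. -/
def IsVariationalPosterior [IsSeparable μ] (S : MercerKernel μ)
    (Pr : Measure (L2 μ)) [IsFiniteMeasure Pr] (σ : ℝ≥0) (m : ℕ) {n : ℕ} (z : Data 𝒳 n)
    (Ψ : Measure (L2 μ)) : Prop :=
  IsMinOn (fun Ψ' => klDiv Ψ' (posterior S Pr σ z)) (variationalClass S Pr m) Ψ ∧
    Ψ ∈ variationalClass S Pr m

open Classical in
/-- The variational posterior `Ψ(· | 𝐱, 𝐲)`, i.e. the minimizer of the Kullback-Leibler
divergence to the posterior over the variational class (with junk value `0` if there is
none). -/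
def variationalPosterior [IsSeparable μ] (S : MercerKernel μ)
    (Pr : Measure (L2 μ)) [IsFiniteMeasure Pr] (σ : ℝ≥0) (m : ℕ) {n : ℕ} (z : Data 𝒳 n) :
    Measure (L2 μ) :=
  if h : ∃ Ψ, IsVariationalPosterior S Pr σ m z Ψ then h.choose else 0

/-! ### Contraction -/

/-- The data-dependent distributions `Ψ n (· | 𝐱, 𝐲)` contract around `f₀` at rate `ε`:
`E₀ Ψ n (‖f - f₀‖ ≥ Mₙ εₙ | 𝐱, 𝐲) → 0` for every sequence `Mₙ → ∞`. -/
def ContractsAtRate (σ : ℝ≥0) (Ψ : ∀ n, Data 𝒳 n → Measure (L2 μ)) (f₀ : L2 μ)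
    (ε : ℕ → ℝ) : Prop :=
  ∀ M : ℕ → ℝ, Tendsto M atTop atTop →
    Tendsto (fun n => ∫⁻ z, Ψ n z {f | M n * ε n ≤ ‖f - f₀‖} ∂(dataLaw σ f₀ n)) atTop (𝓝 0)

/-! ### Sobolev spaces and minimax risk -/

/-- `‖f‖_β² = ∑_{j ≥ 1} j^{2β/d} ⟨f,φⱼ⟩² < ∞`, i.e. `f` is in the `β`-Sobolev space. -/
def MemSobolev (S : MercerKernel μ) (d : ℕ) (β : ℝ) (f : L2 μ) : Prop :=
  Summable fun j : ℕ => ((j : ℝ) + 1) ^ (2 * β / d) * S.coeff f j ^ 2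

/-- The ball `{f : ‖f‖_β ≤ R}` of the `β`-Sobolev space. -/
def sobolevBall (S : MercerKernel μ) (d : ℕ) (β R : ℝ) : Set (L2 μ) :=
  {f | MemSobolev S d β f ∧
    ∑' j : ℕ, ((j : ℝ) + 1) ^ (2 * β / d) * S.coeff f j ^ 2 ≤ R ^ 2}

/-- The minimax risk for squared `L²`-loss over a class `F` of regression functions: the
infimum over all estimators `T` (measurable functions of the data) of the worst-case risk
`sup_{f ∈ F} E_f ‖T(𝐱, 𝐲) - f‖²`. -/
def minimaxRisk (σ : ℝ≥0) (F : Set (L2 μ)) (n : ℕ) : ℝ≥0∞ :=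
  ⨅ (T : Data 𝒳 n → L2 μ) (_ : Measurable T),
    ⨆ f ∈ F, ∫⁻ z, ‖T z - f‖ₑ ^ 2 ∂(dataLaw σ f n)

end Model

end SparseGP

end

/-!
The prior is the law of `∑ⱼ √λⱼ Zⱼ φⱼ` with independent standard normal `Zⱼ`, so the first `m`
coefficients of `f` are independent of the rest and every member of the variational class is the
law of a head with a Gaussian law of our choice plus an independent prior tail (`headTail`). As the
tail is centered, the expected log-likelihood under such a law splits into that of the head and a
constant, and the minimizer of the divergence is the head-tail law whose head is the posterior in
the linear regression on `φ_1, …, φ_m` which ignores the tail (`isVariationalPosterior_iff`). This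
is an explicit Gaussian law, with precision `Λ⁻¹ + σ⁻² ΦᵀΦ` for the design matrix `Φ`.

*Contraction.* Since `m² / n → 0` and the `φⱼ` are bounded, the Gram matrix `ΦᵀΦ` is at least
`n / 2` with probability tending to one (`measure_not_wellConditioned_le`). On that event the mean
squared distance to `f₀` is bounded by a variance `∑ⱼ (λⱼ⁻¹ + n/(2σ²))⁻¹`, a shrinkage bias, an
approximation error and the prior variance of the tail (`lintegral_variationalPosterior_le`); all
of them are of the order of the squared rate when `m ≳ n^{d/(d+2α)}` (`exists_oracle_bound`).

*Minimax rate.* The upper bound is the risk of the projection estimator (`minimaxRisk_le`). The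
lower bound is Assouad's lemma on a hypercube of side `≍ n^{-1/2}` (`le_minimaxRisk`), with a
two-point bound for Gaussian shifts in terms of the `χ²`-divergence.

*Too few features.* Under every variational posterior the tail is a prior tail, whatever the data.
Its coefficients `m, …, 2m` alone have total variance at least of the order of `m^{-2α/d}`, so that
for every center `f₀` the distance to `f₀` exceeds `n^{-p}` with probability tending to one
(`headTail_ball_le`), for some `p < β/(d+2β)`. Any bounded `f₀` in the Sobolev space will do.
-/

set_option linter.unusedSectionVars false

namespace SparseGP

/-! ### Heads and tails of the basis expansion -/

section Prior

variable {𝒳 : Type*} [TopologicalSpace 𝒳] [MeasurableSpace 𝒳] {μ : Measure 𝒳}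

instance instSecondCountableTopologyL2 [IsSeparable μ] :
    SecondCountableTopology (Lp ℝ 2 μ) := by
  have : Fact ((2 : ℝ≥0∞) ≠ ∞) := ⟨by norm_num⟩
  exact Lp.SecondCountableTopology

namespace MercerKernel

variable (S : MercerKernel μ)

/-- The coefficient functional `f ↦ ⟨f, φⱼ⟩` as a continuous linear form. -/
noncomputable def coeffL (j : ℕ) : L2 μ →L[ℝ] ℝ := innerSL ℝ (S.basis j)

lemma coeffL_apply (j : ℕ) (f : L2 μ) : S.coeffL j f = S.coeff f j := rfl

lemma coeff_add (f g : L2 μ) (j : ℕ) : S.coeff (f + g) j = S.coeff f j + S.coeff g j :=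
  map_add (S.coeffL j) f g

lemma coeff_sub (f g : L2 μ) (j : ℕ) : S.coeff (f - g) j = S.coeff f j - S.coeff g j :=
  map_sub (S.coeffL j) f g

@[fun_prop]
lemma measurable_coeff (j : ℕ) : Measurable fun f : L2 μ => S.coeff f j :=
  (S.coeffL j).continuous.measurable

/-- The feature map as a continuous linear map. -/
noncomputable def featuresL (m : ℕ) : L2 μ →L[ℝ] (Fin m → ℝ) :=
  ContinuousLinearMap.pi fun j => S.coeffL j

@[fun_prop]
lemma measurable_features (m : ℕ) : Measurable (S.features m) :=
  (S.featuresL m).continuous.measurable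

/-- The synthesis map `u ↦ ∑_{j<m} uⱼ φⱼ`. -/
noncomputable def synth (m : ℕ) : (Fin m → ℝ) →L[ℝ] L2 μ :=
  ∑ j : Fin m, (ContinuousLinearMap.proj (R := ℝ) (φ := fun _ : Fin m => ℝ) j).smulRight
    (S.basis j)

lemma synth_apply (m : ℕ) (u : Fin m → ℝ) : S.synth m u = ∑ j : Fin m, u j • S.basis j := by
  simp [synth]

/-- The residual `f - ∑_{j<m} ⟨f, φⱼ⟩ φⱼ`. -/
noncomputable def tail (m : ℕ) : L2 μ →L[ℝ] L2 μ :=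
  ContinuousLinearMap.id ℝ _ - (S.synth m).comp (S.featuresL m)

lemma tail_apply (m : ℕ) (f : L2 μ) : S.tail m f = f - S.synth m (S.features m f) := rfl

lemma coeff_basis (i j : ℕ) : S.coeff (S.basis i) j = if i = j then 1 else 0 := by
  have := (orthonormal_iff_ite.1 S.basis.orthonormal) j i
  rw [coeff, this]
  simp [eq_comm]

lemma coeff_synth (m : ℕ) (u : Fin m → ℝ) (j : ℕ) :
    S.coeff (S.synth m u) j = if h : j < m then u ⟨j, h⟩ else 0 := by
  rw [synth_apply, ← coeffL_apply, map_sum]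
  simp only [map_smul, coeffL_apply, coeff_basis, smul_eq_mul, mul_ite, mul_one, mul_zero]
  split_ifs with h
  · rw [Finset.sum_eq_single ⟨j, h⟩] <;> simp +contextual [Fin.ext_iff]
  · exact Finset.sum_eq_zero fun i _ => if_neg fun hij : (i : ℕ) = j => h (hij ▸ i.2)

lemma coeff_tail (m : ℕ) (f : L2 μ) (j : ℕ) :
    S.coeff (S.tail m f) j = if j < m then 0 else S.coeff f j := by
  rw [tail_apply, coeff_sub, coeff_synth]
  split_ifs with h <;> simp [features]

lemma hasSum_coeff_mul_coeff (f g : L2 μ) :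
    HasSum (fun j => S.coeff f j * S.coeff g j) (inner ℝ f g) := by
  simpa [coeff, real_inner_comm] using S.basis.hasSum_inner_mul_inner f g

lemma hasSum_sq_coeff (f : L2 μ) : HasSum (fun j => S.coeff f j ^ 2) (‖f‖ ^ 2) := by
  simpa [sq, real_inner_self_eq_norm_sq] using S.hasSum_coeff_mul_coeff f f

/-- The map `(u, f) ↦ ∑_{j<m} uⱼ φⱼ + (f - ∑_{j<m} ⟨f, φⱼ⟩ φⱼ)`, which replaces the first `m`
coefficients of `f` by `u`. -/
noncomputable def comb (m : ℕ) (p : (Fin m → ℝ) × L2 μ) : L2 μ := S.synth m p.1 + S.tail m p.2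

@[fun_prop]
lemma continuous_comb (m : ℕ) : Continuous (S.comb m) := by
  unfold comb; fun_prop

@[fun_prop]
lemma measurable_comb [IsSeparable μ] (m : ℕ) : Measurable (S.comb m) :=
  (S.continuous_comb m).measurable

lemma comb_features (m : ℕ) (f : L2 μ) : S.comb m (S.features m f, f) = f := by
  simp [comb, tail_apply]

lemma coeff_comb (m : ℕ) (u : Fin m → ℝ) (f : L2 μ) (j : ℕ) :
    S.coeff (S.comb m (u, f)) j = if h : j < m then u ⟨j, h⟩ else S.coeff f j := by
  rw [comb, coeff_add, coeff_synth, coeff_tail]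
  split_ifs <;> simp

lemma features_comb (m : ℕ) (u : Fin m → ℝ) (f : L2 μ) : S.features m (S.comb m (u, f)) = u := by
  funext j
  simp [features, coeff_comb]

/-- Pythagoras: the head and the tail of the expansion are orthogonal. -/
lemma norm_comb_sub_sq (m : ℕ) (u : Fin m → ℝ) (f g : L2 μ) :
    ‖S.comb m (u, f) - g‖ ^ 2 =
      ∑ j : Fin m, (u j - S.coeff g j) ^ 2 + ‖S.tail m f - S.tail m g‖ ^ 2 := by
  have h1 := S.hasSum_sq_coeff (S.comb m (u, f) - g)
  have h2 := S.hasSum_sq_coeff (S.tail m f - S.tail m g)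
  refine h1.unique ?_
  have h3 : HasSum (fun j : ℕ => if h : j < m then (u ⟨j, h⟩ - S.coeff g j) ^ 2 else 0)
      (∑ j : Fin m, (u j - S.coeff g j) ^ 2) := by
    have : HasSum (fun j : ℕ => if h : j < m then (u ⟨j, h⟩ - S.coeff g j) ^ 2 else 0) _ :=
      hasSum_sum_of_ne_finset_zero (s := Finset.range m) (by
        intro j hj; simp at hj; simp [hj])
    rwa [Finset.sum_range, Finset.sum_congr rfl (g := fun j : Fin m => (u j - S.coeff g j) ^ 2)]
      at this
    intro i _; simp
  convert h3.add h2 using 2 with j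
  rw [coeff_sub, coeff_sub, coeff_comb, coeff_tail, coeff_tail]
  split_ifs <;> simp

lemma norm_tail_sq (m : ℕ) (f : L2 μ) :
    HasSum (fun j => S.coeff f (j + m) ^ 2) (‖S.tail m f‖ ^ 2) := by
  have h := S.hasSum_sq_coeff (S.tail m f)
  have := (hasSum_nat_add_iff' (f := fun j => S.coeff (S.tail m f) j ^ 2) m).2 h
  rw [Finset.sum_eq_zero fun j hj => by simp [coeff_tail, Finset.mem_range.1 hj], sub_zero] at this
  simpa [coeff_tail] using this

end MercerKernel

/-! ### Second moments of the prior -/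

section Moments

variable {S : MercerKernel μ} {C : ℝ}

lemma abs_mul_φ_le (hC : ∀ j x, |S.φ j x| ≤ C) (i j : ℕ) (x y : 𝒳) :
    |S.φ i x * S.φ j y| ≤ C ^ 2 := by
  rw [abs_mul, sq]
  exact mul_le_mul (hC i x) (hC j y) (abs_nonneg _) ((abs_nonneg _).trans (hC i x))

lemma integral_φ_mul_φ (S : MercerKernel μ) (i j : ℕ) :
    ∫ x, S.φ i x * S.φ j x ∂μ = if i = j then 1 else 0 := by
  rw [← orthonormal_iff_ite.1 S.basis.orthonormal i j, L2.inner_def]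
  refine integral_congr_ae ?_
  filter_upwards [S.basis_ae_eq i, S.basis_ae_eq j] with x h1 h2
  simp [h1, h2, mul_comm]

/-- The integral operator of `k` is diagonal in the basis `φ`. -/
lemma integral_kernel_φ [IsProbabilityMeasure μ] (hC : ∀ j x, |S.φ j x| ≤ C) (g : L2 μ) (j : ℕ) :
    ∫ x, ∫ y, S.k x y * g x * S.φ j y ∂μ ∂μ = S.lam j * S.coeff g j := by
  have hi : ∀ᵐ x ∂μ, ∫ y, S.k x y * g x * S.φ j y ∂μ = S.lam j * (g x * S.basis j x) := by
    filter_upwards [Measure.ae_ae_of_ae_prod S.mercer, S.basis_ae_eq j] with x hx hxj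
    have h2 : ∫ y, S.k x y * g x * S.φ j y ∂μ =
        ∫ y, ∑' l, (S.lam l * S.φ l x * g x) * (S.φ l y * S.φ j y) ∂μ := by
      refine integral_congr_ae ?_
      filter_upwards [hx] with y hy
      rw [← ((hy.mul_right (g x)).mul_right (S.φ j y)).tsum_eq]
      exact tsum_congr fun l => by ring
    have hint : ∀ l, Integrable (fun y => (S.lam l * S.φ l x * g x) *
        (S.φ l y * S.φ j y)) μ := fun l => by
      refine Integrable.const_mul ?_ _
      refine Integrable.of_bound (((S.φ_measurable l).mul
        (S.φ_measurable j)).aestronglyMeasurable) (C ^ 2) ?_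
      exact ae_of_all _ fun y => abs_mul_φ_le hC l j y y
    rw [h2, ← integral_tsum_of_summable_integral_norm hint]
    · simp_rw [integral_const_mul, integral_φ_mul_φ]
      rw [tsum_eq_single j]
      · simp [hxj]; ring
      · intro l hl; simp [hl]
    · refine Summable.of_nonneg_of_le (fun l => integral_nonneg fun y => norm_nonneg _)
        (fun l => ?_) (((S.lam_summable.mul_right C).mul_right |g x|).mul_right (C ^ 2))
      have : ∀ y, ‖(S.lam l * S.φ l x * g x) * (S.φ l y * S.φ j y)‖ ≤
          S.lam l * C * |g x| * C ^ 2 := fun y => by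
        rw [norm_mul, norm_mul, norm_mul, Real.norm_eq_abs (S.lam l),
          abs_of_nonneg (S.lam_nonneg l)]
        have h1 := hC l x
        have h2 := abs_mul_φ_le hC l j y y
        have := S.lam_nonneg l
        have h3 : 0 ≤ C := (abs_nonneg _).trans h1
        simp only [Real.norm_eq_abs]
        gcongr
      calc _ ≤ ∫ y, S.lam l * C * |g x| * C ^ 2 ∂μ :=
            integral_mono (hint l).norm (integrable_const _) this
        _ = _ := by simp
  rw [integral_congr_ae hi, integral_const_mul, MercerKernel.coeff, L2.inner_def]
  simp

variable {Pr : Measure (L2 μ)}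

lemma integral_inner_mul_coeff [IsProbabilityMeasure μ] (hC : ∀ j x, |S.φ j x| ≤ C)
    (hPr : IsGPPrior S Pr) (g : L2 μ) (j : ℕ) :
    ∫ f, inner ℝ f g * S.coeff f j ∂Pr = S.lam j * S.coeff g j := by
  rw [← integral_kernel_φ hC]
  simp_rw [MercerKernel.coeff, fun f : L2 μ => real_inner_comm f (S.basis j)]
  rw [hPr.covariance]
  refine integral_congr_ae (ae_of_all _ fun x => integral_congr_ae ?_)
  filter_upwards [S.basis_ae_eq j] with y h2
  rw [h2]

lemma integral_coeff_mul_coeff [IsProbabilityMeasure μ] (hC : ∀ j x, |S.φ j x| ≤ C)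
    (hPr : IsGPPrior S Pr) (i j : ℕ) :
    ∫ f, S.coeff f i * S.coeff f j ∂Pr = if i = j then S.lam i else 0 := by
  have := integral_inner_mul_coeff hC hPr (S.basis i) j
  rw [S.coeff_basis] at this
  simp_rw [MercerKernel.coeff, fun f : L2 μ => real_inner_comm f (S.basis i)]
  refine this.trans ?_
  split_ifs with h <;> simp [h]

lemma integral_coeff (hPr : IsGPPrior S Pr) (i : ℕ) : ∫ f, S.coeff f i ∂Pr = 0 := by
  simpa [MercerKernel.coeff, real_inner_comm] using hPr.mean_zero (S.basis i)

lemma memLp_coeff [IsSeparable μ] (hPr : IsGPPrior S Pr) (i : ℕ) :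
    MemLp (fun f => S.coeff f i) 2 Pr := by
  have := hPr.gaussian
  exact (IsGaussian.hasGaussianLaw_id.map_fun (S.coeffL i)).memLp_two

lemma covariance_coeff [IsProbabilityMeasure μ] [IsSeparable μ] [IsProbabilityMeasure Pr]
    (hC : ∀ j x, |S.φ j x| ≤ C)
    (hPr : IsGPPrior S Pr) (i j : ℕ) :
    cov[fun f => S.coeff f i, fun f => S.coeff f j; Pr] = if i = j then S.lam i else 0 := by
  rw [covariance_eq_sub (memLp_coeff hPr i) (memLp_coeff hPr j), integral_coeff hPr]
  simpa using integral_coeff_mul_coeff hC hPr i j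

/-- Under the prior the first `m` coefficients are independent `N(0, λⱼ)`. -/
lemma map_features [IsProbabilityMeasure μ] [IsSeparable μ] [IsProbabilityMeasure Pr]
    (hC : ∀ j x, |S.φ j x| ≤ C) (hPr : IsGPPrior S Pr) (m : ℕ) :
    Pr.map (S.features m) = Measure.pi fun j : Fin m => gaussianReal 0 (S.lam j).toNNReal := by
  have := hPr.gaussian
  have hG : HasGaussianLaw (fun f => fun j : Fin m => S.coeff f j) Pr :=
    IsGaussian.hasGaussianLaw_id.map_fun (S.featuresL m)
  have hind := hG.iIndepFun_of_covariance_eq_zero (fun i j hij => by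
    rw [covariance_coeff hC hPr, if_neg (by simpa [Fin.ext_iff] using hij)])
  have := (iIndepFun_iff_map_fun_eq_pi_map (fun i => by fun_prop)).1 hind
  refine this.trans ?_
  congr 1
  funext j
  rw [(hG.eval j).map_eq_gaussianReal, integral_coeff hPr,
    ← covariance_self (by fun_prop), covariance_coeff hC hPr, if_pos rfl]

/-- Under the prior the first `m` coefficients are independent of the residual. -/
lemma indepFun_features_tail [IsProbabilityMeasure μ] [IsSeparable μ] [IsProbabilityMeasure Pr]
    (hC : ∀ j x, |S.φ j x| ≤ C) (hPr : IsGPPrior S Pr) (m : ℕ) :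
    IndepFun (S.features m) (S.tail m) Pr := by
  have := hPr.gaussian
  have hG : HasGaussianLaw (fun f => (S.features m f, S.tail m f)) Pr :=
    IsGaussian.hasGaussianLaw_id.map_fun ((S.featuresL m).prod (S.tail m))
  refine hG.indepFun_of_covariance_strongDual fun L₁ L₂ => ?_
  have hid : MemLp (fun f : L2 μ => f) 2 Pr := IsGaussian.hasGaussianLaw_id.memLp_two
  set c : Fin m → ℝ := fun j => L₁ (Pi.single j 1)
  set b : L2 μ := S.tail m ((InnerProductSpace.toDual ℝ (L2 μ)).symm L₂)
  have hL1 : ∀ f, (L₁ ∘ S.features m) f = ∑ j, c j * S.coeff f j := fun f => by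
    simp only [Function.comp_apply, c]
    conv_lhs => rw [pi_eq_sum_univ' (S.features m f)]
    simp [MercerKernel.features, mul_comm]
  have hL2 : ∀ f, (L₂ ∘ S.tail m) f = inner ℝ f b := fun f => by
    simp only [Function.comp_apply, b]
    rw [← InnerProductSpace.toDual_symm_apply, real_inner_comm]
    rw [← (S.hasSum_coeff_mul_coeff _ _).tsum_eq, ← (S.hasSum_coeff_mul_coeff _ _).tsum_eq]
    refine tsum_congr fun j => ?_
    simp only [S.coeff_tail]
    split_ifs <;> simp
  have hb : MemLp (fun f => inner ℝ f b) 2 Pr := hid.inner_const b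
  have hc : ∀ j : Fin m, MemLp (fun f => c j * S.coeff f j) 2 Pr := fun j =>
    (memLp_coeff hPr j).const_mul _
  rw [show L₁ ∘ S.features m = fun f => ∑ j, c j * S.coeff f j from funext hL1,
    show L₂ ∘ S.tail m = fun f => inner ℝ f b from funext hL2,
    covariance_fun_sum_left hc hb]
  refine Finset.sum_eq_zero fun j _ => ?_
  rw [covariance_const_mul_left, covariance_eq_sub (memLp_coeff hPr j) hb, integral_coeff hPr]
  have : ∫ f, inner ℝ f b * S.coeff f j ∂Pr = 0 := by
    rw [integral_inner_mul_coeff hC hPr, S.coeff_tail, if_pos j.2, mul_zero]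
  simp only [Pi.mul_apply, zero_mul, sub_zero]
  simp_rw [mul_comm (S.coeff _ _)]
  rw [this, mul_zero]

end Moments
end Prior

/-! ### Tilted measures -/

section Tilted

lemma pi_tilted {ι : Type*} [Fintype ι] {E : ι → Type*} [∀ i, MeasurableSpace (E i)]
    (μ : ∀ i, Measure (E i)) [∀ i, SigmaFinite (μ i)] (f : ∀ i, E i → ℝ) :
    Measure.pi (fun i => (μ i).tilted (f i)) =
      (Measure.pi μ).tilted fun u => ∑ i, f i (u i) := by
  refine Measure.pi_eq fun s hs => ?_
  rw [tilted_apply_eq_ofReal_integral]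
  simp_rw [Real.exp_sum, tilted_apply_eq_ofReal_integral]
  rw [integral_div, Measure.restrict_pi_pi,
    integral_fintype_prod_eq_prod (fun i x => Real.exp (f i x)),
    integral_fintype_prod_eq_prod (fun i x => Real.exp (f i x)), ← Finset.prod_div_distrib,
    ENNReal.ofReal_prod_of_nonneg]
  · simp_rw [integral_div]
  · intro i _
    exact div_nonneg (integral_nonneg fun _ => (Real.exp_pos _).le)
      (integral_nonneg fun _ => (Real.exp_pos _).le)

lemma map_tilted {α β : Type*} [MeasurableSpace α] [MeasurableSpace β] (μ : Measure α)
    {T : α → β} (hT : Measurable T) {f : β → ℝ} (hf : Measurable f) :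
    (μ.tilted (f ∘ T)).map T = (μ.map T).tilted f := by
  ext s hs
  rw [Measure.map_apply hT hs, tilted_apply' _ _ (hT hs), tilted_apply' _ _ hs,
    setLIntegral_map hs (by fun_prop) hT, integral_map hT.aemeasurable (by fun_prop)]
  rfl

lemma smul_tilted {α : Type*} [MeasurableSpace α] (μ : Measure α) (f : α → ℝ) {c : ℝ≥0∞}
    (hc : c ≠ 0) (hc' : c ≠ ∞) : (c • μ).tilted f = μ.tilted f := by
  ext s hs
  rw [tilted_apply' _ _ hs, tilted_apply' _ _ hs, Measure.restrict_smul, lintegral_smul_measure,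
    integral_smul_measure, smul_eq_mul, ← lintegral_const_mul' _ _ hc']
  refine lintegral_congr fun x => ?_
  have h : 0 < c.toReal := ENNReal.toReal_pos hc hc'
  nth_rewrite 1 [← ENNReal.ofReal_toReal hc']
  rw [← ENNReal.ofReal_mul h.le, smul_eq_mul, mul_div_assoc', mul_div_mul_left _ _ h.ne']

lemma tilted_add_const {α : Type*} [MeasurableSpace α] (μ : Measure α) (f : α → ℝ) (c : ℝ) :
    μ.tilted (fun x => f x + c) = μ.tilted f := by
  unfold Measure.tilted
  congr 1
  funext x
  simp_rw [Real.exp_add, integral_mul_const]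
  rw [mul_div_mul_right _ _ (Real.exp_pos c).ne']

lemma gaussianReal_eq_tilted (m : ℝ) {v : ℝ≥0} (hv : v ≠ 0) :
    gaussianReal m v = volume.tilted fun x => -(x - m) ^ 2 / (2 * v) := by
  have h1 := integral_gaussianPDFReal_eq_one m hv
  simp_rw [gaussianPDFReal, integral_const_mul] at h1
  have hpos : (0 : ℝ) < (√(2 * Real.pi * v))⁻¹ := by
    have : (0 : ℝ) < v := by positivity
    positivity
  rw [gaussianReal_of_var_ne_zero _ hv, Measure.tilted]
  congr 1
  funext x
  rw [gaussianPDF, gaussianPDFReal, div_eq_mul_inv (Real.exp _), mul_comm, eq_inv_of_mul_eq_one_left h1]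

end Tilted

/-! ### Gaussian measures on `ℝᵐ` -/

section GaussianVector

variable {m : ℕ}

/-- The law of `a + B w` for a standard Gaussian vector `w`. -/
noncomputable def gaussVec (a : Fin m → ℝ) (B : Matrix (Fin m) (Fin m) ℝ) :
    Measure (Fin m → ℝ) :=
  (Measure.pi fun _ : Fin m => gaussianReal 0 1).map fun w => a + B.mulVec w

lemma measurable_affine (a : Fin m → ℝ) (B : Matrix (Fin m) (Fin m) ℝ) :
    Measurable fun w : Fin m → ℝ => a + B.mulVec w := by
  have : Continuous fun w : Fin m → ℝ => a + B.mulVec w := by fun_prop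
  exact this.measurable

instance isProbabilityMeasure_gaussVec (a : Fin m → ℝ) (B : Matrix (Fin m) (Fin m) ℝ) :
    IsProbabilityMeasure (gaussVec a B) :=
  Measure.isProbabilityMeasure_map (measurable_affine a B).aemeasurable

lemma isGaussian_pi_gaussianReal (v : Fin m → ℝ≥0) :
    IsGaussian (Measure.pi fun j : Fin m => gaussianReal 0 (v j)) := by
  have h := (iIndepFun_pi (μ := fun j : Fin m => gaussianReal 0 (v j))
    (X := fun _ x => x) (fun i => aemeasurable_id)).hasGaussianLaw (fun i => ?_)
  · have := h.isGaussian_map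
    simpa using this
  · refine ⟨?_⟩
    rw [show (fun x : Fin m → ℝ => x i) = Function.eval i from rfl, Measure.pi_map_eval]
    simp
    infer_instance

instance isGaussian_gaussVec (a : Fin m → ℝ) (B : Matrix (Fin m) (Fin m) ℝ) :
    IsGaussian (gaussVec a B) := by
  have := isGaussian_pi_gaussianReal (m := m) fun _ => 1
  have h : gaussVec a B = ((Measure.pi fun _ : Fin m => gaussianReal 0 1).map
      (LinearMap.toContinuousLinearMap B.mulVecLin)).map fun x => a + x := by
    rw [gaussVec, Measure.map_map (by fun_prop) (by fun_prop)]
    rfl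
  rw [h]
  infer_instance

lemma memLp_eval_of_isGaussian (ν : Measure (Fin m → ℝ)) [IsGaussian ν] (i : Fin m) :
    MemLp (fun u : Fin m → ℝ => u i) 2 ν :=
  (IsGaussian.memLp_dual ν (ContinuousLinearMap.proj i) 2 (by simp) :)

lemma integral_eval_stdGaussian (i : Fin m) :
    ∫ w : Fin m → ℝ, w i ∂(Measure.pi fun _ : Fin m => gaussianReal 0 1) = 0 := by
  rw [integral_comp_eval (μ := fun _ : Fin m => gaussianReal 0 1) (f := fun x => x) (by fun_prop)]
  simp

lemma integral_eval_mul_eval_stdGaussian (i j : Fin m) :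
    ∫ w : Fin m → ℝ, w i * w j ∂(Measure.pi fun _ : Fin m => gaussianReal 0 1) =
      if i = j then 1 else 0 := by
  split_ifs with h
  · subst h
    rw [integral_comp_eval (μ := fun _ : Fin m => gaussianReal 0 1) (f := fun x => x * x)
      (by fun_prop)]
    have h1 := variance_fun_id_gaussianReal (μ := 0) (v := 1)
    rw [variance_eq_integral (by fun_prop)] at h1
    simpa [sq] using h1
  · have hind := (iIndepFun_pi (μ := fun _ : Fin m => gaussianReal 0 1)
      (X := fun _ x => x) (fun i => aemeasurable_id)).indepFun h
    have := hind.integral_fun_mul_eq_mul_integral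
      (measurable_pi_apply i).aestronglyMeasurable (measurable_pi_apply j).aestronglyMeasurable
    rw [this, integral_eval_stdGaussian, zero_mul]

lemma memLp_eval_std (i : Fin m) :
    MemLp (fun u : Fin m → ℝ => u i) 2 (Measure.pi fun _ : Fin m => gaussianReal 0 1) := by
  have := isGaussian_pi_gaussianReal (m := m) fun _ => 1
  exact memLp_eval_of_isGaussian _ i

lemma integral_linear_std (b : Fin m → ℝ) :
    ∫ w : Fin m → ℝ, b ⬝ᵥ w ∂(Measure.pi fun _ : Fin m => gaussianReal 0 1) = 0 := by
  simp_rw [dotProduct]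
  rw [integral_finsetSum _ fun i _ => ((memLp_eval_std i).integrable (by simp)).const_mul _]
  simp [integral_const_mul, integral_eval_stdGaussian]

lemma integral_linear_mul_linear_std (b c : Fin m → ℝ) :
    ∫ w : Fin m → ℝ, (b ⬝ᵥ w) * (c ⬝ᵥ w) ∂(Measure.pi fun _ : Fin m => gaussianReal 0 1) =
      b ⬝ᵥ c := by
  simp_rw [dotProduct, Finset.sum_mul_sum]
  have hi : ∀ i j : Fin m, Integrable (fun w : Fin m → ℝ => b i * w i * (c j * w j))
      (Measure.pi fun _ : Fin m => gaussianReal 0 1) := fun i j =>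
    ((memLp_eval_std i).const_mul _).integrable_mul ((memLp_eval_std j).const_mul _)
  rw [integral_finsetSum _ fun i _ => integrable_finsetSum _ fun j _ => hi i j]
  refine Finset.sum_congr rfl fun i _ => ?_
  rw [integral_finsetSum _ fun j _ => hi i j]
  have : ∀ j, ∫ w : Fin m → ℝ, b i * w i * (c j * w j)
      ∂(Measure.pi fun _ : Fin m => gaussianReal 0 1) = if i = j then b i * c j else 0 := by
    intro j
    simp_rw [mul_mul_mul_comm]
    rw [integral_const_mul, integral_eval_mul_eval_stdGaussian]
    simp
  simp [this]

lemma memLp_linear_std (b : Fin m → ℝ) :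
    MemLp (fun w : Fin m → ℝ => b ⬝ᵥ w) 2 (Measure.pi fun _ : Fin m => gaussianReal 0 1) := by
  simp_rw [dotProduct]
  exact memLp_finsetSum _ fun i _ => (memLp_eval_std i).const_mul _

lemma integral_eval_gaussVec (a : Fin m → ℝ) (B : Matrix (Fin m) (Fin m) ℝ) (i : Fin m) :
    ∫ u, u i ∂(gaussVec a B) = a i := by
  rw [gaussVec, integral_map (measurable_affine a B).aemeasurable
    (measurable_pi_apply i).aestronglyMeasurable]
  simp only [Pi.add_apply, Matrix.mulVec]
  rw [integral_add (integrable_const _) ((memLp_linear_std _).integrable (by simp)),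
    integral_linear_std]
  simp

lemma integral_sq_sub_gaussVec (a : Fin m → ℝ) (B : Matrix (Fin m) (Fin m) ℝ) (i : Fin m)
    (c : ℝ) : ∫ u, (u i - c) ^ 2 ∂(gaussVec a B) = (a i - c) ^ 2 + (B * B.transpose) i i := by
  rw [gaussVec, integral_map (measurable_affine a B).aemeasurable
    (((measurable_pi_apply i).sub_const c).pow_const 2).aestronglyMeasurable]
  set r : Fin m → ℝ := fun k => B i k
  have h : ∀ w : Fin m → ℝ, ((a + B.mulVec w) i - c) ^ 2 =
      ((a i - c) ^ 2 + 2 * (a i - c) * (r ⬝ᵥ w)) + (r ⬝ᵥ w) * (r ⬝ᵥ w) := fun w => by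
    simp only [Pi.add_apply, Matrix.mulVec, r]; ring
  simp_rw [h]
  have hl := memLp_linear_std r
  have hl1 := (hl.integrable (by simp)).const_mul (2 * (a i - c))
  have hl0 := integrable_const (μ := Measure.pi fun _ : Fin m => gaussianReal 0 1) ((a i - c) ^ 2)
  have e1 := integral_add (hl0.add hl1) (hl.integrable_mul hl)
  have e2 := integral_add hl0 hl1
  simp only [Pi.add_apply, Pi.mul_apply] at e1
  rw [e1, e2, integral_const_mul, integral_linear_std, integral_linear_mul_linear_std]
  simp [Matrix.mul_apply, dotProduct, r]

lemma covariance_gaussVec (a : Fin m → ℝ) (B : Matrix (Fin m) (Fin m) ℝ) (i j : Fin m) :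
    cov[fun u : Fin m → ℝ => u i, fun u => u j; gaussVec a B] = (B * B.transpose) i j := by
  rw [covariance, integral_eval_gaussVec, integral_eval_gaussVec, gaussVec,
    integral_map (measurable_affine a B).aemeasurable (by fun_prop)]
  simp only [Pi.add_apply, Matrix.mulVec, add_sub_cancel_left]
  rw [integral_linear_mul_linear_std]
  simp [Matrix.mul_apply, dotProduct]

/-- A Gaussian measure on `ℝᵐ` is determined by its mean vector and covariance matrix. -/
lemma isGaussian_ext {ν ν' : Measure (Fin m → ℝ)} [IsGaussian ν] [IsGaussian ν']
    (h1 : ∀ i, ∫ u, u i ∂ν = ∫ u, u i ∂ν')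
    (h2 : ∀ i j, cov[fun u : Fin m → ℝ => u i, fun u => u j; ν] =
      cov[fun u : Fin m → ℝ => u i, fun u => u j; ν']) : ν = ν' := by
  refine Measure.ext_of_charFunDual ?_
  ext L
  obtain ⟨c, hL⟩ : ∃ c : Fin m → ℝ, (L : (Fin m → ℝ) → ℝ) = fun u => ∑ j, c j * u j := by
    refine ⟨fun j => L (Pi.single j 1), ?_⟩
    funext u
    conv_lhs => rw [pi_eq_sum_univ' u]
    simp [mul_comm]
  rw [IsGaussian.charFunDual_eq, IsGaussian.charFunDual_eq]
  have hi : ∀ (ξ : Measure (Fin m → ℝ)) [IsGaussian ξ] (j : Fin m),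
      MemLp (fun u : Fin m → ℝ => c j * u j) 2 ξ := fun ξ _ j =>
    (memLp_eval_of_isGaussian ξ j).const_mul _
  have hm : ∀ (ξ : Measure (Fin m → ℝ)) [IsGaussian ξ],
      ∫ u, L u ∂ξ = ∑ j, c j * ∫ u, u j ∂ξ := fun ξ _ => by
    simp only [hL]
    rw [integral_finsetSum _ fun j _ => (hi ξ j).integrable (by simp)]
    simp [integral_const_mul]
  have hv : ∀ (ξ : Measure (Fin m → ℝ)) [IsGaussian ξ],
      Var[L; ξ] = ∑ i, ∑ j, c i * (c j *
        cov[fun u : Fin m → ℝ => u i, fun u => u j; ξ]) := fun ξ _ => by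
    rw [← covariance_self (by fun_prop)]
    simp only [hL]
    rw [covariance_fun_sum_fun_sum (hi ξ) (hi ξ)]
    simp [covariance_const_mul_left, covariance_const_mul_right, mul_left_comm]
  rw [integral_complex_ofReal, integral_complex_ofReal, hm ν, hm ν', hv ν, hv ν']
  simp_rw [h1, h2]

lemma exists_mul_transpose_eq {A : Matrix (Fin m) (Fin m) ℝ} (hA : A.PosDef) :
    ∃ B : Matrix (Fin m) (Fin m) ℝ, B.det ≠ 0 ∧ B * B.transpose = A := by
  open scoped MatrixOrder Matrix.Norms.L2Operator in
  refine ⟨CFC.sqrt A, ?_, ?_⟩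
  · have h := Matrix.PosSemidef.det_sqrt hA.posSemidef
    rw [h]
    have := hA.det_pos
    simp [RCLike.sqrt_of_nonneg this.le]
    positivity
  · have h1 : (CFC.sqrt A).PosSemidef :=
      Matrix.nonneg_iff_posSemidef.1 (CFC.sqrt_nonneg A)
    have h2 : (CFC.sqrt A).transpose = CFC.sqrt A := by
      simpa using h1.isHermitian.eq
    rw [h2, CFC.sqrt_mul_sqrt_self A hA.posSemidef.nonneg]

lemma exists_map_affine_volume (a : Fin m → ℝ) {B : Matrix (Fin m) (Fin m) ℝ}
    (hB : B.det ≠ 0) : ∃ c : ℝ≥0∞, c ≠ 0 ∧ c ≠ ∞ ∧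
      (volume : Measure (Fin m → ℝ)).map (fun w => a + B.mulVec w) = c • volume := by
  refine ⟨ENNReal.ofReal |(B.det)⁻¹|, by simpa using hB, by simp, ?_⟩
  have h := Real.map_matrix_volume_pi_eq_smul_volume_pi hB
  have h2 : (fun w => a + B.mulVec w) = (fun u => a + u) ∘ (Matrix.toLin' B) := by
    funext w; simp
  rw [h2, ← Measure.map_map (by fun_prop)
    (LinearMap.continuous_of_finiteDimensional _).measurable, h, Measure.map_smul]
  congr 1
  exact map_add_left_eq_self volume a

/-- A product of centered Gaussian measures as a tilted Lebesgue measure. -/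
lemma pi_gaussianReal_eq_tilted {v : Fin m → ℝ≥0} (hv : ∀ j, v j ≠ 0) :
    (Measure.pi fun j : Fin m => gaussianReal 0 (v j)) =
      volume.tilted fun u : Fin m → ℝ => ∑ j, -(u j) ^ 2 / (2 * v j) := by
  have : (fun j : Fin m => gaussianReal 0 (v j)) =
      fun j => (volume : Measure ℝ).tilted fun x => -x ^ 2 / (2 * v j) := by
    funext j
    simpa using gaussianReal_eq_tilted 0 (hv j)
  rw [this, pi_tilted (fun _ => volume) fun j x => -x ^ 2 / (2 * v j)]
  rfl

lemma volume_absolutelyContinuous_pi_gaussianReal {v : Fin m → ℝ≥0} (hv : ∀ j, v j ≠ 0) :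
    (volume : Measure (Fin m → ℝ)) ≪ Measure.pi fun j : Fin m => gaussianReal 0 (v j) := by
  have h := pi_gaussianReal_eq_tilted hv
  rw [h]
  refine absolutelyContinuous_tilted ?_
  by_contra hc
  rw [tilted_of_not_integrable hc] at h
  exact IsProbabilityMeasure.ne_zero _ h

lemma gaussVec_absolutelyContinuous (a : Fin m → ℝ) {B : Matrix (Fin m) (Fin m) ℝ}
    (hB : B.det ≠ 0) : gaussVec a B ≪ volume := by
  obtain ⟨c, hc, hc', h⟩ := exists_map_affine_volume a hB
  have h1 : (Measure.pi fun _ : Fin m => gaussianReal 0 1) ≪ volume := by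
    rw [pi_gaussianReal_eq_tilted fun _ => one_ne_zero]
    exact tilted_absolutelyContinuous _ _
  refine (h1.map (measurable_affine a B)).trans ?_
  rw [h]
  exact Measure.smul_absolutelyContinuous

/-- Completing the square: the measure with density proportional to `exp (-uᵀAu/2 + bᵀu)` is
Gaussian with mean `A⁻¹b` and covariance matrix `A⁻¹ = BBᵀ`. -/
lemma tilted_quadratic_eq_gaussVec {A B : Matrix (Fin m) (Fin m) ℝ} (hA : A.PosDef)
    (hB : B.det ≠ 0) (hAB : B * B.transpose = A⁻¹) (b : Fin m → ℝ) :
    (volume.tilted fun u : Fin m → ℝ => -(u ⬝ᵥ A.mulVec u) / 2 + b ⬝ᵥ u) =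
      gaussVec (A⁻¹.mulVec b) B := by
  obtain ⟨c, hc, hc', h⟩ := exists_map_affine_volume (A⁻¹.mulVec b) hB
  rw [← smul_tilted volume _ hc hc', ← h, ← map_tilted _ (measurable_affine _ _)
    (by unfold dotProduct Matrix.mulVec dotProduct; fun_prop), gaussVec,
    pi_gaussianReal_eq_tilted fun _ => one_ne_zero]
  congr 1
  have hAdet : IsUnit A.det := (Matrix.isUnit_iff_isUnit_det A).1 hA.isUnit
  have hBdet : IsUnit B.det := hB.isUnit
  have hAt : A.transpose = A := by simpa using hA.isHermitian.eq
  have hI : B.transpose * A * B = 1 := by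
    have h1 : B * (B.transpose * A) = 1 := by
      rw [← Matrix.mul_assoc, hAB, Matrix.nonsing_inv_mul A hAdet]
    exact mul_eq_one_comm.1 h1
  set a := A⁻¹.mulVec b
  have hAa : A.mulVec a = b := by
    rw [Matrix.mulVec_mulVec, Matrix.mul_nonsing_inv A hAdet, Matrix.one_mulVec]
  rw [← tilted_add_const _ _ (-(a ⬝ᵥ b) / 2)]
  congr 1
  funext w
  have e1 : B.mulVec w ⬝ᵥ A.mulVec (B.mulVec w) = w ⬝ᵥ w := by
    rw [Matrix.dotProduct_mulVec, ← Matrix.mulVec_transpose, hAt, Matrix.mulVec_mulVec,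
      Matrix.dotProduct_mulVec, ← Matrix.mulVec_transpose, Matrix.mulVec_mulVec,
      ← Matrix.mul_assoc, hI, Matrix.one_mulVec]
  have e2 : a ⬝ᵥ A.mulVec (B.mulVec w) = b ⬝ᵥ B.mulVec w := by
    rw [Matrix.dotProduct_mulVec, ← Matrix.mulVec_transpose, hAt, hAa]
  simp only [Function.comp_apply, Matrix.mulVec_add, add_dotProduct, dotProduct_add, e1, e2, hAa]
  rw [dotProduct_comm (B.mulVec w) b, dotProduct_comm b a]
  have : w ⬝ᵥ w = ∑ j, w j ^ 2 := by simp [dotProduct, sq]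
  rw [this]
  simp only [NNReal.coe_one, mul_one, neg_div, Finset.sum_neg_distrib, ← Finset.sum_div]
  ring

lemma exists_eq_gaussVec {ν : Measure (Fin m → ℝ)} (hν : IsNondegenerateGaussian ν) :
    ∃ (a : Fin m → ℝ) (B : Matrix (Fin m) (Fin m) ℝ), B.det ≠ 0 ∧ ν = gaussVec a B := by
  have := hν.1
  obtain ⟨B, hB, hAB⟩ := exists_mul_transpose_eq hν.2
  refine ⟨fun i => ∫ u, u i ∂ν, B, hB, isGaussian_ext (fun i => ?_) fun i j => ?_⟩
  · rw [integral_eval_gaussVec]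
  · rw [covariance_gaussVec, hAB]
    rfl

lemma isNondegenerateGaussian_gaussVec (a : Fin m → ℝ) {B : Matrix (Fin m) (Fin m) ℝ}
    (hB : B.det ≠ 0) : IsNondegenerateGaussian (gaussVec a B) := by
  refine ⟨inferInstance, ?_⟩
  have : (Matrix.of fun i j : Fin m =>
      cov[fun u : Fin m → ℝ => u i, fun u => u j; gaussVec a B]) = B * B.conjTranspose := by
    ext i j
    simp [covariance_gaussVec]
  rw [this]
  refine Matrix.PosDef.mul_conjTranspose_self B ?_
  exact Matrix.vecMul_injective_of_isUnit ((Matrix.isUnit_iff_isUnit_det B).2 hB.isUnit)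

/-- A non-degenerate Gaussian measure is absolutely continuous with respect to a product of
non-degenerate centered Gaussian measures. -/
lemma IsNondegenerateGaussian.absolutelyContinuous {ν : Measure (Fin m → ℝ)}
    (hν : IsNondegenerateGaussian ν) {v : Fin m → ℝ≥0} (hv : ∀ j, v j ≠ 0) :
    ν ≪ Measure.pi fun j : Fin m => gaussianReal 0 (v j) := by
  obtain ⟨a, B, hB, rfl⟩ := exists_eq_gaussVec hν
  exact (gaussVec_absolutelyContinuous a hB).trans (volume_absolutelyContinuous_pi_gaussianReal hv)

end GaussianVector

/-! ### The variational class -/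

section VariationalClass

variable {𝒳 : Type*} [TopologicalSpace 𝒳] [MeasurableSpace 𝒳] {μ : Measure 𝒳}
  [IsProbabilityMeasure μ] [IsSeparable μ] {S : MercerKernel μ} {C : ℝ}
  {Pr : Measure (L2 μ)} [IsProbabilityMeasure Pr]

/-- The law of `f` when its first `m` coefficients have law `ν` and, independently, the remaining
ones are distributed as under the prior `Pr`. -/
noncomputable def headTail (S : MercerKernel μ) (Pr : Measure (L2 μ)) (m : ℕ)
    (ν : Measure (Fin m → ℝ)) : Measure (L2 μ) :=
  (ν.prod Pr).map (S.comb m)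

lemma map_features_prodMk (hC : ∀ j x, |S.φ j x| ≤ C) (hPr : IsGPPrior S Pr) (m : ℕ) :
    Pr.map (fun f => (S.features m f, f)) =
      ((Pr.map (S.features m)).prod Pr).map fun p => (p.1, S.comb m p) := by
  have hind := indepFun_features_tail hC hPr m
  have hmt : Measurable (S.tail m) := (S.tail m).continuous.measurable
  have hmf := S.measurable_features m
  have hms : Measurable (S.synth m) := (S.synth m).continuous.measurable
  rw [indepFun_iff_map_prod_eq_prod_map_map hmf.aemeasurable hmt.aemeasurable] at hind
  set T : (Fin m → ℝ) × L2 μ → (Fin m → ℝ) × L2 μ := fun q => (q.1, S.synth m q.1 + q.2)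
  have hT : Measurable T := by fun_prop
  have h1 : (fun f => (S.features m f, f)) = T ∘ fun f => (S.features m f, S.tail m f) := by
    funext f; simp [T, MercerKernel.tail_apply]
  have h2 : (fun p : (Fin m → ℝ) × L2 μ => (p.1, S.comb m p)) = T ∘ Prod.map id (S.tail m) := by
    funext p; simp [T, MercerKernel.comb]
  rw [h1, ← Measure.map_map hT (by fun_prop), hind, h2,
    ← Measure.map_map hT (by fun_prop), ← Measure.map_prod_map _ _ measurable_id hmt,
    Measure.map_id]

lemma headTail_map_features (hC : ∀ j x, |S.φ j x| ≤ C) (hPr : IsGPPrior S Pr) (m : ℕ) :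
    headTail S Pr m (Pr.map (S.features m)) = Pr := by
  have h := congrArg (Measure.map Prod.snd) (map_features_prodMk hC hPr m)
  rw [Measure.map_map (by fun_prop) (by fun_prop), Measure.map_map (by fun_prop) (by fun_prop)] at h
  have : (Prod.snd ∘ fun f : L2 μ => (S.features m f, f)) = id := rfl
  rw [this, Measure.map_id] at h
  exact h.symm

/-- Mixing the conditional prior given the features over a law `ν` of the features gives the
measure with head distributed as `ν` and tail distributed as under the prior. -/
lemma bind_condDistrib_eq_headTail (hC : ∀ j x, |S.φ j x| ≤ C) (hPr : IsGPPrior S Pr) (m : ℕ)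
    {ν : Measure (Fin m → ℝ)} [IsProbabilityMeasure ν] (hν : ν ≪ Pr.map (S.features m)) :
    ν.bind (condDistrib id (S.features m) Pr) = headTail S Pr m ν := by
  set κ : Kernel (Fin m → ℝ) (L2 μ) := (Kernel.id ×ₖ Kernel.const _ Pr).map (S.comb m)
  have hκ : ∀ u, κ u = Pr.map fun f => S.comb m (u, f) := fun u => by
    rw [Kernel.map_apply _ (by fun_prop), Kernel.prod_apply, Kernel.id_apply, Kernel.const_apply,
      Measure.dirac_prod, Measure.map_map (by fun_prop) (by fun_prop)]
    rfl
  have hmark : IsMarkovKernel κ := Kernel.IsMarkovKernel.map _ (by fun_prop)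
  have hcomp : ∀ (ξ : Measure (Fin m → ℝ)) [IsProbabilityMeasure ξ], ξ ⊗ₘ κ =
      (ξ.prod Pr).map fun p => (p.1, S.comb m p) := by
    intro ξ _
    ext s hs
    rw [Measure.compProd_apply hs, Measure.map_apply (by fun_prop) hs,
      Measure.prod_apply ((show Measurable fun p : (Fin m → ℝ) × L2 μ => (p.1, S.comb m p) by
        fun_prop) hs)]
    refine lintegral_congr fun u => ?_
    rw [hκ, Measure.map_apply (by fun_prop) (measurable_prodMk_left hs)]
    rfl
  have : IsProbabilityMeasure (Pr.map (S.features m)) :=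
    Measure.isProbabilityMeasure_map (by fun_prop)
  have hae : condDistrib id (S.features m) Pr =ᵐ[Pr.map (S.features m)] κ := by
    refine condDistrib_ae_eq_of_measure_eq_compProd _ measurable_id.aemeasurable ?_
    rw [hcomp]
    exact map_features_prodMk hC hPr m
  rw [Measure.bind_congr_right (hν.ae_le hae), ← Measure.snd_compProd, hcomp, Measure.snd,
    Measure.map_map (by fun_prop) (by fun_prop)]
  rfl

lemma IsNondegenerateGaussian.absolutelyContinuous_map_features (hC : ∀ j x, |S.φ j x| ≤ C)
    (hPr : IsGPPrior S Pr) (hpos : ∀ j, 0 < S.lam j) {m : ℕ} {ν : Measure (Fin m → ℝ)}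
    (hν : IsNondegenerateGaussian ν) : ν ≪ Pr.map (S.features m) := by
  rw [map_features hC hPr]
  exact hν.absolutelyContinuous fun j => by simpa using hpos j

lemma mem_variationalClass_iff (hC : ∀ j x, |S.φ j x| ≤ C) (hPr : IsGPPrior S Pr)
    (hpos : ∀ j, 0 < S.lam j) {m : ℕ} {Ψ : Measure (L2 μ)} :
    Ψ ∈ variationalClass S Pr m ↔
      ∃ ν : Measure (Fin m → ℝ), IsNondegenerateGaussian ν ∧ Ψ = headTail S Pr m ν := by
  refine exists_congr fun ν => and_congr_right fun hν => ?_
  have := hν.1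
  rw [bind_condDistrib_eq_headTail hC hPr m
    (hν.absolutelyContinuous_map_features hC hPr hpos)]

instance isProbabilityMeasure_headTail (m : ℕ) (ν : Measure (Fin m → ℝ))
    [IsProbabilityMeasure ν] : IsProbabilityMeasure (headTail S Pr m ν) :=
  Measure.isProbabilityMeasure_map (by fun_prop)

lemma headTail_absolutelyContinuous (hC : ∀ j x, |S.φ j x| ≤ C)
    (hPr : IsGPPrior S Pr) (m : ℕ) {ν : Measure (Fin m → ℝ)} [IsProbabilityMeasure ν]
    (hν : ν ≪ Pr.map (S.features m)) : headTail S Pr m ν ≪ Pr := by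
  have : IsProbabilityMeasure (Pr.map (S.features m)) :=
    Measure.isProbabilityMeasure_map (by fun_prop)
  conv_rhs => rw [← headTail_map_features hC hPr m]
  exact (hν.prod Measure.AbsolutelyContinuous.rfl).map (by fun_prop)

lemma tilted_prod {α β : Type*} [MeasurableSpace α] [MeasurableSpace β] (μ : Measure α)
    [IsProbabilityMeasure μ] (ν : Measure β) [IsProbabilityMeasure ν] {f : α → ℝ}
    (hf : Measurable f) : (μ.prod ν).tilted (f ∘ Prod.fst) = (μ.tilted f).prod ν := by
  rw [Measure.tilted, Measure.tilted, prod_withDensity_left (by fun_prop)]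
  have : ∫ x, Real.exp ((f ∘ Prod.fst) x) ∂(μ.prod ν) = ∫ x, Real.exp (f x) ∂μ := by
    have := integral_fun_fst (μ := μ) (ν := ν) fun x => Real.exp (f x)
    simpa using this
  rw [this]
  rfl

/-- Reweighting the prior by a function of the features only changes the law of the features. -/
lemma headTail_tilted (hC : ∀ j x, |S.φ j x| ≤ C) (hPr : IsGPPrior S Pr) (m : ℕ)
    {g : (Fin m → ℝ) → ℝ} (hg : Measurable g) :
    headTail S Pr m ((Pr.map (S.features m)).tilted g) = Pr.tilted (g ∘ S.features m) := by
  have : IsProbabilityMeasure (Pr.map (S.features m)) :=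
    Measure.isProbabilityMeasure_map (by fun_prop)
  conv_rhs => rw [← headTail_map_features hC hPr m]
  rw [headTail, headTail, ← map_tilted _ (by fun_prop) (hg.comp (by fun_prop)), ← tilted_prod _ _ hg]
  congr 2
  funext p
  simp [S.features_comb m p.1 p.2]

end VariationalClass

/-! ### Minimising the Kullback-Leibler divergence to a tilted measure -/

section KL

variable {α : Type*} [MeasurableSpace α]

lemma klDiv_tilted_right {Ψ Q : Measure α} [IsProbabilityMeasure Ψ] [IsProbabilityMeasure Q]
    {h : α → ℝ} (hQ : Integrable (fun x => Real.exp (h x)) Q) (hΨ : Integrable h Ψ) :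
    (klDiv Ψ (Q.tilted h) = ∞ ↔ klDiv Ψ Q = ∞) ∧ (klDiv Ψ Q ≠ ∞ →
      (klDiv Ψ (Q.tilted h)).toReal =
        (klDiv Ψ Q).toReal - ∫ x, h x ∂Ψ + Real.log (∫ x, Real.exp (h x) ∂Q)) := by
  have hprob : IsProbabilityMeasure (Q.tilted h) := isProbabilityMeasure_tilted hQ
  have h1 := tilted_absolutelyContinuous Q h
  have h2 := absolutelyContinuous_tilted hQ
  have hiff : klDiv Ψ (Q.tilted h) ≠ ∞ ↔ klDiv Ψ Q ≠ ∞ := by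
    rw [klDiv_ne_top_iff, klDiv_ne_top_iff]
    constructor
    · rintro ⟨ha, hi⟩
      have ha' := ha.trans h1
      refine ⟨ha', ?_⟩
      have := (integrable_congr (llr_tilted_right ha' hQ)).1 hi
      refine (this.add (hΨ.sub (integrable_const (Real.log (∫ x, Real.exp (h x) ∂Q))))).congr ?_
      refine ae_of_all _ fun x => ?_
      simp only [Pi.add_apply, Pi.sub_apply]
      ring
    · rintro ⟨ha, hi⟩
      exact ⟨ha.trans h2, integrable_llr_tilted_right ha hΨ hi hQ⟩
  refine ⟨not_iff_not.1 hiff, fun hfin => ?_⟩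
  obtain ⟨ha, hi⟩ := klDiv_ne_top_iff.1 hfin
  rw [toReal_klDiv_of_measure_eq (ha.trans h2) (by simp), toReal_klDiv_of_measure_eq ha (by simp),
    integral_llr_tilted_right ha hΨ hQ hi]

/-- If `h` has the same integral under all members of a class, then within this class a member `Q`
is the unique minimiser of the divergence to the tilted measure `Q.tilted h`. -/
lemma existsUnique_minimizer_klDiv_tilted {𝒬 : Set (Measure α)} {Q : Measure α} {h : α → ℝ} {κ : ℝ}
    (hQ : Q ∈ 𝒬) (hprob : ∀ Ψ ∈ 𝒬, IsProbabilityMeasure Ψ)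
    (hexp : Integrable (fun x => Real.exp (h x)) Q) (hint : ∀ Ψ ∈ 𝒬, Integrable h Ψ)
    (hκ : ∀ Ψ ∈ 𝒬, ∫ x, h x ∂Ψ = κ) (Ψ : Measure α) :
    (IsMinOn (fun Ψ' => klDiv Ψ' (Q.tilted h)) 𝒬 Ψ ∧ Ψ ∈ 𝒬) ↔ Ψ = Q := by
  have := hprob Q hQ
  have hQQ := klDiv_tilted_right hexp (hint Q hQ)
  have hfin : klDiv Q (Q.tilted h) ≠ ∞ := fun hc => by
    rw [hQQ.1, klDiv_self] at hc
    simp at hc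
  have hval := hQQ.2 (by simp)
  rw [klDiv_self, hκ Q hQ] at hval
  constructor
  · rintro ⟨hmin, hΨ⟩
    have := hprob Ψ hΨ
    have hle : klDiv Ψ (Q.tilted h) ≤ klDiv Q (Q.tilted h) := hmin hQ
    have hΨfin := ne_top_of_le_ne_top hfin hle
    have hΨ' := klDiv_tilted_right hexp (hint Ψ hΨ)
    have hne : klDiv Ψ Q ≠ ∞ := fun hc => hΨfin (hΨ'.1.2 hc)
    have h1 := hΨ'.2 hne
    have h2 := ENNReal.toReal_mono hfin hle
    rw [h1, hval, hκ Ψ hΨ] at h2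
    have h3 : (klDiv Ψ Q).toReal = 0 := le_antisymm (by simp at h2; linarith) ENNReal.toReal_nonneg
    exact klDiv_eq_zero_iff.1 ((ENNReal.toReal_eq_zero_iff _).1 h3 |>.resolve_right hne)
  · rintro rfl
    refine ⟨fun Ψ' hΨ' => ?_, hQ⟩
    have := hprob Ψ' hΨ'
    have h1 := klDiv_tilted_right hexp (hint Ψ' hΨ')
    change klDiv _ _ ≤ klDiv Ψ' _
    by_cases hc : klDiv Ψ' Ψ = ∞
    · rw [h1.1.2 hc]; exact le_top
    · have hne : klDiv Ψ' (Ψ.tilted h) ≠ ∞ := fun h' => hc (h1.1.1 h')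
      rw [← ENNReal.toReal_le_toReal hfin hne, hval, h1.2 hc, hκ Ψ' hΨ', ENNReal.toReal_zero]
      have : 0 ≤ (klDiv Ψ' Ψ).toReal := ENNReal.toReal_nonneg
      linarith

end KL

/-! ### Point evaluations under the prior -/

section Evaluation

variable {𝒳 : Type*} [TopologicalSpace 𝒳] [MeasurableSpace 𝒳] {μ : Measure 𝒳}
  [IsProbabilityMeasure μ] [IsSeparable μ] {S : MercerKernel μ} {C : ℝ}
  {Pr : Measure (L2 μ)} [IsProbabilityMeasure Pr]

lemma lintegral_enorm_coeff_sq (hC : ∀ j x, |S.φ j x| ≤ C) (hPr : IsGPPrior S Pr) (j : ℕ) :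
    ∫⁻ f, ‖S.coeff f j‖ₑ ^ 2 ∂Pr = ENNReal.ofReal (S.lam j) := by
  have h := integral_coeff_mul_coeff hC hPr j j
  rw [if_pos rfl] at h
  rw [← h, ofReal_integral_eq_lintegral_ofReal]
  · refine lintegral_congr fun f => ?_
    rw [← sq, ← Real.enorm_eq_ofReal (sq_nonneg _), enorm_pow]
  · exact (memLp_coeff hPr j).integrable_mul (memLp_coeff hPr j)
  · exact ae_of_all _ fun f => mul_self_nonneg _

lemma lintegral_enorm_coeff_mul_le (hC : ∀ j x, |S.φ j x| ≤ C) (hPr : IsGPPrior S Pr) (i j : ℕ) :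
    ∫⁻ f, ‖S.coeff f i‖ₑ * ‖S.coeff f j‖ₑ ∂Pr ≤
      ENNReal.ofReal √(S.lam i) * ENNReal.ofReal √(S.lam j) := by
  have h := ENNReal.lintegral_mul_le_Lp_mul_Lq Pr (p := 2) (q := 2)
    ⟨by norm_num, by norm_num, by norm_num⟩
    (f := fun f => ‖S.coeff f i‖ₑ) (g := fun f => ‖S.coeff f j‖ₑ) (by fun_prop) (by fun_prop)
  refine h.trans (le_of_eq ?_)
  simp only [ENNReal.rpow_ofNat, lintegral_enorm_coeff_sq hC hPr]
  simp_rw [Real.sqrt_eq_rpow]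
  rw [ENNReal.ofReal_rpow_of_nonneg (S.lam_nonneg i) (by norm_num),
    ENNReal.ofReal_rpow_of_nonneg (S.lam_nonneg j) (by norm_num)]

/-- Since `∑ √λⱼ < ∞`, the `ℓ¹` norm of the coefficients has a finite second moment under the
prior. -/
lemma lintegral_tsum_enorm_coeff_sq_lt_top (hC : ∀ j x, |S.φ j x| ≤ C) (hPr : IsGPPrior S Pr)
    (hsum : Summable fun j => √(S.lam j)) :
    ∫⁻ f, (∑' j, ‖S.coeff f j‖ₑ) ^ 2 ∂Pr < ∞ := by
  have h1 : ∀ f, (∑' j, ‖S.coeff f j‖ₑ) ^ 2 =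
      ∑' i, ∑' j, ‖S.coeff f i‖ₑ * ‖S.coeff f j‖ₑ := fun f => by
    rw [sq, ← ENNReal.tsum_mul_right]
    simp_rw [ENNReal.tsum_mul_left]
  simp_rw [h1]
  rw [lintegral_tsum (fun i => (Measurable.tsum fun j => by fun_prop).aemeasurable)]
  simp_rw [fun i => lintegral_tsum (μ := Pr) (f := fun j f => ‖S.coeff f i‖ₑ * ‖S.coeff f j‖ₑ)
    (fun j => by fun_prop)]
  calc ∑' i, ∑' j, ∫⁻ f, ‖S.coeff f i‖ₑ * ‖S.coeff f j‖ₑ ∂Pr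
      ≤ ∑' i, ∑' j, ENNReal.ofReal √(S.lam i) * ENNReal.ofReal √(S.lam j) :=
        ENNReal.tsum_le_tsum fun i => ENNReal.tsum_le_tsum fun j =>
          lintegral_enorm_coeff_mul_le hC hPr i j
    _ = (∑' j, ENNReal.ofReal √(S.lam j)) ^ 2 := by
        rw [sq, ← ENNReal.tsum_mul_right]
        simp_rw [ENNReal.tsum_mul_left]
    _ < ∞ := by
        rw [← ENNReal.ofReal_tsum_of_nonneg (fun _ => Real.sqrt_nonneg _) hsum]
        exact ENNReal.pow_lt_top ENNReal.ofReal_lt_top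

/-- Under the prior almost every `f` has an absolutely convergent expansion at every point, so that
`S.eval f` is not a junk value. -/
lemma ae_summable_coeff (hC : ∀ j x, |S.φ j x| ≤ C) (hPr : IsGPPrior S Pr)
    (hsum : Summable fun j => √(S.lam j)) : ∀ᵐ f ∂Pr, Summable fun j => |S.coeff f j| := by
  have hm : Measurable fun f : L2 μ => (∑' j, ‖S.coeff f j‖ₑ) ^ 2 :=
    (Measurable.tsum fun j => by fun_prop).pow_const 2
  filter_upwards [ae_lt_top hm (lintegral_tsum_enorm_coeff_sq_lt_top hC hPr hsum).ne] with f hf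
  have hf' : ∑' j, ‖S.coeff f j‖ₑ ≠ ∞ := fun hc => by simp [hc] at hf
  have := tsum_enorm_ne_top_iff_summable_norm.1 hf'
  simpa using this

lemma summable_coeff_mul_φ (hC : ∀ j x, |S.φ j x| ≤ C) {f : L2 μ}
    (hf : Summable fun j => |S.coeff f j|) (x : 𝒳) : Summable fun j => S.coeff f j * S.φ j x := by
  refine Summable.of_norm_bounded (hf.mul_right C) fun j => ?_
  rw [norm_mul, Real.norm_eq_abs, Real.norm_eq_abs]
  exact mul_le_mul_of_nonneg_left (hC j x) (abs_nonneg _)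

lemma summable_coeff_tail (m : ℕ) {f : L2 μ} (hf : Summable fun j => |S.coeff f j|) :
    Summable fun j => |S.coeff (S.tail m f) j| := by
  refine Summable.of_nonneg_of_le (fun _ => abs_nonneg _) (fun j => ?_) hf
  rw [S.coeff_tail]
  split_ifs <;> simp

/-- The values of `∑_{j<m} uⱼ φⱼ` at `x`. -/
noncomputable def MercerKernel.headEval (S : MercerKernel μ) {m : ℕ} (u : Fin m → ℝ) (x : 𝒳) : ℝ :=
  ∑ j : Fin m, u j * S.φ j x

lemma eval_comb (hC : ∀ j x, |S.φ j x| ≤ C) (m : ℕ) (u : Fin m → ℝ) {f : L2 μ}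
    (hf : Summable fun j => |S.coeff f j|) (x : 𝒳) :
    S.eval (S.comb m (u, f)) x = S.headEval u x + S.eval (S.tail m f) x := by
  have h2 := (summable_coeff_mul_φ hC (summable_coeff_tail m hf) x).hasSum
  have h3 : HasSum (fun j : ℕ => (if h : j < m then u ⟨j, h⟩ else 0) * S.φ j x)
      (S.headEval u x) := by
    have : HasSum (fun j : ℕ => (if h : j < m then u ⟨j, h⟩ else 0) * S.φ j x) _ :=
      hasSum_sum_of_ne_finset_zero (s := Finset.range m) (by
        intro j hj; simp at hj; simp [hj])
    rwa [Finset.sum_range, Finset.sum_congr rfl (g := fun j : Fin m => u j * S.φ j x)] at this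
    intro i _; simp
  refine ((h3.add h2).congr_fun fun j => ?_).tsum_eq
  rw [S.coeff_comb, S.coeff_tail]
  split_ifs <;> simp

lemma aestronglyMeasurable_eval (hC : ∀ j x, |S.φ j x| ≤ C) (hPr : IsGPPrior S Pr)
    (hsum : Summable fun j => √(S.lam j)) (x : 𝒳) :
    AEStronglyMeasurable (fun f => S.eval f x) Pr := by
  refine aestronglyMeasurable_of_tendsto_ae atTop
    (f := fun N f => ∑ j ∈ Finset.range N, S.coeff f j * S.φ j x) (fun N => ?_) ?_
  · exact (Finset.measurable_fun_sum _ fun j _ => (S.measurable_coeff j).mul_const _).aestronglyMeasurable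
  · filter_upwards [ae_summable_coeff hC hPr hsum] with f hf
    exact (summable_coeff_mul_φ hC hf x).hasSum.tendsto_sum_nat

lemma memLp_eval_tail (hC : ∀ j x, |S.φ j x| ≤ C) (hPr : IsGPPrior S Pr)
    (hsum : Summable fun j => √(S.lam j)) (m : ℕ) (x : 𝒳) :
    MemLp (fun f => S.eval (S.tail m f) x) 2 Pr := by
  have hms : AEStronglyMeasurable (fun f => S.eval (S.tail m f) x) Pr := by
    have h1 := aestronglyMeasurable_eval hC hPr hsum x
    have h2 : Measurable fun f => S.headEval (S.features m f) x := by
      unfold MercerKernel.headEval MercerKernel.features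
      fun_prop
    refine (h1.sub h2.aestronglyMeasurable).congr ?_
    filter_upwards [ae_summable_coeff hC hPr hsum] with f hf
    have := eval_comb hC m (S.features m f) hf x
    rw [S.comb_features] at this
    simp only [Pi.sub_apply]
    linarith
  refine ⟨hms, ?_⟩
  rw [eLpNorm_lt_top_iff_lintegral_rpow_enorm_lt_top (by norm_num) (by norm_num)]
  have hle : ∀ᵐ f ∂Pr, ‖S.eval (S.tail m f) x‖ₑ ^ (2 : ℝ≥0∞).toReal ≤
      ENNReal.ofReal C ^ 2 * (∑' j, ‖S.coeff f j‖ₑ) ^ 2 := by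
    filter_upwards [ae_summable_coeff hC hPr hsum] with f hf
    rw [ENNReal.toReal_ofNat, ENNReal.rpow_ofNat, ← mul_pow]
    gcongr
    rw [← ENNReal.tsum_mul_left]
    have hs := summable_coeff_mul_φ hC (summable_coeff_tail m hf) x
    refine (enorm_tsum_le_tsum_enorm).trans (ENNReal.tsum_le_tsum fun j => ?_)
    rw [enorm_mul, mul_comm]
    gcongr
    · rw [Real.enorm_eq_ofReal_abs]
      exact ENNReal.ofReal_le_ofReal (hC j x)
    · rw [S.coeff_tail]
      split_ifs <;> simp
  refine (lintegral_mono_ae hle).trans_lt ?_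
  rw [lintegral_const_mul' _ _ (by simp)]
  exact ENNReal.mul_lt_top (by simp) (lintegral_tsum_enorm_coeff_sq_lt_top hC hPr hsum)

lemma integral_abs_coeff_le (hC : ∀ j x, |S.φ j x| ≤ C) (hPr : IsGPPrior S Pr) (j : ℕ) :
    ∫ f, |S.coeff f j| ∂Pr ≤ √(S.lam j) := by
  have h := integral_coeff_mul_coeff hC hPr j j
  rw [if_pos rfl] at h
  refine Real.le_sqrt_of_sq_le ?_
  rw [← h]
  have hm : MemLp (fun f => |S.coeff f j|) 2 Pr := (memLp_coeff hPr j).norm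
  have := variance_nonneg (fun f => |S.coeff f j|) Pr
  rw [variance_eq_sub hm] at this
  simp only [Pi.pow_apply, sq_abs] at this
  simp only [← sq]
  linarith

lemma integral_eval_tail (hC : ∀ j x, |S.φ j x| ≤ C) (hPr : IsGPPrior S Pr)
    (hsum : Summable fun j => √(S.lam j)) (m : ℕ) (x : 𝒳) :
    ∫ f, S.eval (S.tail m f) x ∂Pr = 0 := by
  have hint : ∀ j, Integrable (fun f => S.coeff (S.tail m f) j * S.φ j x) Pr := fun j => by
    refine Integrable.mul_const ?_ _
    simp_rw [S.coeff_tail]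
    split_ifs
    · exact integrable_zero _ _ _
    · exact (memLp_coeff hPr j).integrable (by simp)
  have hle : ∀ j, ∫ f, ‖S.coeff (S.tail m f) j * S.φ j x‖ ∂Pr ≤ √(S.lam j) * C := fun j => by
    calc ∫ f, ‖S.coeff (S.tail m f) j * S.φ j x‖ ∂Pr ≤ ∫ f, |S.coeff f j| * C ∂Pr := by
          refine integral_mono (hint j).norm
            ((((memLp_coeff hPr j).integrable (by simp)).norm).mul_const C) fun f => ?_
          simp only [norm_mul, Real.norm_eq_abs, S.coeff_tail]
          refine mul_le_mul ?_ (hC j x) (abs_nonneg _) (abs_nonneg _)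
          split_ifs <;> simp
      _ ≤ √(S.lam j) * C := by
          rw [integral_mul_const]
          exact mul_le_mul_of_nonneg_right (integral_abs_coeff_le hC hPr j)
            ((abs_nonneg _).trans (hC j x))
  unfold MercerKernel.eval
  rw [← integral_tsum_of_summable_integral_norm hint (Summable.of_nonneg_of_le
    (fun j => integral_nonneg fun _ => norm_nonneg _) hle (hsum.mul_right C))]
  refine (tsum_congr fun j => ?_).trans tsum_zero
  rw [integral_mul_const]
  simp_rw [S.coeff_tail]
  split_ifs
  · simp
  · simp [integral_coeff hPr]

end Evaluation

/-! ### The variational posterior -/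

section VariationalPosterior

variable {𝒳 : Type*} [TopologicalSpace 𝒳] [MeasurableSpace 𝒳] {μ : Measure 𝒳}
  [IsProbabilityMeasure μ] [IsSeparable μ] {S : MercerKernel μ} {C : ℝ}
  {Pr : Measure (L2 μ)} [IsProbabilityMeasure Pr]

/-- The log-likelihood of the features, for the regression function `∑_{j<m} uⱼ φⱼ`. -/
noncomputable def headLogLik (S : MercerKernel μ) (σ : ℝ≥0) (m : ℕ) {n : ℕ} (z : Data 𝒳 n)
    (u : Fin m → ℝ) : ℝ :=
  -(∑ i, (z.2 i - S.headEval u (z.1 i)) ^ 2) / (2 * (σ : ℝ) ^ 2)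

/-- The optimal law of the features: the posterior in the model with prior `N(0, λⱼ)` on the first
`m` coefficients and with the residual function neglected. -/
noncomputable def headPosterior (S : MercerKernel μ) (Pr : Measure (L2 μ)) (σ : ℝ≥0) (m : ℕ)
    {n : ℕ} (z : Data 𝒳 n) : Measure (Fin m → ℝ) :=
  (Pr.map (S.features m)).tilted (headLogLik S σ m z)

lemma measurable_headEval {m : ℕ} (x : 𝒳) :
    Measurable fun u : Fin m → ℝ => S.headEval u x := by
  unfold MercerKernel.headEval
  fun_prop

lemma measurable_headLogLik (σ : ℝ≥0) (m : ℕ) {n : ℕ} (z : Data 𝒳 n) :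
    Measurable (headLogLik S σ m z) := by
  unfold headLogLik
  have := fun i => measurable_headEval (S := S) (m := m) (z.1 i)
  fun_prop

lemma headLogLik_nonpos (σ : ℝ≥0) (m : ℕ) {n : ℕ} (z : Data 𝒳 n) (u : Fin m → ℝ) :
    headLogLik S σ m z u ≤ 0 := by
  unfold headLogLik
  rw [neg_div]
  exact neg_nonpos.2 (div_nonneg (Finset.sum_nonneg fun _ _ => sq_nonneg _) (by positivity))

lemma integrable_exp_of_nonpos {α : Type*} [MeasurableSpace α] {ν : Measure α} [IsFiniteMeasure ν]
    {g : α → ℝ} (hg : AEMeasurable g ν) (h : ∀ x, g x ≤ 0) :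
    Integrable (fun x => Real.exp (g x)) ν := by
  refine Integrable.of_bound (by fun_prop) 1 (ae_of_all _ fun x => ?_)
  rw [Real.norm_eq_abs, Real.abs_exp]
  exact Real.exp_le_one_iff.2 (h x)

lemma posterior_eq_tilted (hC : ∀ j x, |S.φ j x| ≤ C) (hPr : IsGPPrior S Pr) (σ : ℝ≥0) (m : ℕ)
    {n : ℕ} (z : Data 𝒳 n) :
    posterior S Pr σ z = (headTail S Pr m (headPosterior S Pr σ m z)).tilted fun f =>
      -(∑ i, (z.2 i - S.eval f (z.1 i)) ^ 2) / (2 * (σ : ℝ) ^ 2) -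
        headLogLik S σ m z (S.features m f) := by
  rw [headPosterior, headTail_tilted hC hPr m (measurable_headLogLik σ m z),
    tilted_tilted, posterior]
  · congr 1
    funext f
    simp
  · exact integrable_exp_of_nonpos
      ((measurable_headLogLik σ m z).comp (S.measurable_features m)).aemeasurable
      fun f => headLogLik_nonpos σ m z _

lemma aemeasurable_logLik (hC : ∀ j x, |S.φ j x| ≤ C) (hPr : IsGPPrior S Pr)
    (hsum : Summable fun j => √(S.lam j)) (σ : ℝ≥0) {n : ℕ} (z : Data 𝒳 n) :
    AEMeasurable (fun f => -(∑ i, (z.2 i - S.eval f (z.1 i)) ^ 2) / (2 * (σ : ℝ) ^ 2)) Pr := by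
  have := fun i => (aestronglyMeasurable_eval hC hPr hsum (z.1 i)).aemeasurable
  fun_prop

/-- Under every law in the variational class the tail of the function is centered and independent
of the head, so the expected discrepancy between the two log-likelihoods only depends on the
second moments of the tail under the prior. -/
lemma integral_logLik_sub_headLogLik (hC : ∀ j x, |S.φ j x| ≤ C) (hPr : IsGPPrior S Pr)
    (hsum : Summable fun j => √(S.lam j)) (σ : ℝ≥0) (m : ℕ)
    {n : ℕ} (z : Data 𝒳 n) {ν : Measure (Fin m → ℝ)} [IsGaussian ν]
    (hν : ν ≪ Pr.map (S.features m)) :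
    Integrable (fun f => -(∑ i, (z.2 i - S.eval f (z.1 i)) ^ 2) / (2 * (σ : ℝ) ^ 2) -
        headLogLik S σ m z (S.features m f)) (headTail S Pr m ν) ∧
    ∫ f, (-(∑ i, (z.2 i - S.eval f (z.1 i)) ^ 2) / (2 * (σ : ℝ) ^ 2) -
        headLogLik S σ m z (S.features m f)) ∂(headTail S Pr m ν) =
      ∑ i, -(∫ f, S.eval (S.tail m f) (z.1 i) ^ 2 ∂Pr) / (2 * (σ : ℝ) ^ 2) := by
  have hac := headTail_absolutelyContinuous hC hPr m hν
  have hms : AEStronglyMeasurable (fun f =>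
      -(∑ i, (z.2 i - S.eval f (z.1 i)) ^ 2) / (2 * (σ : ℝ) ^ 2) -
        headLogLik S σ m z (S.features m f)) (headTail S Pr m ν) :=
    (((aemeasurable_logLik hC hPr hsum σ z).mono_ac hac).sub
      ((measurable_headLogLik σ m z).comp (S.measurable_features m)).aemeasurable).aestronglyMeasurable
  have hcm : AEMeasurable (S.comb m) (ν.prod Pr) := by fun_prop
  have hae : ∀ᵐ p ∂(ν.prod Pr),
      -(∑ i, (z.2 i - S.eval (S.comb m p) (z.1 i)) ^ 2) / (2 * (σ : ℝ) ^ 2) -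
        headLogLik S σ m z (S.features m (S.comb m p)) =
      ∑ i, ((z.2 i - S.headEval p.1 (z.1 i)) * (S.eval (S.tail m p.2) (z.1 i) / (σ : ℝ) ^ 2) +
        -S.eval (S.tail m p.2) (z.1 i) ^ 2 / (2 * (σ : ℝ) ^ 2)) := by
    have h0 : ∀ᵐ p ∂(ν.prod Pr), Summable fun j => |S.coeff p.2 j| :=
      Measure.quasiMeasurePreserving_snd.ae (ae_summable_coeff hC hPr hsum)
    filter_upwards [h0] with p hp
    rw [show p = (p.1, p.2) from rfl, S.features_comb]
    simp_rw [eval_comb hC m p.1 hp]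
    rw [headLogLik, neg_div, neg_div, ← sub_eq_zero]
    rw [Finset.sum_div, Finset.sum_div, sub_neg_eq_add, ← Finset.sum_neg_distrib,
      ← Finset.sum_add_distrib, ← Finset.sum_sub_distrib]
    refine Finset.sum_eq_zero fun i _ => ?_
    rcases eq_or_ne (σ : ℝ) 0 with h | h
    · simp [h]
    · field_simp
      ring
  have ht := fun i => memLp_eval_tail hC hPr hsum m (z.1 i)
  have hh : ∀ i, Integrable (fun u : Fin m → ℝ => z.2 i - S.headEval u (z.1 i)) ν := fun i => by
    refine (integrable_const _).sub ?_
    unfold MercerKernel.headEval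
    exact integrable_finsetSum _ fun j _ =>
      ((memLp_eval_of_isGaussian ν j).integrable (by simp)).mul_const _
  have hi1 : ∀ i, Integrable (fun p : (Fin m → ℝ) × L2 μ =>
      (z.2 i - S.headEval p.1 (z.1 i)) * (S.eval (S.tail m p.2) (z.1 i) / (σ : ℝ) ^ 2))
      (ν.prod Pr) := fun i => (hh i).mul_prod (((ht i).integrable (by simp)).div_const _)
  have hi2 : ∀ i, Integrable (fun p : (Fin m → ℝ) × L2 μ =>
      -S.eval (S.tail m p.2) (z.1 i) ^ 2 / (2 * (σ : ℝ) ^ 2)) (ν.prod Pr) := fun i =>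
    (((ht i).integrable_sq.neg).div_const _).comp_snd ν
  have hi : ∀ i ∈ Finset.univ, Integrable (fun p : (Fin m → ℝ) × L2 μ =>
      (z.2 i - S.headEval p.1 (z.1 i)) * (S.eval (S.tail m p.2) (z.1 i) / (σ : ℝ) ^ 2) +
        -S.eval (S.tail m p.2) (z.1 i) ^ 2 / (2 * (σ : ℝ) ^ 2)) (ν.prod Pr) :=
    fun i _ => (hi1 i).add (hi2 i)
  constructor
  · rw [headTail, integrable_map_measure hms hcm, Function.comp_def, integrable_congr hae]
    exact integrable_finsetSum _ hi
  · rw [headTail, integral_map hcm hms, integral_congr_ae hae,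
      integral_finsetSum _ hi]
    refine Finset.sum_congr rfl fun i _ => ?_
    rw [integral_add (hi1 i) (hi2 i), integral_prod_mul (μ := ν) (ν := Pr)
      (fun u => z.2 i - S.headEval u (z.1 i)) (fun f => S.eval (S.tail m f) (z.1 i) / (σ : ℝ) ^ 2),
      integral_div, integral_eval_tail hC hPr hsum,
      integral_fun_snd (μ := ν) (ν := Pr)
        (fun f => -S.eval (S.tail m f) (z.1 i) ^ 2 / (2 * (σ : ℝ) ^ 2)),
      integral_div, integral_neg]
    simp

/-- The design matrix `(φⱼ(xᵢ))`. -/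
def MercerKernel.design (S : MercerKernel μ) (m : ℕ) {n : ℕ} (x : Fin n → 𝒳) :
    Matrix (Fin n) (Fin m) ℝ :=
  Matrix.of fun i j => S.φ j (x i)

/-- The precision matrix `Λ⁻¹ + σ⁻² ΦᵀΦ` of the optimal law of the features. -/
noncomputable def precision (S : MercerKernel μ) (σ : ℝ≥0) (m : ℕ) {n : ℕ} (x : Fin n → 𝒳) :
    Matrix (Fin m) (Fin m) ℝ :=
  Matrix.diagonal (fun j : Fin m => (S.lam j)⁻¹) +
    ((σ : ℝ) ^ 2)⁻¹ • ((S.design m x).transpose * S.design m x)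

/-- The mean `(Λ⁻¹ + σ⁻² ΦᵀΦ)⁻¹ σ⁻² Φᵀ y` of the optimal law of the features. -/
noncomputable def postMean (S : MercerKernel μ) (σ : ℝ≥0) (m : ℕ) {n : ℕ} (z : Data 𝒳 n) :
    Fin m → ℝ :=
  (precision S σ m z.1)⁻¹.mulVec (((σ : ℝ) ^ 2)⁻¹ • (S.design m z.1).transpose.mulVec z.2)

lemma design_mulVec (m : ℕ) {n : ℕ} (x : Fin n → 𝒳) (u : Fin m → ℝ) (i : Fin n) :
    (S.design m x).mulVec u i = S.headEval u (x i) := by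
  simp [MercerKernel.design, MercerKernel.headEval, Matrix.mulVec, dotProduct, mul_comm]

lemma dotProduct_precision_mulVec (σ : ℝ≥0) (m : ℕ) {n : ℕ} (x : Fin n → 𝒳) (u : Fin m → ℝ) :
    u ⬝ᵥ (precision S σ m x).mulVec u =
      ∑ j : Fin m, u j ^ 2 / S.lam j + (∑ i, S.headEval u (x i) ^ 2) / (σ : ℝ) ^ 2 := by
  rw [precision, Matrix.add_mulVec, dotProduct_add, Matrix.smul_mulVec, dotProduct_smul,
    ← Matrix.mulVec_mulVec, Matrix.dotProduct_mulVec u (S.design m x).transpose,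
    ← Matrix.mulVec_transpose, Matrix.transpose_transpose]
  congr 1
  · simp only [dotProduct, Matrix.mulVec_diagonal]
    exact Finset.sum_congr rfl fun j _ => by ring
  · simp only [dotProduct, design_mulVec, smul_eq_mul]
    rw [inv_mul_eq_div]
    simp_rw [sq]

lemma posDef_precision (hpos : ∀ j, 0 < S.lam j) (σ : ℝ≥0) (m : ℕ) {n : ℕ} (x : Fin n → 𝒳) :
    (precision S σ m x).PosDef := by
  refine Matrix.PosDef.add_posSemidef
    (Matrix.PosDef.diagonal fun j : Fin m => inv_pos.2 (hpos j)) ?_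
  refine Matrix.PosSemidef.smul ?_ (by positivity)
  simpa using Matrix.posSemidef_conjTranspose_mul_self (S.design m x)

lemma headPosterior_eq_gaussVec (hC : ∀ j x, |S.φ j x| ≤ C) (hPr : IsGPPrior S Pr)
    (hpos : ∀ j, 0 < S.lam j) {σ : ℝ≥0} (m : ℕ) {n : ℕ} (z : Data 𝒳 n)
    {B : Matrix (Fin m) (Fin m) ℝ} (hB : B.det ≠ 0)
    (hAB : B * B.transpose = (precision S σ m z.1)⁻¹) :
    headPosterior S Pr σ m z = gaussVec (postMean S σ m z) B := by
  have hv : ∀ j : Fin m, (S.lam j).toNNReal ≠ 0 := fun j => by simpa using hpos j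
  have h1 := pi_gaussianReal_eq_tilted hv
  rw [headPosterior, map_features hC hPr, h1, tilted_tilted, postMean,
    ← tilted_quadratic_eq_gaussVec (posDef_precision hpos σ m z.1) hB hAB]
  · rw [← tilted_add_const _ _ ((∑ i, z.2 i ^ 2) / (2 * (σ : ℝ) ^ 2))]
    congr 1
    funext u
    rw [dotProduct_precision_mulVec, smul_dotProduct, Matrix.mulVec_transpose,
      ← Matrix.dotProduct_mulVec]
    simp only [Pi.add_apply, headLogLik, dotProduct, design_mulVec, smul_eq_mul]
    have e1 : ∑ j : Fin m, -u j ^ 2 / (2 * ((S.lam j).toNNReal : ℝ)) =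
        -(∑ j : Fin m, u j ^ 2 / S.lam j) / 2 := by
      rw [← Finset.sum_neg_distrib, Finset.sum_div]
      refine Finset.sum_congr rfl fun j _ => ?_
      rw [Real.coe_toNNReal _ (hpos j).le]
      ring
    have e2 : ∑ i, (z.2 i - S.headEval u (z.1 i)) ^ 2 = ∑ i, z.2 i ^ 2 -
        2 * ∑ i, z.2 i * S.headEval u (z.1 i) + ∑ i, S.headEval u (z.1 i) ^ 2 := by
      rw [Finset.mul_sum, ← Finset.sum_sub_distrib, ← Finset.sum_add_distrib]
      exact Finset.sum_congr rfl fun i _ => by ring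
    rw [e1, e2]
    ring
  · by_contra hc
    rw [tilted_of_not_integrable hc] at h1
    exact IsProbabilityMeasure.ne_zero _ h1

lemma exists_headPosterior_eq_gaussVec (hC : ∀ j x, |S.φ j x| ≤ C) (hPr : IsGPPrior S Pr)
    (hpos : ∀ j, 0 < S.lam j) (σ : ℝ≥0) (m : ℕ) {n : ℕ} (z : Data 𝒳 n) :
    ∃ B : Matrix (Fin m) (Fin m) ℝ, B.det ≠ 0 ∧ B * B.transpose = (precision S σ m z.1)⁻¹ ∧
      headPosterior S Pr σ m z = gaussVec (postMean S σ m z) B := by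
  obtain ⟨B, hB, hAB⟩ := exists_mul_transpose_eq (posDef_precision hpos σ m z.1).inv
  exact ⟨B, hB, hAB, headPosterior_eq_gaussVec hC hPr hpos m z hB hAB⟩

/-- The divergence to the posterior has exactly one minimiser over the variational class. -/
theorem isVariationalPosterior_iff (hC : ∀ j x, |S.φ j x| ≤ C) (hPr : IsGPPrior S Pr)
    (hpos : ∀ j, 0 < S.lam j) (hsum : Summable fun j => √(S.lam j)) (σ : ℝ≥0) (m : ℕ)
    {n : ℕ} (z : Data 𝒳 n) (Ψ : Measure (L2 μ)) :
    IsVariationalPosterior S Pr σ m z Ψ ↔ Ψ = headTail S Pr m (headPosterior S Pr σ m z) := by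
  obtain ⟨B, hB, -, hν⟩ := exists_headPosterior_eq_gaussVec hC hPr hpos σ m z
  rw [IsVariationalPosterior, posterior_eq_tilted hC hPr σ m z]
  refine existsUnique_minimizer_klDiv_tilted (h := fun f =>
    -(∑ i, (z.2 i - S.eval f (z.1 i)) ^ 2) / (2 * (σ : ℝ) ^ 2) -
      headLogLik S σ m z (S.features m f))
    (κ := ∑ i, -(∫ f, S.eval (S.tail m f) (z.1 i) ^ 2 ∂Pr) / (2 * (σ : ℝ) ^ 2))
    ?_ ?_ ?_ ?_ ?_ Ψ
  · exact (mem_variationalClass_iff hC hPr hpos).2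
      ⟨_, hν ▸ isNondegenerateGaussian_gaussVec _ hB, rfl⟩
  · intro Ψ' hΨ'
    obtain ⟨ν, hν, rfl⟩ := (mem_variationalClass_iff hC hPr hpos).1 hΨ'
    have := hν.1
    infer_instance
  · have hm := (measurable_headLogLik (S := S) σ m z).comp (S.measurable_features m)
    rw [headPosterior, headTail_tilted hC hPr m (measurable_headLogLik σ m z),
      integrable_tilted_iff (integrable_exp_of_nonpos hm.aemeasurable
        fun f => headLogLik_nonpos σ m z _)]
    refine (integrable_exp_of_nonpos (aemeasurable_logLik hC hPr hsum σ z) fun f => ?_).congr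
      (ae_of_all _ fun f => ?_)
    · rw [neg_div]
      exact neg_nonpos.2 (div_nonneg (Finset.sum_nonneg fun _ _ => sq_nonneg _) (by positivity))
    · simp only [Function.comp_apply, smul_eq_mul, ← Real.exp_add]
      congr 1
      ring
  · intro Ψ' hΨ'
    obtain ⟨ν, hν, rfl⟩ := (mem_variationalClass_iff hC hPr hpos).1 hΨ'
    have := hν.1
    exact (integral_logLik_sub_headLogLik hC hPr hsum σ m z
      (hν.absolutelyContinuous_map_features hC hPr hpos)).1
  · intro Ψ' hΨ'
    obtain ⟨ν, hν, rfl⟩ := (mem_variationalClass_iff hC hPr hpos).1 hΨ'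
    have := hν.1
    exact (integral_logLik_sub_headLogLik hC hPr hsum σ m z
      (hν.absolutelyContinuous_map_features hC hPr hpos)).2

lemma variationalPosterior_eq (hC : ∀ j x, |S.φ j x| ≤ C) (hPr : IsGPPrior S Pr)
    (hpos : ∀ j, 0 < S.lam j) (hsum : Summable fun j => √(S.lam j)) (σ : ℝ≥0) (m : ℕ)
    {n : ℕ} (z : Data 𝒳 n) :
    variationalPosterior S Pr σ m z = headTail S Pr m (headPosterior S Pr σ m z) := by
  have h := isVariationalPosterior_iff hC hPr hpos hsum σ m z
  have hex : ∃ Ψ, IsVariationalPosterior S Pr σ m z Ψ := ⟨_, (h _).2 rfl⟩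
  rw [variationalPosterior, dif_pos hex]
  exact (h _).1 hex.choose_spec

end VariationalPosterior

/-! ### Small balls and lower bounds on the contraction rate -/

section SmallBall

lemma integral_exp_neg_sq_gaussianReal_le {v : ℝ≥0} (hv : v ≠ 0) {a : ℝ} (ha : 0 < a) (h : ℝ) :
    ∫ w, Real.exp (-a * (w - h) ^ 2) ∂(gaussianReal 0 v) ≤ (√(1 + 2 * a * v))⁻¹ := by
  have hv' : (0 : ℝ) < v := by positivity
  set b : ℝ := (2 * (v : ℝ))⁻¹ + a
  have hb : 0 < b := by positivity
  rw [integral_gaussianReal_eq_integral_smul hv]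
  have hle : ∀ w, gaussianPDFReal 0 v w • Real.exp (-a * (w - h) ^ 2) ≤
      (√(2 * Real.pi * v))⁻¹ * Real.exp (-b * (w - a * h / b) ^ 2) := fun w => by
    rw [gaussianPDFReal, smul_eq_mul, mul_assoc, ← Real.exp_add]
    refine mul_le_mul_of_nonneg_left (Real.exp_le_exp.2 ?_) (by positivity)
    have : -(w - 0) ^ 2 / (2 * (v : ℝ)) + -a * (w - h) ^ 2 =
        -b * (w - a * h / b) ^ 2 - a * h ^ 2 * (2 * (v : ℝ))⁻¹ / b := by
      field_simp
      simp only [b]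
      field_simp
      ring
    rw [this]
    have : 0 ≤ a * h ^ 2 * (2 * (v : ℝ))⁻¹ / b := by positivity
    linarith
  have hint : Integrable fun w : ℝ => (√(2 * Real.pi * v))⁻¹ *
      Real.exp (-b * (w - a * h / b) ^ 2) :=
    ((integrable_exp_neg_mul_sq hb).comp_sub_right (a * h / b)).const_mul _
  calc _ ≤ ∫ w, (√(2 * Real.pi * v))⁻¹ * Real.exp (-b * (w - a * h / b) ^ 2) :=
        integral_mono_of_nonneg (ae_of_all _ fun w => by
          have := gaussianPDFReal_nonneg 0 v w
          simp only [Pi.zero_apply, smul_eq_mul]; positivity) hint (ae_of_all _ hle)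
    _ = (√(2 * Real.pi * v))⁻¹ * √(Real.pi / b) := by
        rw [integral_const_mul,
          integral_sub_right_eq_self (fun w => Real.exp (-b * w ^ 2)) (a * h / b),
          integral_gaussian]
    _ = (√(1 + 2 * a * v))⁻¹ := by
        rw [← Real.sqrt_inv, ← Real.sqrt_inv, ← Real.sqrt_mul (by positivity)]
        congr 1
        simp only [b]
        field_simp

variable {𝒳 : Type*} [TopologicalSpace 𝒳] [MeasurableSpace 𝒳] {μ : Measure 𝒳}
  [IsProbabilityMeasure μ] [IsSeparable μ] {S : MercerKernel μ} {C : ℝ}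
  {Pr : Measure (L2 μ)} [IsProbabilityMeasure Pr]

/-- A small-ball estimate which holds uniformly over all centers: the tail of `f` alone, which
under every member of the variational class is distributed as under the prior, makes
`‖f - f₀‖ ≤ s` unlikely unless `s²` is at least of the order of `(m + 1) λ_{2m}`. -/
lemma headTail_ball_le (hC : ∀ j x, |S.φ j x| ≤ C) (hPr : IsGPPrior S Pr)
    (hpos : ∀ j, 0 < S.lam j) (m : ℕ) (ν : Measure (Fin m → ℝ)) [IsProbabilityMeasure ν]
    (f₀ : L2 μ) {s : ℝ} (hs : 0 < s) :
    headTail S Pr m ν {f | ‖f - f₀‖ ≤ s} ≤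
      ENNReal.ofReal (Real.exp 1 * (√(1 + (m + 1) * (2 * S.lam (2 * m) / s ^ 2)))⁻¹) := by
  -- Markov's inequality for `g`, the exponential of minus `s⁻²` times the squared distance in the
  -- coefficients `m, …, 2m`, whose variances are at least `λ_{2m}`
  set N : ℕ := 2 * m + 1
  set I : Finset (Fin N) := Finset.univ.filter fun j => m ≤ (j : ℕ)
  set g : (Fin N → ℝ) → ℝ := fun w =>
    ∏ j : Fin N, if m ≤ (j : ℕ) then Real.exp (-(s ^ 2)⁻¹ * (w j - S.coeff f₀ j) ^ 2) else 1
  have hg : Measurable g := by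
    refine Finset.measurable_fun_prod _ fun j _ => ?_
    split_ifs <;> fun_prop
  have hg0 : ∀ w, 0 ≤ g w := fun w => Finset.prod_nonneg fun j _ => by split_ifs <;> positivity
  have hg1 : ∀ w, g w ≤ 1 := fun w => Finset.prod_le_one (fun j _ => by split_ifs <;> positivity)
    fun j _ => by
      split_ifs
      · refine Real.exp_le_one_iff.2 ?_
        rw [neg_mul]
        exact neg_nonpos.2 (by positivity)
      · exact le_rfl
  -- on the ball, the exponential of minus the squared tail norm is bounded from below
  have hsub : ∀ p : (Fin m → ℝ) × L2 μ, ‖S.comb m p - f₀‖ ≤ s →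
      Real.exp (-1) ≤ g (S.features N p.2) := fun p hp => by
    have h1 : ∑ j ∈ I, (S.coeff p.2 j - S.coeff f₀ j) ^ 2 ≤ s ^ 2 := by
      have h2 := S.hasSum_sq_coeff (S.comb m p - f₀)
      have h3 : ∑ j ∈ I, S.coeff (S.comb m p - f₀) j ^ 2 ≤ ‖S.comb m p - f₀‖ ^ 2 := by
        have := sum_le_hasSum (I.map Fin.valEmbedding) (fun _ _ => sq_nonneg _) h2
        simpa using this
      refine (le_of_eq (Finset.sum_congr rfl fun j hj => ?_)).trans
        (h3.trans (pow_le_pow_left₀ (norm_nonneg _) hp 2))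
      have hj' : ¬ (j : ℕ) < m := not_lt.2 (Finset.mem_filter.1 hj).2
      rw [S.coeff_sub, show p = (p.1, p.2) from rfl, S.coeff_comb, dif_neg hj']
    simp only [g]
    rw [← Finset.prod_filter, ← Real.exp_sum, Real.exp_le_exp, ← Finset.mul_sum, neg_mul,
      neg_le_neg_iff, inv_mul_le_iff₀ (by positivity), mul_one]
    exact h1
  have hint : ∫ f, g (S.features N f) ∂Pr ≤ (√(1 + (m + 1) * (2 * S.lam (2 * m) / s ^ 2)))⁻¹ := by
    have h1 : ∫ f, g (S.features N f) ∂Pr = ∫ w, g w ∂(Pr.map (S.features N)) := by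
      rw [integral_map (by fun_prop) hg.aestronglyMeasurable]
    rw [h1, map_features hC hPr]
    have h2 := integral_fintype_prod_eq_prod
      (μ := fun j : Fin N => gaussianReal 0 (S.lam j).toNNReal)
      (fun (j : Fin N) (x : ℝ) => if m ≤ (j : ℕ) then
        Real.exp (-(s ^ 2)⁻¹ * (x - S.coeff f₀ j) ^ 2) else 1)
    refine h2.trans_le ?_
    calc _ ≤ ∏ j : Fin N, (if m ≤ (j : ℕ) then (√(1 + 2 * S.lam (2 * m) / s ^ 2))⁻¹ else 1) := by
          refine Finset.prod_le_prod (fun j _ => integral_nonneg fun x => ?_) fun j _ => ?_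
          · split_ifs <;> positivity
          · split_ifs with hj
            · refine (integral_exp_neg_sq_gaussianReal_le (by simpa using hpos j)
                (by positivity) _).trans ?_
              rw [Real.coe_toNNReal _ (hpos j).le]
              have h3 : S.lam (2 * m) ≤ S.lam j := S.lam_antitone (by omega)
              have := hpos (2 * m)
              gcongr ?_⁻¹
              refine Real.sqrt_le_sqrt ?_
              rw [mul_div_right_comm, mul_comm 2 (s ^ 2)⁻¹, ← div_eq_inv_mul]
              gcongr
            · simp
      _ = (√((1 + 2 * S.lam (2 * m) / s ^ 2) ^ (m + 1)))⁻¹ := by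
          rw [← Finset.prod_filter, Finset.prod_const]
          have hcard : I.card = m + 1 := by
            have : I = Finset.Ici (⟨m, by omega⟩ : Fin N) := by
              ext j; simp [I, Fin.le_def]
            rw [this, Fin.card_Ici]
            simp only [N]; omega
          have h0 : 0 ≤ 1 + 2 * S.lam (2 * m) / s ^ 2 := by
            have := hpos (2 * m)
            positivity
          rw [hcard, inv_pow]
          congr 1
          refine ((Real.sqrt_eq_iff_mul_self_eq (pow_nonneg h0 _) (by positivity)).2 ?_).symm
          rw [← mul_pow, Real.mul_self_sqrt h0]
      _ ≤ _ := by
          have := hpos (2 * m)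
          gcongr ?_⁻¹
          refine Real.sqrt_le_sqrt ?_
          have h4 := one_add_mul_le_pow (a := 2 * S.lam (2 * m) / s ^ 2)
            (by have : 0 ≤ 2 * S.lam (2 * m) / s ^ 2 := by positivity
                linarith) (m + 1)
          push_cast at h4
          exact h4
  have hmg : Measurable fun f => g (S.features N f) := hg.comp (by fun_prop)
  have hmarkov := mul_meas_ge_le_integral_of_nonneg (μ := Pr)
    (ae_of_all _ fun f => hg0 (S.features N f))
    (Integrable.of_bound hmg.aestronglyMeasurable 1 (ae_of_all _ fun f => by
      rw [Real.norm_eq_abs, abs_of_nonneg (hg0 _)]; exact hg1 _)) (Real.exp (-1))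
  have hms : MeasurableSet {f : L2 μ | ‖f - f₀‖ ≤ s} :=
    measurableSet_le (by fun_prop) measurable_const
  have hms2 : MeasurableSet {f : L2 μ | Real.exp (-1) ≤ g (S.features N f)} :=
    measurableSet_le measurable_const hmg
  calc headTail S Pr m ν {f | ‖f - f₀‖ ≤ s}
      ≤ (ν.prod Pr) (Prod.snd ⁻¹' {f | Real.exp (-1) ≤ g (S.features N f)}) := by
        rw [headTail, Measure.map_apply (by fun_prop) hms]
        exact measure_mono fun p hp => hsub p hp
    _ = Pr {f | Real.exp (-1) ≤ g (S.features N f)} := by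
        rw [← Measure.map_apply measurable_snd hms2, Measure.map_snd_prod]
        simp
    _ = ENNReal.ofReal (Pr.real {f | Real.exp (-1) ≤ g (S.features N f)}) := by
        rw [ofReal_measureReal]
    _ ≤ _ := by
        refine ENNReal.ofReal_le_ofReal ?_
        rw [← inv_mul_le_iff₀ (Real.exp_pos 1), ← Real.exp_neg]
        exact hmarkov.trans hint

end SmallBall

section RateLowerBound

variable {𝒳 : Type*} [MeasurableSpace 𝒳] {μ : Measure 𝒳}

lemma measurable_dataMap (f : L2 μ) (n : ℕ) :
    Measurable fun p : (Fin n → 𝒳) × (Fin n → ℝ) => (p.1, fun i => f (p.1 i) + p.2 i) := by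
  have hf : Measurable f := (Lp.stronglyMeasurable f).measurable
  fun_prop

instance isProbabilityMeasure_dataLaw [TopologicalSpace 𝒳] [IsProbabilityMeasure μ] (σ : ℝ≥0)
    (f : L2 μ) (n : ℕ) : IsProbabilityMeasure (dataLaw σ f n) :=
  Measure.isProbabilityMeasure_map (measurable_dataMap f n).aemeasurable

/-- If balls of radius `a n` around `f₀` have probability at most `q n → 0`, uniformly in the data,
then no rate of smaller order than `a n` is a contraction rate at `f₀`. -/
lemma isBigO_of_contractsAtRate [TopologicalSpace 𝒳] [IsProbabilityMeasure μ] {σ : ℝ≥0}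
    {Ψ : ∀ n, Data 𝒳 n → Measure (L2 μ)}
    (hΨ : ∀ n z, IsProbabilityMeasure (Ψ n z)) {f₀ : L2 μ} {a : ℕ → ℝ} {q : ℕ → ℝ≥0∞}
    (hq : Tendsto q atTop (𝓝 0)) (ha : ∀ n, 0 ≤ a n)
    (hball : ∀ᶠ n in atTop, ∀ z, Ψ n z {f | ‖f - f₀‖ ≤ a n} ≤ q n) {ε : ℕ → ℝ}
    (hε : ContractsAtRate σ Ψ f₀ ε) : a =O[atTop] ε := by
  by_contra hO
  rw [isBigO_iff] at hO
  push Not at hO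
  have hfreq : ∀ k : ℕ, ∃ᶠ n in atTop, (k : ℝ) * ‖ε n‖ < ‖a n‖ := fun k => by
    have := hO k
    simpa [Filter.Frequently, Filter.Eventually] using this
  -- along a subsequence `φ` with `k ε (φ k) < a (φ k)`, take `M (φ k) = k`
  obtain ⟨φ, hφ, hφk⟩ := extraction_forall_of_frequently hfreq
  classical
  set M : ℕ → ℝ := fun n => if h : ∃ k, φ k = n then (h.choose : ℝ) else n
  have hMφ : ∀ k, M (φ k) = k := fun k => by
    have h : ∃ l, φ l = φ k := ⟨k, rfl⟩
    simp only [M, dif_pos h]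
    exact_mod_cast hφ.injective h.choose_spec
  have hM : Tendsto M atTop atTop := by
    refine tendsto_atTop.2 fun b => ?_
    obtain ⟨K, hK⟩ := exists_nat_ge b
    filter_upwards [eventually_ge_atTop (φ K)] with n hn
    by_cases h : ∃ k, φ k = n
    · obtain ⟨k, rfl⟩ := h
      rw [hMφ]
      exact hK.trans (by exact_mod_cast hφ.le_iff_le.1 hn)
    · simp only [M, dif_neg h]
      exact hK.trans (by exact_mod_cast (hφ.id_le K).trans hn)
  have h1 := (hε M hM).comp hφ.tendsto_atTop
  have h2 : ∀ᶠ k in atTop, 1 - q (φ k) ≤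
      ∫⁻ z, Ψ (φ k) z {f | M (φ k) * ε (φ k) ≤ ‖f - f₀‖} ∂(dataLaw σ f₀ (φ k)) := by
    filter_upwards [hφ.tendsto_atTop.eventually hball] with k hk
    calc 1 - q (φ k) = ∫⁻ _, (1 - q (φ k)) ∂(dataLaw σ f₀ (φ k)) := by simp
      _ ≤ _ := by
        refine lintegral_mono fun z => ?_
        have hp := hΨ (φ k) z
        have hms : MeasurableSet {f : L2 μ | ‖f - f₀‖ ≤ a (φ k)} :=
          measurableSet_le (by fun_prop) measurable_const
        have h3 : 1 - q (φ k) ≤ Ψ (φ k) z {f | ‖f - f₀‖ ≤ a (φ k)}ᶜ := by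
          rw [prob_compl_eq_one_sub hms]
          exact tsub_le_tsub_left (hk z) 1
        refine h3.trans (measure_mono fun f hf => ?_)
        have hf' : a (φ k) < ‖f - f₀‖ := not_le.1 hf
        have h4 := hφk k
        rw [Real.norm_eq_abs, Real.norm_eq_abs, abs_of_nonneg (ha _)] at h4
        change M (φ k) * ε (φ k) ≤ ‖f - f₀‖
        rw [hMφ]
        have : (k : ℝ) * ε (φ k) ≤ k * |ε (φ k)| :=
          mul_le_mul_of_nonneg_left (le_abs_self _) (Nat.cast_nonneg k)
        linarith
  have h3 : Tendsto (fun k => 1 - q (φ k)) atTop (𝓝 (1 - 0)) :=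
    ENNReal.Tendsto.sub tendsto_const_nhds (hq.comp hφ.tendsto_atTop) (by simp)
  have := le_of_tendsto_of_tendsto h3 h1 h2
  simp at this

end RateLowerBound

/-! ### Polynomially decaying eigenvalues -/

section Decay

lemma exists_bounds_of_isTheta_top {l g : ℕ → ℝ} (hl : ∀ j, 0 ≤ l j) (hg : ∀ j, 0 < g j)
    (h : l =Θ[⊤] g) : ∃ c C : ℝ, 0 < c ∧ 0 < C ∧ (∀ j, c * g j ≤ l j) ∧ ∀ j, l j ≤ C * g j := by
  obtain ⟨C, hC, h1⟩ := h.1.exists_pos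
  obtain ⟨c, hc, h2⟩ := h.2.exists_pos
  rw [isBigOWith_top] at h1 h2
  refine ⟨c⁻¹, C, inv_pos.2 hc, hC, fun j => ?_, fun j => ?_⟩
  · have := h2 j
    rw [Real.norm_of_nonneg (hl j), Real.norm_of_nonneg (hg j).le] at this
    rwa [inv_mul_le_iff₀ hc]
  · have := h1 j
    rwa [Real.norm_of_nonneg (hl j), Real.norm_of_nonneg (hg j).le] at this

lemma summable_sqrt_of_le {l : ℕ → ℝ} {C q : ℝ} (hq : 1 < q)
    (hu : ∀ j : ℕ, l j ≤ C * ((j : ℝ) + 1) ^ (-1 - q)) : Summable fun j => √(l j) := by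
  have h1 : Summable fun j : ℕ => √C * ((j : ℝ) + 1) ^ (-((1 + q) / 2)) := by
    have h2 : Summable fun j : ℕ => ((j : ℝ)) ^ (-((1 + q) / 2)) :=
      Real.summable_nat_rpow.2 (by linarith)
    have h3 := (summable_nat_add_iff 1).2 h2
    simpa using h3.mul_left (√C)
  refine h1.of_nonneg_of_le (fun j => Real.sqrt_nonneg _) fun j => ?_
  have hj : (0 : ℝ) < (j : ℝ) + 1 := by positivity
  refine (Real.sqrt_le_sqrt (hu j)).trans (le_of_eq ?_)
  rw [Real.sqrt_mul' _ (by positivity), Real.sqrt_eq_rpow (_ ^ _), ← Real.rpow_mul hj.le]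
  congr 2
  ring

/-- The comparison of a tail sum with an integral, in the telescoping form
`(j + 1)^{-q-1} ≤ j^{-q} - (j + 1)^{-q}` for `q ≥ 1`, from Bernoulli's inequality. -/
lemma rpow_succ_le_sub {q : ℝ} (hq : 1 ≤ q) {x : ℝ} (hx : 0 < x) :
    (x + 1) ^ (-1 - q) ≤ x ^ (-q) - (x + 1) ^ (-q) := by
  have hx1 : 0 < x + 1 := by linarith
  have h1 := one_add_mul_self_le_rpow_one_add (s := x⁻¹) (p := q)
    (by have := inv_pos.2 hx; linarith) hq
  have h2 : 1 + x⁻¹ = (x + 1) / x := by field_simp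
  rw [h2, Real.div_rpow hx1.le hx.le, le_div_iff₀ (by positivity)] at h1
  rw [show -1 - q = -q + -1 by ring, Real.rpow_add hx1, Real.rpow_neg_one, Real.rpow_neg hx.le,
    Real.rpow_neg hx1.le]
  have h3 : 0 < x ^ q := by positivity
  have h4 : 0 < (x + 1) ^ q := by positivity
  have h5 : (1 + (x + 1)⁻¹) * x ^ q ≤ (x + 1) ^ q := by
    refine le_trans ?_ h1
    gcongr
    calc (x + 1)⁻¹ ≤ x⁻¹ := by gcongr; linarith
      _ ≤ q * x⁻¹ := le_mul_of_one_le_left (by positivity) hq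
  rw [le_sub_iff_add_le]
  calc ((x + 1) ^ q)⁻¹ * (x + 1)⁻¹ + ((x + 1) ^ q)⁻¹
      = ((1 + (x + 1)⁻¹) * x ^ q) * ((x + 1) ^ q)⁻¹ * (x ^ q)⁻¹ := by
        field_simp
        ring
    _ ≤ (x + 1) ^ q * ((x + 1) ^ q)⁻¹ * (x ^ q)⁻¹ := by gcongr
    _ = (x ^ q)⁻¹ := by rw [mul_inv_cancel₀ h4.ne', one_mul]

lemma sum_tail_rpow_le {q : ℝ} (hq : 1 ≤ q) {m : ℕ} (hm : 0 < m) (k : ℕ) :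
    ∑ j ∈ Finset.range k, (((j + m : ℕ) : ℝ) + 1) ^ (-1 - q) ≤ (m : ℝ) ^ (-q) := by
  have h : ∀ k : ℕ, ∑ j ∈ Finset.range k, (((j + m : ℕ) : ℝ) + 1) ^ (-1 - q) ≤
      (m : ℝ) ^ (-q) - ((k + m : ℕ) : ℝ) ^ (-q) := fun k => by
    induction k with
    | zero => simp
    | succ k ih =>
      rw [Finset.sum_range_succ]
      have := rpow_succ_le_sub hq (x := ((k + m : ℕ) : ℝ)) (by positivity)
      have h2 : ((k + 1 + m : ℕ) : ℝ) = ((k + m : ℕ) : ℝ) + 1 := by push_cast; ring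
      rw [h2]
      linarith
  have := h k
  have h2 : 0 ≤ ((k + m : ℕ) : ℝ) ^ (-q) := by positivity
  linarith

lemma tsum_tail_le {l : ℕ → ℝ} {C q : ℝ} (hq : 1 ≤ q) (hl : ∀ j, 0 ≤ l j) (hC : 0 ≤ C)
    (hu : ∀ j : ℕ, l j ≤ C * ((j : ℝ) + 1) ^ (-1 - q)) {m : ℕ} (hm : 0 < m) :
    ∑' j, l (j + m) ≤ C * (m : ℝ) ^ (-q) := by
  refine Real.tsum_le_of_sum_range_le (fun j => hl _) fun k => ?_
  calc ∑ j ∈ Finset.range k, l (j + m)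
      ≤ ∑ j ∈ Finset.range k, C * (((j + m : ℕ) : ℝ) + 1) ^ (-1 - q) :=
        Finset.sum_le_sum fun j _ => hu _
    _ ≤ _ := by
        rw [← Finset.mul_sum]
        exact mul_le_mul_of_nonneg_left (sum_tail_rpow_le hq hm k) hC

/-- With `m ≲ n^r` features, the small-ball bound at radius `n^{-p}` vanishes as soon as
`2 p > q r`. -/
lemma tendsto_smallBall_bound {l : ℕ → ℝ} {c q : ℝ} (hc : 0 < c) (hq : 0 ≤ q)
    (hlow : ∀ j : ℕ, c * ((j : ℝ) + 1) ^ (-1 - q) ≤ l j) {m : ℕ → ℕ} {r : ℝ} (hr : 0 ≤ r)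
    (hm : (fun n => (m n : ℝ)) =O[atTop] fun n : ℕ => (n : ℝ) ^ r) {p : ℝ} (hp : q * r < 2 * p)
    {M : ℝ} (hM : 0 < M) :
    Tendsto (fun n : ℕ => ENNReal.ofReal (Real.exp 1 *
      (√(1 + (m n + 1) * (2 * l (2 * m n) / (M * (n : ℝ) ^ (-p)) ^ 2)))⁻¹)) atTop (𝓝 0) := by
  obtain ⟨A, hA, hmA⟩ := hm.exists_pos
  rw [isBigOWith_iff] at hmA
  set K : ℝ := 2 * c * 2 ^ (-1 - q) * (A + 1) ^ (-q) / M ^ 2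
  have hK : 0 < K := by positivity
  have hle : ∀ᶠ n : ℕ in atTop, K * (n : ℝ) ^ (2 * p - q * r) ≤
      1 + (m n + 1) * (2 * l (2 * m n) / (M * (n : ℝ) ^ (-p)) ^ 2) := by
    filter_upwards [hmA, eventually_ge_atTop 1] with n hn hn1
    have hn0 : (0 : ℝ) < n := by exact_mod_cast hn1
    have hm1 : (m n : ℝ) + 1 ≤ (A + 1) * (n : ℝ) ^ r := by
      rw [Real.norm_of_nonneg (by positivity), Real.norm_of_nonneg (by positivity)] at hn
      have : 1 ≤ (n : ℝ) ^ r := Real.one_le_rpow (by exact_mod_cast hn1) hr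
      linarith
    have hm0 : (0 : ℝ) < m n + 1 := by positivity
    have h1 : c * 2 ^ (-1 - q) * ((m n : ℝ) + 1) ^ (-1 - q) ≤ l (2 * m n) := by
      refine le_trans ?_ (hlow _)
      rw [mul_assoc, ← Real.mul_rpow (by norm_num) hm0.le]
      refine mul_le_mul_of_nonneg_left ?_ hc.le
      refine Real.rpow_le_rpow_of_nonpos (by positivity) ?_ (by linarith)
      push_cast
      linarith
    have h2 : ((A + 1) * (n : ℝ) ^ r) ^ (-q) ≤ ((m n : ℝ) + 1) ^ (-q) :=
      Real.rpow_le_rpow_of_nonpos hm0 hm1 (by linarith)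
    have h3 : c * 2 ^ (-1 - q) * ((A + 1) ^ (-q) * (n : ℝ) ^ (-(q * r))) ≤
        (m n + 1) * l (2 * m n) := by
      calc _ ≤ c * 2 ^ (-1 - q) * ((m n : ℝ) + 1) ^ (-q) := by
            rw [Real.mul_rpow (by positivity) (by positivity), ← Real.rpow_mul hn0.le] at h2
            rw [show -(q * r) = r * -q by ring]
            gcongr
        _ = (m n + 1) * (c * 2 ^ (-1 - q) * ((m n : ℝ) + 1) ^ (-1 - q)) := by
            rw [show -q = 1 + (-1 - q) by ring, Real.rpow_add hm0, Real.rpow_one]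
            ring_nf
        _ ≤ _ := by gcongr
    have h4 : (M * (n : ℝ) ^ (-p)) ^ 2 = M ^ 2 * (n : ℝ) ^ (-(2 * p)) := by
      rw [mul_pow, ← Real.rpow_mul_natCast hn0.le]
      congr 2
      push_cast
      ring
    calc K * (n : ℝ) ^ (2 * p - q * r)
        = 2 * (c * 2 ^ (-1 - q) * ((A + 1) ^ (-q) * (n : ℝ) ^ (-(q * r)))) /
            (M ^ 2 * (n : ℝ) ^ (-(2 * p))) := by
          rw [show 2 * p - q * r = -(q * r) - -(2 * p) by ring, Real.rpow_sub hn0]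
          simp only [K]
          have : 0 < (n : ℝ) ^ (-(2 * p)) := by positivity
          field_simp
      _ ≤ 2 * ((m n + 1) * l (2 * m n)) / (M ^ 2 * (n : ℝ) ^ (-(2 * p))) := by gcongr
      _ = (m n + 1) * (2 * l (2 * m n) / (M * (n : ℝ) ^ (-p)) ^ 2) := by rw [h4]; ring
      _ ≤ _ := by linarith
  have h1 : Tendsto (fun n : ℕ => K * (n : ℝ) ^ (2 * p - q * r)) atTop atTop :=
    ((tendsto_rpow_atTop (by linarith)).comp tendsto_natCast_atTop_atTop).const_mul_atTop hK
  have h2 := tendsto_atTop_mono' _ hle h1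
  have h3 := ((Real.tendsto_sqrt_atTop.comp h2).inv_tendsto_atTop).const_mul (Real.exp 1)
  have h4 := ENNReal.tendsto_ofReal h3
  simpa using h4

end Decay

/-! ### Too few features -/

section Suboptimal

variable {𝒳 : Type*} [TopologicalSpace 𝒳] [MeasurableSpace 𝒳] {μ : Measure 𝒳}
  [IsProbabilityMeasure μ] [IsSeparable μ] {S : MercerKernel μ} {C : ℝ}
  {Pr : Measure (L2 μ)} [IsProbabilityMeasure Pr]

/-- Too few features: the unmodified prior tail keeps the variational posterior away from every
`f₀`, whatever the data. -/
lemma variationalPosterior_suboptimal (hC : ∀ j x, |S.φ j x| ≤ C) (hPr : IsGPPrior S Pr)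
    (hpos : ∀ j, 0 < S.lam j) (hsum : Summable fun j => √(S.lam j)) {c q : ℝ} (hc : 0 < c)
    (hq : 0 ≤ q) (hlow : ∀ j : ℕ, c * ((j : ℝ) + 1) ^ (-1 - q) ≤ S.lam j) (σ : ℝ≥0)
    {m : ℕ → ℕ}
    {r : ℝ} (hr : 0 ≤ r) (hm : (fun n => (m n : ℝ)) =O[atTop] fun n : ℕ => (n : ℝ) ^ r) {p : ℝ}
    (hp : q * r < 2 * p) (f₀ : L2 μ) :
    (∀ M : ℝ, 0 < M → Tendsto (fun n : ℕ => ∫⁻ z, variationalPosterior S Pr σ (m n) z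
        {f | ‖f - f₀‖ ≤ M * (n : ℝ) ^ (-p)} ∂(dataLaw σ f₀ n)) atTop (𝓝 0)) ∧
      ∀ ε : ℕ → ℝ, ContractsAtRate σ (fun n z => variationalPosterior S Pr σ (m n) z) f₀ ε →
        (fun n : ℕ => (n : ℝ) ^ (-p)) =O[atTop] ε := by
  have hprob : ∀ n (z : Data 𝒳 n), IsProbabilityMeasure (headPosterior S Pr σ (m n) z) :=
    fun n z => by
      obtain ⟨B, -, -, h⟩ := exists_headPosterior_eq_gaussVec hC hPr hpos σ (m n) z
      rw [h]
      infer_instance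
  have hball : ∀ M : ℝ, 0 < M → ∀ᶠ n : ℕ in atTop, ∀ z : Data 𝒳 n,
      variationalPosterior S Pr σ (m n) z {f | ‖f - f₀‖ ≤ M * (n : ℝ) ^ (-p)} ≤
        ENNReal.ofReal (Real.exp 1 * (√(1 + (m n + 1) *
          (2 * S.lam (2 * m n) / (M * (n : ℝ) ^ (-p)) ^ 2)))⁻¹) := fun M hM => by
    filter_upwards [eventually_ge_atTop 1] with n hn z
    have := hprob n z
    have hn0 : (0 : ℝ) < n := by exact_mod_cast hn
    rw [variationalPosterior_eq hC hPr hpos hsum]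
    exact headTail_ball_le hC hPr hpos _ _ _ (by positivity)
  refine ⟨fun M hM => ?_, fun ε hε => ?_⟩
  · refine tendsto_of_tendsto_of_tendsto_of_le_of_le' tendsto_const_nhds
      (tendsto_smallBall_bound hc hq hlow hr hm hp hM) (Eventually.of_forall fun _ => zero_le) ?_
    filter_upwards [hball M hM] with n hn
    refine (lintegral_mono hn).trans ?_
    simp
  · refine isBigO_of_contractsAtRate (fun n z => ?_)
      (tendsto_smallBall_bound hc hq hlow hr hm hp one_pos) (fun n => by positivity) ?_ hε
    · have := hprob n z
      rw [variationalPosterior_eq hC hPr hpos hsum]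
      infer_instance
    · filter_upwards [hball 1 one_pos] with n hn z
      simpa using hn z

end Suboptimal

/-! ### Bayesian linear regression with a well-conditioned design -/

lemma integral_sq_sum_pi {Ω : Type*} [MeasurableSpace Ω] {ν : Measure Ω} [IsProbabilityMeasure ν]
    {n : ℕ} {X : Fin n → Ω → ℝ} (hX : ∀ i, MemLp (X i) 2 ν) (h0 : ∀ i, ∫ ω, X i ω ∂ν = 0) :
    Integrable (fun ω : Fin n → Ω => (∑ i, X i (ω i)) ^ 2) (Measure.pi fun _ : Fin n => ν) ∧
    ∫ ω, (∑ i, X i (ω i)) ^ 2 ∂(Measure.pi fun _ : Fin n => ν) = ∑ i, ∫ ω, X i ω ^ 2 ∂ν := by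
  have hLp : ∀ i ∈ (Finset.univ : Finset (Fin n)), MemLp (fun ω : Fin n → Ω => X i (ω i)) 2
      (Measure.pi fun _ : Fin n => ν) := fun i _ =>
    (hX i).comp_measurePreserving (measurePreserving_eval (fun _ : Fin n => ν) i)
  have hS : MemLp (fun ω : Fin n → Ω => ∑ i, X i (ω i)) 2 (Measure.pi fun _ : Fin n => ν) :=
    memLp_finsetSum _ hLp
  have h := variance_sum_pi (μ := fun _ : Fin n => ν) hX
  refine ⟨hS.integrable_sq, ?_⟩
  have hmean : ∫ ω, ∑ i, X i (ω i) ∂(Measure.pi fun _ : Fin n => ν) = 0 := by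
    rw [integral_finsetSum _ fun i hi => (hLp i hi).integrable (by simp)]
    refine Finset.sum_eq_zero fun i _ => ?_
    rw [integral_comp_eval (μ := fun _ : Fin n => ν) (hX i).aestronglyMeasurable, h0]
  have e1 : (∑ i, fun ω : Fin n → Ω => X i (ω i)) = fun ω : Fin n → Ω => ∑ i, X i (ω i) := by
    funext ω; simp
  rw [e1, variance_of_integral_eq_zero hS.aemeasurable hmean] at h
  rw [h]
  exact Finset.sum_congr rfl fun i _ =>
    variance_of_integral_eq_zero (hX i).aemeasurable (h0 i)

section LinearAlgebra

open Matrix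

variable {𝒳 : Type*} [TopologicalSpace 𝒳] [MeasurableSpace 𝒳] {μ : Measure 𝒳}
  [IsProbabilityMeasure μ] [IsSeparable μ] {S : MercerKernel μ} {σ : ℝ≥0} {m n : ℕ}
  {x : Fin n → 𝒳}

/-- The empirical Gram matrix of the first `m` eigenfunctions is bounded from below by half the
identity, which is its population counterpart. -/
def MercerKernel.WellConditioned (S : MercerKernel μ) (m : ℕ) {n : ℕ} (x : Fin n → 𝒳) : Prop :=
  ∀ w : Fin m → ℝ, n / 2 * ∑ j, w j ^ 2 ≤ ∑ i, S.headEval w (x i) ^ 2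

lemma det_precision_isUnit (hpos : ∀ j, 0 < S.lam j) : IsUnit (precision S σ m x).det :=
  (posDef_precision hpos σ m x).det_pos.ne'.isUnit

/-- The quadratic form of the precision matrix at a column of its inverse. -/
lemma precision_inv_diag_eq (hpos : ∀ j, 0 < S.lam j) (j : Fin m) :
    ∑ k : Fin m, ((precision S σ m x)⁻¹ k j) ^ 2 / S.lam k +
        (∑ i, S.headEval (fun k => (precision S σ m x)⁻¹ k j) (x i) ^ 2) / (σ : ℝ) ^ 2 =
      (precision S σ m x)⁻¹ j j := by
  rw [← dotProduct_precision_mulVec]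
  have h : (fun k => (precision S σ m x)⁻¹ k j) = (precision S σ m x)⁻¹ *ᵥ Pi.single j 1 := by
    funext k; simp
  rw [h, mulVec_mulVec, mul_nonsing_inv _ (det_precision_isUnit hpos), one_mulVec]
  simp

lemma precision_inv_diag_le (hpos : ∀ j, 0 < S.lam j) (hσ : 0 < σ) (hx : S.WellConditioned m x)
    (j : Fin m) :
    (precision S σ m x)⁻¹ j j ≤ ((S.lam j)⁻¹ + n / (2 * (σ : ℝ) ^ 2))⁻¹ := by
  have hσ' : (0 : ℝ) < σ := hσ
  have h := precision_inv_diag_eq (σ := σ) (x := x) hpos j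
  set w : Fin m → ℝ := fun k => (precision S σ m x)⁻¹ k j
  have h1 : w j ^ 2 / S.lam j ≤ ∑ k : Fin m, w k ^ 2 / S.lam k :=
    Finset.single_le_sum (f := fun k : Fin m => w k ^ 2 / S.lam k)
      (fun k _ => div_nonneg (sq_nonneg _) (hpos k).le) (Finset.mem_univ j)
  have h2 : (n : ℝ) / 2 * w j ^ 2 ≤ ∑ i, S.headEval w (x i) ^ 2 := by
    refine le_trans ?_ (hx w)
    gcongr
    exact Finset.single_le_sum (f := fun k => w k ^ 2) (fun k _ => sq_nonneg _) (Finset.mem_univ j)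
  have h3 : w j ^ 2 * ((S.lam j)⁻¹ + n / (2 * (σ : ℝ) ^ 2)) ≤ w j := by
    calc _ = w j ^ 2 / S.lam j + ((n : ℝ) / 2 * w j ^ 2) / (σ : ℝ) ^ 2 := by
          field_simp
      _ ≤ ∑ k : Fin m, w k ^ 2 / S.lam k + (∑ i, S.headEval w (x i) ^ 2) / (σ : ℝ) ^ 2 := by
          gcongr
      _ = w j := h
  have hD : 0 < (S.lam j)⁻¹ + n / (2 * (σ : ℝ) ^ 2) := by
    have := inv_pos.2 (hpos j)
    positivity
  have hw : 0 < w j := (posDef_precision hpos σ m x).inv.diag_pos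
  rw [sq, mul_assoc] at h3
  change w j ≤ _
  rw [← one_div, le_div_iff₀ hD]
  exact le_of_mul_le_mul_left (by rwa [mul_one]) hw

/-- The regularised least squares map is stable: it turns a residual `s` into an error of squared
size at most `4 |s|² / n`, and the shrinkage term `v` into one of size `16 σ⁴ |v|² / n²`. -/
lemma sum_sq_precision_inv_mulVec_le (hpos : ∀ j, 0 < S.lam j) (hσ : 0 < σ) (hn : 0 < n)
    (hx : S.WellConditioned m x) (s : Fin n → ℝ) (v : Fin m → ℝ) :
    ∑ j, ((precision S σ m x)⁻¹ *ᵥ (((σ : ℝ) ^ 2)⁻¹ • ((S.design m x)ᵀ *ᵥ s) - v)) j ^ 2 ≤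
      4 / n * ∑ i, s i ^ 2 + 16 * (σ : ℝ) ^ 4 / n ^ 2 * ∑ j, v j ^ 2 := by
  have hσ' : (0 : ℝ) < σ := hσ
  have hn' : (0 : ℝ) < n := by exact_mod_cast hn
  set w := (precision S σ m x)⁻¹ *ᵥ (((σ : ℝ) ^ 2)⁻¹ • ((S.design m x)ᵀ *ᵥ s) - v) with hw
  have h1 := dotProduct_precision_mulVec (S := S) σ m x w
  rw [hw, mulVec_mulVec, mul_nonsing_inv _ (det_precision_isUnit hpos), one_mulVec, ← hw,
    dotProduct_sub, dotProduct_smul, mulVec_transpose, ← dotProduct_comm (s ᵥ* _),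
    ← dotProduct_mulVec] at h1
  simp only [dotProduct, design_mulVec, smul_eq_mul] at h1
  have h2 : 0 ≤ ∑ j : Fin m, w j ^ 2 / S.lam j :=
    Finset.sum_nonneg fun j _ => div_nonneg (sq_nonneg _) (hpos j).le
  have h3 := hx w
  set W := ∑ j, w j ^ 2
  set E := ∑ i, S.headEval w (x i) ^ 2
  set s2 := ∑ i, s i ^ 2
  set v2 := ∑ j, v j ^ 2
  have h4 : 2 * ∑ i, s i * S.headEval w (x i) ≤ s2 + E := by
    rw [Finset.mul_sum, ← Finset.sum_add_distrib]
    refine Finset.sum_le_sum fun i _ => ?_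
    nlinarith [sq_nonneg (s i - S.headEval w (x i))]
  have h5 : -∑ j, w j * v j ≤ n / (8 * (σ : ℝ) ^ 2) * W + 2 * (σ : ℝ) ^ 2 / n * v2 := by
    rw [Finset.mul_sum, Finset.mul_sum, ← Finset.sum_add_distrib, ← Finset.sum_neg_distrib]
    refine Finset.sum_le_sum fun j _ => ?_
    have : 0 ≤ n / (8 * (σ : ℝ) ^ 2) * (w j + 4 * (σ : ℝ) ^ 2 / n * v j) ^ 2 := by positivity
    have e : n / (8 * (σ : ℝ) ^ 2) * (w j + 4 * (σ : ℝ) ^ 2 / n * v j) ^ 2 =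
        n / (8 * (σ : ℝ) ^ 2) * w j ^ 2 + 2 * (σ : ℝ) ^ 2 / n * v j ^ 2 + w j * v j := by
      field_simp
      ring
    linarith
  set P := ∑ i, s i * S.headEval w (x i)
  have h6 : E / (σ : ℝ) ^ 2 ≤ ((σ : ℝ) ^ 2)⁻¹ * ((s2 + E) / 2) +
      (n / (8 * (σ : ℝ) ^ 2) * W + 2 * (σ : ℝ) ^ 2 / n * v2) := by
    have : ((σ : ℝ) ^ 2)⁻¹ * P ≤ ((σ : ℝ) ^ 2)⁻¹ * ((s2 + E) / 2) := by
      gcongr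
      linarith
    linarith
  have h7 : E ≤ s2 + n / 4 * W + 4 * (σ : ℝ) ^ 4 / n * v2 := by
    have := mul_le_mul_of_nonneg_left h6 (by positivity : 0 ≤ 2 * (σ : ℝ) ^ 2)
    have e1 : 2 * (σ : ℝ) ^ 2 * (E / (σ : ℝ) ^ 2) = 2 * E := by field_simp
    have e2 : 2 * (σ : ℝ) ^ 2 * (((σ : ℝ) ^ 2)⁻¹ * ((s2 + E) / 2) +
      (n / (8 * (σ : ℝ) ^ 2) * W + 2 * (σ : ℝ) ^ 2 / n * v2)) =
        s2 + E + n / 4 * W + 4 * (σ : ℝ) ^ 4 / n * v2 := by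
      field_simp
      ring
    linarith
  have h8 : n / 4 * W ≤ s2 + 4 * (σ : ℝ) ^ 4 / n * v2 := by linarith
  calc W = 4 / n * (n / 4 * W) := by field_simp
    _ ≤ 4 / n * (s2 + 4 * (σ : ℝ) ^ 4 / n * v2) := by gcongr
    _ = _ := by field_simp; ring

/-- The error of the posterior mean, relative to an arbitrary linear combination `u` of the
features, is the sum of a deterministic part and a part due to the noise. -/
lemma postMean_sub (hpos : ∀ j, 0 < S.lam j) (u : Fin m → ℝ) (s e y : Fin n → ℝ)
    (hy : ∀ i, y i = S.headEval u (x i) + s i + e i) :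
    postMean S σ m (x, y) - u =
      (precision S σ m x)⁻¹ *ᵥ (((σ : ℝ) ^ 2)⁻¹ • ((S.design m x)ᵀ *ᵥ s) -
        fun j : Fin m => u j / S.lam j) +
      (precision S σ m x)⁻¹ *ᵥ (((σ : ℝ) ^ 2)⁻¹ • ((S.design m x)ᵀ *ᵥ e)) := by
  have hy' : y = S.design m x *ᵥ u + s + e := by
    funext i; simp [hy, design_mulVec]
  have hu : u = (precision S σ m x)⁻¹ *ᵥ (precision S σ m x *ᵥ u) := by
    rw [mulVec_mulVec, nonsing_inv_mul _ (det_precision_isUnit hpos), one_mulVec]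
  have hAu : precision S σ m x *ᵥ u = (fun j : Fin m => u j / S.lam j) +
      ((σ : ℝ) ^ 2)⁻¹ • ((S.design m x)ᵀ *ᵥ (S.design m x *ᵥ u)) := by
    rw [precision, add_mulVec, smul_mulVec, mulVec_mulVec]
    congr 1
    funext j
    rw [mulVec_diagonal, inv_mul_eq_div]
  conv_lhs => rw [hu, hAu]
  rw [postMean, ← mulVec_sub, ← mulVec_add, hy']
  congr 1
  simp only [mulVec_add, smul_add]
  abel

lemma integral_sq_sum_mul_gaussian (a : Fin n → ℝ) (v : ℝ≥0) :
    Integrable (fun e : Fin n → ℝ => (∑ i, a i * e i) ^ 2)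
      (Measure.pi fun _ : Fin n => gaussianReal 0 v) ∧
    ∫ e, (∑ i, a i * e i) ^ 2 ∂(Measure.pi fun _ : Fin n => gaussianReal 0 v) =
      v * ∑ i, a i ^ 2 := by
  have h := integral_sq_sum_pi (ν := gaussianReal 0 v) (X := fun (i : Fin n) t => a i * t)
    (fun i => ((memLp_id_gaussianReal 2).const_mul _ :))
    fun i => by rw [integral_const_mul, integral_id_gaussianReal, mul_zero]
  refine ⟨h.1, h.2.trans ?_⟩
  rw [Finset.mul_sum]
  refine Finset.sum_congr rfl fun i _ => ?_
  simp_rw [mul_pow]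
  have := variance_of_integral_eq_zero (μ := gaussianReal 0 v) (X := fun t => t)
    aemeasurable_id (by simp)
  rw [integral_const_mul, ← this, variance_fun_id_gaussianReal, mul_comm]

/-- The noise contributes to the squared error of the posterior mean at most the trace of the
posterior covariance. -/
lemma lintegral_noise_le (hpos : ∀ j, 0 < S.lam j) (hσ : 0 < σ) :
    ∫⁻ e, ENNReal.ofReal (∑ j, ((precision S σ m x)⁻¹ *ᵥ
        (((σ : ℝ) ^ 2)⁻¹ • ((S.design m x)ᵀ *ᵥ e))) j ^ 2)
        ∂(Measure.pi fun _ : Fin n => gaussianReal 0 (σ ^ 2)) ≤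
      ENNReal.ofReal (∑ j, (precision S σ m x)⁻¹ j j) := by
  have hσ' : (0 : ℝ) < σ := hσ
  have hsymm : ∀ j k, (precision S σ m x)⁻¹ j k = (precision S σ m x)⁻¹ k j := fun j k => by
    simpa using (posDef_precision hpos σ m x).inv.isHermitian.apply k j
  have he : ∀ (e : Fin n → ℝ) (j : Fin m), ((precision S σ m x)⁻¹ *ᵥ
      (((σ : ℝ) ^ 2)⁻¹ • ((S.design m x)ᵀ *ᵥ e))) j = ∑ i, (((σ : ℝ) ^ 2)⁻¹ *
        S.headEval (fun k => (precision S σ m x)⁻¹ k j) (x i)) * e i := fun e j => by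
    rw [mulVec_smul, Pi.smul_apply, mulVec_mulVec, smul_eq_mul, mulVec, dotProduct, Finset.mul_sum]
    refine Finset.sum_congr rfl fun i _ => ?_
    rw [mul_assoc, ← design_mulVec, Matrix.mul_apply, mulVec, dotProduct]
    congr 2
    exact Finset.sum_congr rfl fun k _ => by rw [transpose_apply, hsymm j k, mul_comm]
  simp_rw [he]
  have hI := fun j : Fin m => integral_sq_sum_mul_gaussian (fun i => ((σ : ℝ) ^ 2)⁻¹ *
        S.headEval (fun k => (precision S σ m x)⁻¹ k j) (x i)) (σ ^ 2)
  rw [← ofReal_integral_eq_lintegral_ofReal (integrable_finsetSum _ fun j _ => (hI j).1)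
    (ae_of_all _ fun e => Finset.sum_nonneg fun j _ => sq_nonneg _)]
  refine ENNReal.ofReal_le_ofReal ?_
  rw [integral_finsetSum _ fun j _ => (hI j).1]
  refine Finset.sum_le_sum fun j _ => ?_
  rw [(hI j).2, ← precision_inv_diag_eq hpos j]
  have h2 : 0 ≤ ∑ k : Fin m, ((precision S σ m x)⁻¹ k j) ^ 2 / S.lam k :=
    Finset.sum_nonneg fun k _ => div_nonneg (sq_nonneg _) (hpos k).le
  have h3 : ((σ ^ 2 : ℝ≥0) : ℝ) * ∑ i, (((σ : ℝ) ^ 2)⁻¹ *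
        S.headEval (fun k => (precision S σ m x)⁻¹ k j) (x i)) ^ 2 =
      (∑ i, S.headEval (fun k => (precision S σ m x)⁻¹ k j) (x i) ^ 2) / (σ : ℝ) ^ 2 := by
    simp_rw [mul_pow]
    rw [← Finset.mul_sum]
    push_cast
    field_simp
  linarith

end LinearAlgebra

/-! ### An oracle inequality for the variational posterior -/

section Oracle

variable {𝒳 : Type*} [TopologicalSpace 𝒳] [MeasurableSpace 𝒳] {μ : Measure 𝒳}
  [IsProbabilityMeasure μ] [IsSeparable μ] {S : MercerKernel μ} {C : ℝ}
  {Pr : Measure (L2 μ)} [IsProbabilityMeasure Pr]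

lemma lintegral_ofReal_sq (h : L2 μ) :
    ∫⁻ x, ENNReal.ofReal (h x ^ 2) ∂μ = ENNReal.ofReal (‖h‖ ^ 2) := by
  rw [← real_inner_self_eq_norm_sq, L2.inner_def,
    ofReal_integral_eq_lintegral_ofReal (L2.integrable_inner h h)
      (ae_of_all _ fun x => real_inner_self_nonneg)]
  refine lintegral_congr fun x => ?_
  rw [real_inner_self_eq_norm_sq, Real.norm_eq_abs, sq_abs]

/-- The empirical Gram matrix concentrates: Markov's inequality for the squared Frobenius norm of
its deviation from its mean. -/
lemma measure_not_wellConditioned_le (hC : ∀ j x, |S.φ j x| ≤ C) (m : ℕ) {n : ℕ} (hn : 0 < n) :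
    (Measure.pi fun _ : Fin n => μ) {x | ¬ S.WellConditioned m x} ≤
      ENNReal.ofReal (4 * (m : ℝ) ^ 2 * C ^ 4 / n) := by
  have hn' : (0 : ℝ) < n := by exact_mod_cast hn
  set δ : Fin m → Fin m → ℝ := fun j k => if (j : ℕ) = k then 1 else 0
  set X : Fin m × Fin m → 𝒳 → ℝ := fun q x => S.φ q.1 x * S.φ q.2 x - δ q.1 q.2
  have hφb : ∀ q : Fin m × Fin m, MemLp (fun x => S.φ q.1 x * S.φ q.2 x) 2 μ := fun q =>
    MemLp.of_bound ((S.φ_measurable _).mul (S.φ_measurable _)).aestronglyMeasurable (C ^ 2)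
      (ae_of_all _ fun x => abs_mul_φ_le hC _ _ _ _)
  have hmean : ∀ q : Fin m × Fin m, ∫ x, S.φ q.1 x * S.φ q.2 x ∂μ = δ q.1 q.2 := fun q =>
    integral_φ_mul_φ S _ _
  have hX : ∀ q, MemLp (X q) 2 μ := fun q => (hφb q).sub (memLp_const _)
  have hX0 : ∀ q, ∫ x, X q x ∂μ = 0 := fun q => by
    simp only [X]
    rw [integral_sub ((hφb q).integrable (by simp)) (integrable_const _), hmean]
    simp
  have hX2 : ∀ q, ∫ x, X q x ^ 2 ∂μ ≤ C ^ 4 := fun q => by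
    have h1 : Var[fun x => S.φ q.1 x * S.φ q.2 x; μ] = ∫ x, X q x ^ 2 ∂μ := by
      rw [variance_eq_integral (hφb q).aemeasurable, hmean]
    rw [← h1]
    refine (variance_le_expectation_sq (hφb q).aestronglyMeasurable).trans ?_
    calc ∫ x, (S.φ q.1 x * S.φ q.2 x) ^ 2 ∂μ ≤ ∫ _, C ^ 4 ∂μ := by
          refine integral_mono (hφb q).integrable_sq (integrable_const _) fun x => ?_
          rw [← sq_abs, show C ^ 4 = (C ^ 2) ^ 2 by ring]
          exact pow_le_pow_left₀ (abs_nonneg _) (abs_mul_φ_le hC _ _ _ _) 2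
      _ = C ^ 4 := by simp
  have hI := fun q => integral_sq_sum_pi (ν := μ) (n := n) (X := fun _ => X q) (fun _ => hX q)
    fun _ => hX0 q
  set F : (Fin n → 𝒳) → ℝ := fun x => ∑ q, (∑ i, X q (x i)) ^ 2
  have hF : Integrable F (Measure.pi fun _ : Fin n => μ) :=
    integrable_finsetSum _ fun q _ => (hI q).1
  have hF2 : ∫ x, F x ∂(Measure.pi fun _ : Fin n => μ) ≤ (m : ℝ) ^ 2 * (n * C ^ 4) := by
    simp only [F]
    rw [integral_finsetSum _ fun q _ => (hI q).1]
    calc _ ≤ ∑ _q : Fin m × Fin m, (n : ℝ) * C ^ 4 := by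
          refine Finset.sum_le_sum fun q _ => ?_
          rw [(hI q).2]
          simpa using mul_le_mul_of_nonneg_left (hX2 q) hn'.le
      _ = _ := by simp [sq]
  have hsub : {x | ¬ S.WellConditioned m x} ⊆ {x | (n : ℝ) ^ 2 / 4 ≤ F x} := fun x hx => by
    by_contra hlt
    simp only [Set.mem_ofPred_eq, not_le] at hlt
    refine hx fun w => ?_
    set W := ∑ j, w j ^ 2
    have hW : 0 ≤ W := Finset.sum_nonneg fun _ _ => sq_nonneg _
    have e1 : ∑ i, S.headEval w (x i) ^ 2 - n * W =
        ∑ q : Fin m × Fin m, (w q.1 * w q.2) * ∑ i, X q (x i) := by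
      have h1 : (n : ℝ) * W = ∑ _i : Fin n, ∑ q : Fin m × Fin m, (w q.1 * w q.2) * δ q.1 q.2 := by
        rw [Finset.sum_const, Finset.card_univ, Fintype.card_fin, nsmul_eq_mul,
          Fintype.sum_prod_type]
        congr 1
        refine Finset.sum_congr rfl fun j _ => ?_
        simp [δ, Fin.val_inj, sq]
      have h2 : ∀ i, S.headEval w (x i) ^ 2 =
          ∑ q : Fin m × Fin m, (w q.1 * w q.2) * (S.φ q.1 (x i) * S.φ q.2 (x i)) := fun i => by
        rw [MercerKernel.headEval, sq, Finset.sum_mul_sum, Fintype.sum_prod_type]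
        exact Finset.sum_congr rfl fun j _ => Finset.sum_congr rfl fun k _ => by ring
      simp_rw [h1, h2, Finset.mul_sum]
      rw [← Finset.sum_sub_distrib, Finset.sum_comm]
      refine Finset.sum_congr rfl fun i _ => ?_
      rw [← Finset.sum_sub_distrib]
      exact Finset.sum_congr rfl fun q _ => by simp only [X]; ring
    have e2 : (∑ q : Fin m × Fin m, (w q.1 * w q.2) * ∑ i, X q (x i)) ^ 2 ≤ (n / 2 * W) ^ 2 := by
      refine (Finset.sum_mul_sq_le_sq_mul_sq _ _ _).trans ?_
      have : ∑ q : Fin m × Fin m, (w q.1 * w q.2) ^ 2 = W ^ 2 := by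
        rw [sq W, Finset.sum_mul_sum, Fintype.sum_prod_type]
        exact Finset.sum_congr rfl fun j _ => Finset.sum_congr rfl fun k _ => by ring
      rw [this]
      calc W ^ 2 * ∑ q, (∑ i, X q (x i)) ^ 2 ≤ W ^ 2 * ((n : ℝ) ^ 2 / 4) := by
            gcongr
        _ = _ := by ring
    have e3 := (abs_le_of_sq_le_sq' e2 (by positivity)).1
    linarith
  have hmk := mul_meas_ge_le_integral_of_nonneg
    (ae_of_all _ fun x => Finset.sum_nonneg fun q _ => sq_nonneg _ : 0 ≤ᵐ[_] F) hF
    ((n : ℝ) ^ 2 / 4)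
  refine (measure_mono hsub).trans ?_
  rw [← ofReal_measureReal]
  refine ENNReal.ofReal_le_ofReal ?_
  have h3 := hmk.trans hF2
  rw [← le_div_iff₀' (by positivity)] at h3
  refine h3.trans_eq ?_
  field_simp

lemma lintegral_norm_tail_sq (hC : ∀ j x, |S.φ j x| ≤ C) (hPr : IsGPPrior S Pr) (m : ℕ) :
    ∫⁻ f, ENNReal.ofReal (‖S.tail m f‖ ^ 2) ∂Pr = ENNReal.ofReal (∑' j, S.lam (j + m)) := by
  have h1 : ∀ f, ENNReal.ofReal (‖S.tail m f‖ ^ 2) = ∑' j, ‖S.coeff f (j + m)‖ₑ ^ 2 := fun f => by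
    rw [← (S.norm_tail_sq m f).tsum_eq,
      ENNReal.ofReal_tsum_of_nonneg (fun _ => sq_nonneg _) (S.norm_tail_sq m f).summable]
    refine tsum_congr fun j => ?_
    rw [← sq_abs, ENNReal.ofReal_pow (abs_nonneg _), Real.enorm_eq_ofReal_abs]
  simp_rw [h1]
  rw [lintegral_tsum fun j => by fun_prop,
    ENNReal.ofReal_tsum_of_nonneg (fun _ => S.lam_nonneg _)
      ((summable_nat_add_iff m).2 S.lam_summable)]
  exact tsum_congr fun j => lintegral_enorm_coeff_sq hC hPr _

/-- The mean squared distance to `f₀`: squared bias and variance of the Gaussian law of the head,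
plus the contribution of the tail. -/
lemma lintegral_headTail_gaussVec_le (hC : ∀ j x, |S.φ j x| ≤ C) (hPr : IsGPPrior S Pr) {m : ℕ}
    (a : Fin m → ℝ) (B : Matrix (Fin m) (Fin m) ℝ) (f₀ : L2 μ) :
    ∫⁻ f, ENNReal.ofReal (‖f - f₀‖ ^ 2) ∂(headTail S Pr m (gaussVec a B)) ≤
      ENNReal.ofReal (∑ j : Fin m, (a j - S.coeff f₀ j) ^ 2 +
        ∑ j, (B * B.transpose) j j + 2 * ‖S.tail m f₀‖ ^ 2 + 2 * ∑' j, S.lam (j + m)) := by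
  have hi : ∀ j : Fin m, Integrable (fun u : Fin m → ℝ => (u j - S.coeff f₀ j) ^ 2)
      (gaussVec a B) := fun j =>
    (((memLp_eval_of_isGaussian (gaussVec a B) j).sub (memLp_const _)).integrable_sq :)
  have hBB : 0 ≤ ∑ j, (B * B.transpose) j j := Finset.sum_nonneg fun j _ => by
    simp only [Matrix.mul_apply, Matrix.transpose_apply]
    exact Finset.sum_nonneg fun k _ => mul_self_nonneg _
  have hl : 0 ≤ ∑' j, S.lam (j + m) := tsum_nonneg fun j => S.lam_nonneg _
  have ha : 0 ≤ ∑ j : Fin m, (a j - S.coeff f₀ j) ^ 2 := Finset.sum_nonneg fun _ _ => sq_nonneg _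
  refine (lintegral_map_le _ _).trans ?_
  have hle : ∀ p : (Fin m → ℝ) × L2 μ, ENNReal.ofReal (‖S.comb m p - f₀‖ ^ 2) ≤
      ENNReal.ofReal (∑ j : Fin m, (p.1 j - S.coeff f₀ j) ^ 2) +
        (ENNReal.ofReal (2 * ‖S.tail m f₀‖ ^ 2) +
          ENNReal.ofReal 2 * ENNReal.ofReal (‖S.tail m p.2‖ ^ 2)) := fun p => by
    rw [← ENNReal.ofReal_mul (by norm_num), ← ENNReal.ofReal_add (by positivity) (by positivity),
      ← ENNReal.ofReal_add (Finset.sum_nonneg fun _ _ => sq_nonneg _) (by positivity),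
      show p = (p.1, p.2) from rfl, S.norm_comb_sub_sq]
    refine ENNReal.ofReal_le_ofReal ?_
    have := norm_sub_le (S.tail m p.2) (S.tail m f₀)
    have := norm_nonneg (S.tail m p.2 - S.tail m f₀)
    nlinarith [sq_nonneg (‖S.tail m p.2‖ - ‖S.tail m f₀‖)]
  refine (lintegral_mono hle).trans ?_
  have hm1 : Measurable fun u : Fin m → ℝ =>
      ENNReal.ofReal (∑ j : Fin m, (u j - S.coeff f₀ j) ^ 2) := by fun_prop
  have hm2 : Measurable fun f : L2 μ => ENNReal.ofReal (2 * ‖S.tail m f₀‖ ^ 2) +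
      ENNReal.ofReal 2 * ENNReal.ofReal (‖S.tail m f‖ ^ 2) := by
    have : Measurable (S.tail m) := (S.tail m).continuous.measurable
    fun_prop
  have hm3 : Measurable fun p : (Fin m → ℝ) × L2 μ =>
      ENNReal.ofReal (∑ j : Fin m, (p.1 j - S.coeff f₀ j) ^ 2) := hm1.comp measurable_fst
  rw [lintegral_add_left hm3,
    (measurePreserving_fst (μ := gaussVec a B) (ν := Pr)).lintegral_comp hm1,
    (measurePreserving_snd (μ := gaussVec a B) (ν := Pr)).lintegral_comp hm2,
    lintegral_add_left measurable_const, lintegral_const_mul' _ _ (by simp),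
    lintegral_norm_tail_sq hC hPr,
    ← ofReal_integral_eq_lintegral_ofReal (integrable_finsetSum _ fun j _ => hi j)
      (ae_of_all _ fun u => Finset.sum_nonneg fun _ _ => sq_nonneg _),
    integral_finsetSum _ fun j _ => hi j]
  simp_rw [integral_sq_sub_gaussVec]
  rw [Finset.sum_add_distrib, lintegral_const, measure_univ, mul_one, ← ENNReal.ofReal_mul (by norm_num),
    ← ENNReal.ofReal_add (by positivity) (by positivity),
    ← ENNReal.ofReal_add (by positivity) (by positivity), ← add_assoc]

lemma synth_ae_eq_headEval {m : ℕ} (u : Fin m → ℝ) :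
    S.synth m u =ᵐ[μ] fun x => S.headEval u x := by
  rw [S.synth_apply]
  have h1 : ∀ s : Finset (Fin m), (((∑ j ∈ s, u j • S.basis j : L2 μ)) : 𝒳 → ℝ) =ᵐ[μ]
      fun x => ∑ j ∈ s, u j * S.φ j x := fun s => by
    classical
    induction s using Finset.induction_on with
    | empty =>
      simp only [Finset.sum_empty]
      exact Lp.coeFn_zero _ _ _
    | insert j s hj ih =>
      simp only [Finset.sum_insert hj]
      filter_upwards [Lp.coeFn_add (u j • S.basis j) (∑ j ∈ s, u j • S.basis j), ih,
        Lp.coeFn_smul (u j) (S.basis j), S.basis_ae_eq j] with x e1 e2 e3 e4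
      rw [e1, Pi.add_apply, e2, e3, Pi.smul_apply, e4, smul_eq_mul]
  exact h1 Finset.univ

/-- The mean squared empirical distance between `f₀` and a linear combination of features. -/
lemma lintegral_sum_residual_sq {m n : ℕ} (u : Fin m → ℝ) (f₀ : L2 μ) :
    ∫⁻ x, ENNReal.ofReal (∑ i, (f₀ (x i) - S.headEval u (x i)) ^ 2)
        ∂(Measure.pi fun _ : Fin n => μ) =
      ENNReal.ofReal (n * ‖S.synth m u - f₀‖ ^ 2) := by
  have hf : Measurable f₀ := (Lp.stronglyMeasurable f₀).measurable
  have hφ := S.φ_measurable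
  have hg : Measurable fun x => ENNReal.ofReal ((f₀ x - S.headEval u x) ^ 2) := by
    unfold MercerKernel.headEval
    fun_prop
  have h1 : ∫⁻ x, ENNReal.ofReal ((f₀ x - S.headEval u x) ^ 2) ∂μ =
      ENNReal.ofReal (‖S.synth m u - f₀‖ ^ 2) := by
    rw [norm_sub_rev, ← lintegral_ofReal_sq]
    refine lintegral_congr_ae ?_
    filter_upwards [Lp.coeFn_sub f₀ (S.synth m u), synth_ae_eq_headEval (S := S) u] with x e1 e2
    rw [e1, Pi.sub_apply, e2]
  simp_rw [ENNReal.ofReal_sum_of_nonneg fun i _ => sq_nonneg _]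
  have hgi : ∀ i : Fin n, Measurable fun x : Fin n → 𝒳 =>
      ENNReal.ofReal ((f₀ (x i) - S.headEval u (x i)) ^ 2) := fun i =>
    hg.comp (measurable_pi_apply i)
  rw [lintegral_finsetSum _ fun i _ => hgi i]
  have h2 : ∀ i : Fin n, ∫⁻ x, ENNReal.ofReal ((f₀ (x i) - S.headEval u (x i)) ^ 2)
      ∂(Measure.pi fun _ : Fin n => μ) = ENNReal.ofReal (‖S.synth m u - f₀‖ ^ 2) := fun i => by
    rw [← h1]
    exact (measurePreserving_eval (fun _ : Fin n => μ) i).lintegral_comp hg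
  simp_rw [h2]
  rw [Finset.sum_const, Finset.card_univ, Fintype.card_fin, nsmul_eq_mul,
    ENNReal.ofReal_mul (by positivity), ENNReal.ofReal_natCast]

/-- Outside the event of an ill-conditioned design, the squared radius of the variational posterior
around `f₀` is bounded by the trace of the posterior covariance, the shrinkage bias and the
approximation error at an arbitrary linear combination `u` of the features, and the prior variance
of the tail. -/
theorem lintegral_variationalPosterior_le (hC : ∀ j x, |S.φ j x| ≤ C) (hPr : IsGPPrior S Pr)
    (hpos : ∀ j, 0 < S.lam j) (hsum : Summable fun j => √(S.lam j)) {σ : ℝ≥0} (hσ : 0 < σ)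
    (m : ℕ) {n : ℕ} (hn : 0 < n) (f₀ : L2 μ) (u : Fin m → ℝ) {t : ℝ} (ht : 0 < t) :
    ∫⁻ z, variationalPosterior S Pr σ m z {f | t ≤ ‖f - f₀‖} ∂(dataLaw σ f₀ n) ≤
      ENNReal.ofReal (4 * (m : ℝ) ^ 2 * C ^ 4 / n) +
      ENNReal.ofReal ((t ^ 2)⁻¹ * (4 * ∑ j : Fin m, ((S.lam j)⁻¹ + n / (2 * (σ : ℝ) ^ 2))⁻¹ +
        48 * (σ : ℝ) ^ 4 / n ^ 2 * ∑ j : Fin m, (u j / S.lam j) ^ 2 +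
        15 * ‖S.synth m u - f₀‖ ^ 2 + 2 * ∑' j, S.lam (j + m))) := by
  classical
  have hn' : (0 : ℝ) < n := by exact_mod_cast hn
  set T : ℝ := ∑ j : Fin m, ((S.lam j)⁻¹ + n / (2 * (σ : ℝ) ^ 2))⁻¹
  set V : ℝ := ∑ j : Fin m, (u j / S.lam j) ^ 2
  set L : ℝ := ∑' j, S.lam (j + m)
  set A : ℝ := ‖S.synth m u - f₀‖ ^ 2
  have hT : 0 ≤ T := Finset.sum_nonneg fun j _ => by
    have := hpos j
    positivity
  have hV : 0 ≤ V := Finset.sum_nonneg fun _ _ => sq_nonneg _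
  have hL : 0 ≤ L := tsum_nonneg fun j => S.lam_nonneg _
  have hA : 0 ≤ A := sq_nonneg _
  have hA2 : A = ∑ j : Fin m, (u j - S.coeff f₀ j) ^ 2 + ‖S.tail m f₀‖ ^ 2 := by
    have := S.norm_comb_sub_sq m u 0 f₀
    simpa [MercerKernel.comb] using this
  set s : (Fin n → 𝒳) → ℝ := fun x => ∑ i, (f₀ (x i) - S.headEval u (x i)) ^ 2
  have hs0 : ∀ x, 0 ≤ s x := fun x => Finset.sum_nonneg fun _ _ => sq_nonneg _
  set c₀ : ℝ := 4 * T + 48 * (σ : ℝ) ^ 4 / n ^ 2 * V + 3 * A + 2 * L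
  set bad : Set (Fin n → 𝒳) := {x | ¬ S.WellConditioned m x}
  have hpt : ∀ x : Fin n → 𝒳, ∫⁻ e, variationalPosterior S Pr σ m (x, fun i => f₀ (x i) + e i)
        {f | t ≤ ‖f - f₀‖} ∂(Measure.pi fun _ : Fin n => gaussianReal 0 (σ ^ 2)) ≤
      bad.indicator 1 x + (ENNReal.ofReal ((t ^ 2)⁻¹ * c₀) +
        ENNReal.ofReal ((t ^ 2)⁻¹ * (12 / n)) * ENNReal.ofReal (s x)) := fun x => by
    by_cases hx : S.WellConditioned m x
    swap
    · -- for an ill-conditioned design only the trivial bound `1` is available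
      have hxb : x ∈ bad := hx
      rw [Set.indicator_of_mem hxb]
      refine le_trans ?_ le_self_add
      refine (lintegral_mono (g := fun _ => 1) fun e => ?_).trans (by simp)
      obtain ⟨B, -, -, h⟩ := exists_headPosterior_eq_gaussVec hC hPr hpos σ m
        ((x, fun i => f₀ (x i) + e i) : Data 𝒳 n)
      rw [variationalPosterior_eq hC hPr hpos hsum, h]
      exact prob_le_one
    · refine le_trans ?_ le_add_self
      set Q : (Fin n → ℝ) → ℝ := fun e => ∑ j, ((precision S σ m x)⁻¹.mulVec
        (((σ : ℝ) ^ 2)⁻¹ • ((S.design m x).transpose.mulVec e))) j ^ 2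
      have hQ0 : ∀ e, 0 ≤ Q e := fun e => Finset.sum_nonneg fun _ _ => sq_nonneg _
      have htr : ∑ j, (precision S σ m x)⁻¹ j j ≤ T :=
        Finset.sum_le_sum fun j _ => precision_inv_diag_le hpos hσ hx j
      set c₁ : ℝ := T + 48 * (σ : ℝ) ^ 4 / n ^ 2 * V + 3 * A + 2 * L + 12 / n * s x
      have hc₁ : 0 ≤ c₁ := by have := hs0 x; positivity
      have he : ∀ e : Fin n → ℝ, variationalPosterior S Pr σ m (x, fun i => f₀ (x i) + e i)
          {f | t ≤ ‖f - f₀‖} ≤ ENNReal.ofReal ((t ^ 2)⁻¹ * c₁) +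
            ENNReal.ofReal ((t ^ 2)⁻¹ * 3) * ENNReal.ofReal (Q e) := fun e => by
        set z : Data 𝒳 n := (x, fun i => f₀ (x i) + e i)
        obtain ⟨B, -, hB, h⟩ := exists_headPosterior_eq_gaussVec hC hPr hpos σ m z
        rw [variationalPosterior_eq hC hPr hpos hsum, h]
        have hmeas : Measurable fun f : L2 μ => ENNReal.ofReal (‖f - f₀‖ ^ 2) := by fun_prop
        have h1 : {f : L2 μ | t ≤ ‖f - f₀‖} ⊆
            {f | ENNReal.ofReal (t ^ 2) ≤ ENNReal.ofReal (‖f - f₀‖ ^ 2)} := fun f hf =>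
          ENNReal.ofReal_le_ofReal (pow_le_pow_left₀ ht.le hf 2)
        have ht2 : (0 : ℝ) < t ^ 2 := by positivity
        refine (measure_mono h1).trans ((meas_ge_le_lintegral_div hmeas.aemeasurable
          (by simpa using ht2.ne') (by simp)).trans ?_)
        rw [← ENNReal.ofReal_mul (by positivity), ← ENNReal.ofReal_add (by positivity)
          (mul_nonneg (by positivity) (hQ0 e)), ENNReal.div_le_iff
          (by simpa using ht2.ne') (by simp), ← ENNReal.ofReal_mul (by
            have := hQ0 e
            positivity)]
        refine (lintegral_headTail_gaussVec_le hC hPr _ B f₀).trans (ENNReal.ofReal_le_ofReal ?_)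
        have hsub := postMean_sub (σ := σ) (x := x) hpos u
          (fun i => f₀ (x i) - S.headEval u (x i)) e z.2 (fun i => by simp [z])
        have hst := sum_sq_precision_inv_mulVec_le hpos hσ hn hx
          (fun i => f₀ (x i) - S.headEval u (x i)) (fun j : Fin m => u j / S.lam j)
        set w1 := (precision S σ m x)⁻¹.mulVec (((σ : ℝ) ^ 2)⁻¹ • ((S.design m x).transpose.mulVec
          fun i => f₀ (x i) - S.headEval u (x i)) - fun j : Fin m => u j / S.lam j)
        set w2 := (precision S σ m x)⁻¹.mulVec
          (((σ : ℝ) ^ 2)⁻¹ • ((S.design m x).transpose.mulVec e)) with hw2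
        -- split the error into bias `w1`, noise `w2` and approximation error `u - ⟨f₀, φⱼ⟩`
        have h3 : ∑ j : Fin m, (postMean S σ m z j - S.coeff f₀ j) ^ 2 ≤
            3 * ∑ j, w1 j ^ 2 + 3 * Q e + 3 * ∑ j : Fin m, (u j - S.coeff f₀ j) ^ 2 := by
          simp only [Q, ← hw2]
          rw [Finset.mul_sum, Finset.mul_sum, Finset.mul_sum, ← Finset.sum_add_distrib,
            ← Finset.sum_add_distrib]
          refine Finset.sum_le_sum fun j _ => ?_
          have h4 : postMean S σ m z j = u j + (w1 j + w2 j) := by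
            have := congrFun hsub j
            simp only [Pi.sub_apply, Pi.add_apply] at this
            linarith
          rw [h4]
          nlinarith [sq_nonneg (w1 j - w2 j), sq_nonneg (w1 j - (u j - S.coeff f₀ j)),
            sq_nonneg (w2 j - (u j - S.coeff f₀ j))]
        have h5 : ∑ j, (B * B.transpose) j j ≤ T := by
          rw [hB]
          exact htr
        have h6 : ((t ^ 2)⁻¹ * c₁ + (t ^ 2)⁻¹ * 3 * Q e) * t ^ 2 = c₁ + 3 * Q e := by
          field_simp
        rw [h6]
        have h7 : 3 * (4 / (n : ℝ) * s x + 16 * (σ : ℝ) ^ 4 / n ^ 2 * V) =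
            12 / n * s x + 48 * (σ : ℝ) ^ 4 / n ^ 2 * V := by ring
        have h8 : 0 ≤ ‖S.tail m f₀‖ ^ 2 := sq_nonneg _
        simp only [c₁]
        linarith
      refine (lintegral_mono he).trans ?_
      rw [lintegral_add_left measurable_const, lintegral_const, measure_univ, mul_one,
        lintegral_const_mul' _ _ (by simp)]
      have hnoise := (lintegral_noise_le (m := m) (x := x) hpos hσ).trans
        (ENNReal.ofReal_le_ofReal htr)
      calc _ ≤ ENNReal.ofReal ((t ^ 2)⁻¹ * c₁) +
            ENNReal.ofReal ((t ^ 2)⁻¹ * 3) * ENNReal.ofReal T := by gcongr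
        _ = _ := by
          rw [← ENNReal.ofReal_mul (by positivity), ← ENNReal.ofReal_mul (by positivity),
            ← ENNReal.ofReal_add (by positivity) (by positivity),
            ← ENNReal.ofReal_add (by positivity) (mul_nonneg (by positivity) (hs0 x))]
          congr 1
          simp only [c₁, c₀]
          ring
  refine (lintegral_map_le _ _).trans ((lintegral_prod_le _).trans ((lintegral_mono hpt).trans ?_))
  have hf : Measurable f₀ := (Lp.stronglyMeasurable f₀).measurable
  have hφ := S.φ_measurable
  have hms : Measurable s := by
    simp only [s, MercerKernel.headEval]
    fun_prop
  rw [lintegral_add_right _ (by fun_prop), lintegral_add_right _ (by fun_prop), lintegral_const,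
    measure_univ, mul_one, lintegral_const_mul' _ _ (by simp), lintegral_sum_residual_sq]
  refine add_le_add ((lintegral_indicator_one_le _).trans
    (measure_not_wellConditioned_le hC m hn)) (le_of_eq ?_)
  rw [← ENNReal.ofReal_mul (by positivity), ← ENNReal.ofReal_add (by positivity) (by positivity)]
  congr 1
  simp only [c₀]
  field_simp
  ring

end Oracle

/-! ### The contraction rate -/

section Rate

/-- The trace of the posterior covariance: the first `N` coefficients are estimated with variance
of order `1 / n`, the others keep at most their prior variance. -/
lemma sum_posterior_variance_le {l : ℕ → ℝ} {C q s n N : ℝ} (hq : 1 ≤ q) (hl : ∀ j, 0 < l j)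
    (hsum : Summable l) (hC : 0 ≤ C) (hu : ∀ j : ℕ, l j ≤ C * ((j : ℝ) + 1) ^ (-1 - q))
    (hs : 0 < s) (hN : 1 ≤ N) (hn : N ^ (1 + q) = n) (m : ℕ) :
    ∑ j : Fin m, ((l j)⁻¹ + n / (2 * s ^ 2))⁻¹ ≤ (4 * s ^ 2 + C) * N ^ (-q) := by
  have hN0 : 0 < N := by linarith
  have hn0 : 0 < n := hn ▸ Real.rpow_pos_of_pos hN0 _
  set t : ℕ → ℝ := fun j => ((l j)⁻¹ + n / (2 * s ^ 2))⁻¹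
  have ht0 : ∀ j, 0 ≤ t j := fun j => by
    have := hl j
    positivity
  have ht1 : ∀ j, t j ≤ 2 * s ^ 2 / n := fun j => by
    rw [← inv_div]
    exact inv_anti₀ (by positivity) (le_add_of_nonneg_left (inv_pos.2 (hl j)).le)
  have ht2 : ∀ j, t j ≤ l j := fun j =>
    (inv_anti₀ (inv_pos.2 (hl j)) (le_add_of_nonneg_right (by positivity))).trans_eq (inv_inv _)
  set J := ⌈N⌉₊
  have hJ : N ≤ J := Nat.le_ceil N
  have hJ0 : 0 < J := Nat.ceil_pos.2 hN0
  have hJ2 : (J : ℝ) ≤ 2 * N := (Nat.ceil_lt_add_one hN0.le).le.trans (by linarith)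
  have hNn : N / n = N ^ (-q) := by
    rw [← hn, Real.rpow_add hN0, Real.rpow_one, Real.rpow_neg hN0.le]
    field_simp
  rw [Fin.sum_univ_eq_sum_range t m]
  calc ∑ j ∈ Finset.range m, t j ≤ ∑ j ∈ Finset.range (J + m), t j :=
        Finset.sum_le_sum_of_subset_of_nonneg (Finset.range_mono (by omega)) fun j _ _ => ht0 j
    _ = ∑ j ∈ Finset.range J, t j + ∑ j ∈ Finset.range m, t (J + j) := Finset.sum_range_add _ _ _
    _ ≤ ∑ _j ∈ Finset.range J, 2 * s ^ 2 / n + ∑ j ∈ Finset.range m, l (j + J) :=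
        add_le_add (Finset.sum_le_sum fun j _ => ht1 j)
          (Finset.sum_le_sum fun j _ => by rw [add_comm]; exact ht2 _)
    _ ≤ 2 * N * (2 * s ^ 2 / n) + C * N ^ (-q) := by
        refine add_le_add ?_ ?_
        · rw [Finset.sum_const, Finset.card_range, nsmul_eq_mul]
          gcongr
        · refine (((summable_nat_add_iff J).2 hsum).sum_le_tsum _ fun j _ => (hl _).le).trans
            ((tsum_tail_le hq (fun j => (hl j).le) hC hu hJ0).trans ?_)
          exact mul_le_mul_of_nonneg_left
            (Real.rpow_le_rpow_of_nonpos hN0 hJ (by linarith)) hC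
    _ = 4 * s ^ 2 * (N / n) + C * N ^ (-q) := by ring
    _ = _ := by rw [hNn]; ring

variable {𝒳 : Type*} [TopologicalSpace 𝒳] [MeasurableSpace 𝒳] {μ : Measure 𝒳}
  [IsProbabilityMeasure μ] [IsSeparable μ] {S : MercerKernel μ} {C : ℝ}
  {Pr : Measure (L2 μ)} [IsProbabilityMeasure Pr]

/-- The truncation `∑_{j<J} ⟨f, φⱼ⟩ φⱼ` as a vector of coefficients. -/
noncomputable def MercerKernel.truncation (S : MercerKernel μ) (f : L2 μ) (J m : ℕ) : Fin m → ℝ :=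
  fun j => if (j : ℕ) < J then S.coeff f j else 0

lemma norm_synth_truncation_sub_sq_le {f : L2 μ} {b : ℝ} (hb : 0 ≤ b)
    (hf : Summable fun j : ℕ => ((j : ℝ) + 1) ^ b * S.coeff f j ^ 2) {J m : ℕ} (hJ : J ≤ m) :
    ‖S.synth m (S.truncation f J m) - f‖ ^ 2 ≤
      ((J : ℝ) + 1) ^ (-b) * ∑' j : ℕ, ((j : ℝ) + 1) ^ b * S.coeff f j ^ 2 := by
  have h := S.hasSum_sq_coeff (S.synth m (S.truncation f J m) - f)
  rw [← h.tsum_eq, ← tsum_mul_left]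
  refine h.summable.tsum_le_tsum (fun j => ?_) (hf.mul_left _)
  have hj : (0 : ℝ) < (j : ℝ) + 1 := by positivity
  rw [S.coeff_sub, S.coeff_synth]
  by_cases hjJ : j < J
  · rw [dif_pos (hjJ.trans_le hJ), MercerKernel.truncation, if_pos hjJ, sub_self,
      zero_pow two_ne_zero]
    positivity
  · have h0 : (if h : j < m then S.truncation f J m ⟨j, h⟩ else 0) = 0 := by
      split_ifs
      · exact if_neg hjJ
      · rfl
    rw [h0, zero_sub, neg_sq, ← mul_assoc]
    refine le_mul_of_one_le_left (sq_nonneg _) ?_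
    rw [Real.rpow_neg (by positivity), ← div_eq_inv_mul, one_le_div (by positivity)]
    refine Real.rpow_le_rpow (by positivity) ?_ hb
    have : (J : ℝ) ≤ j := by exact_mod_cast not_lt.1 hjJ
    linarith

lemma sum_truncation_div_sq_le {f : L2 μ} {b q e c N : ℝ} (he : e ≤ b) (heq : e ≤ 2 + 2 * q)
    (hc : 0 < c)
    (hlow : ∀ j : ℕ, c * ((j : ℝ) + 1) ^ (-1 - q) ≤ S.lam j)
    (hf : Summable fun j : ℕ => ((j : ℝ) + 1) ^ b * S.coeff f j ^ 2) {J m : ℕ} (hJ : (J : ℝ) ≤ N) :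
    ∑ j : Fin m, (S.truncation f J m j / S.lam j) ^ 2 ≤
      (c ^ 2)⁻¹ * N ^ (2 + 2 * q - e) * ∑' j : ℕ, ((j : ℝ) + 1) ^ b * S.coeff f j ^ 2 := by
  set g : ℕ → ℝ := fun j => ((j : ℝ) + 1) ^ b * S.coeff f j ^ 2
  have hg : ∀ j, 0 ≤ g j := fun j => by positivity
  have hN0 : 0 ≤ N := (Nat.cast_nonneg J).trans hJ
  have h1 : ∀ j : Fin m, (S.truncation f J m j / S.lam j) ^ 2 ≤
      (c ^ 2)⁻¹ * N ^ (2 + 2 * q - e) * g j := fun j => by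
    by_cases hj : (j : ℕ) < J
    · rw [MercerKernel.truncation, if_pos hj, div_pow]
      have hj1 : (1 : ℝ) ≤ (j : ℕ) + 1 := by
        have : (0 : ℝ) ≤ (j : ℕ) := Nat.cast_nonneg _
        linarith
      have hj0 : (0 : ℝ) < (j : ℕ) + 1 := by linarith
      have hjN : ((j : ℕ) : ℝ) + 1 ≤ N := by
        have : ((j : ℕ) : ℝ) + 1 ≤ J := by exact_mod_cast hj
        linarith
      have h2 : c ^ 2 * (((j : ℕ) : ℝ) + 1) ^ (-(2 + 2 * q)) ≤ S.lam j ^ 2 := by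
        have := pow_le_pow_left₀ (by positivity) (hlow j) 2
        rw [mul_pow, ← Real.rpow_mul_natCast hj0.le] at this
        rwa [show -(2 + 2 * q) = (-1 - q) * (2 : ℕ) by push_cast; ring]
      have h3 : (((j : ℕ) : ℝ) + 1) ^ (2 + 2 * q - b) ≤ N ^ (2 + 2 * q - e) :=
        (Real.rpow_le_rpow_of_exponent_le hj1 (by linarith)).trans
          (Real.rpow_le_rpow hj0.le hjN (by linarith))
      calc S.coeff f j ^ 2 / S.lam j ^ 2
          ≤ S.coeff f j ^ 2 / (c ^ 2 * (((j : ℕ) : ℝ) + 1) ^ (-(2 + 2 * q))) := by gcongr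
        _ = (c ^ 2)⁻¹ * (((j : ℕ) : ℝ) + 1) ^ (2 + 2 * q - b) * g j := by
            simp only [g]
            rw [Real.rpow_sub hj0, Real.rpow_neg hj0.le]
            field_simp
        _ ≤ _ := by
            have := hg j
            gcongr
    · rw [MercerKernel.truncation, if_neg hj, zero_div, zero_pow two_ne_zero]
      have := hg j
      positivity
  refine (Finset.sum_le_sum fun j _ => h1 j).trans ?_
  rw [← Finset.mul_sum]
  refine mul_le_mul_of_nonneg_left ?_ (by positivity)
  rw [Fin.sum_univ_eq_sum_range g m]
  exact hf.sum_le_tsum _ fun j _ => hg j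

/-- For `N^{1+q} = n` and at least `a N` features, the bound of the oracle inequality at a suitable
truncation of `f₀` is of the order `N^{-min(b, q)}`. -/
lemma exists_oracle_bound {C c q b a : ℝ} (hq : 1 ≤ q) (hb : 0 ≤ b) (ha : 0 < a) (ha1 : a ≤ 1)
    (hC : 0 ≤ C) (hc : 0 < c) (hpos : ∀ j, 0 < S.lam j)
    (hlow : ∀ j : ℕ, c * ((j : ℝ) + 1) ^ (-1 - q) ≤ S.lam j)
    (hu : ∀ j : ℕ, S.lam j ≤ C * ((j : ℝ) + 1) ^ (-1 - q)) {σ : ℝ} (hσ : 0 < σ) {f₀ : L2 μ}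
    (hf : Summable fun j : ℕ => ((j : ℝ) + 1) ^ b * S.coeff f₀ j ^ 2) :
    ∃ K : ℝ, 0 < K ∧ ∀ (m : ℕ) (n N : ℝ), 1 ≤ N → N ^ (1 + q) = n → a * N ≤ m →
      ∃ u : Fin m → ℝ, 4 * ∑ j : Fin m, ((S.lam j)⁻¹ + n / (2 * σ ^ 2))⁻¹ +
        48 * σ ^ 4 / n ^ 2 * ∑ j : Fin m, (u j / S.lam j) ^ 2 +
        15 * ‖S.synth m u - f₀‖ ^ 2 + 2 * ∑' j, S.lam (j + m) ≤ K * N ^ (-min b q) := by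
  set e := min b q
  have heb : e ≤ b := min_le_left _ _
  have heq : e ≤ q := min_le_right _ _
  have he : 0 ≤ e := le_min hb (by linarith)
  set B := ∑' j : ℕ, ((j : ℝ) + 1) ^ b * S.coeff f₀ j ^ 2
  have hB : 0 ≤ B := tsum_nonneg fun j => by positivity
  refine ⟨4 * (4 * σ ^ 2 + C) + 48 * σ ^ 4 * ((c ^ 2)⁻¹ * B) + 15 * (a ^ (-e) * B) +
    2 * (C * a ^ (-q)), by positivity, fun m n N hN hn hm => ?_⟩
  have hN0 : 0 < N := by linarith
  have hn0 : 0 < n := hn ▸ Real.rpow_pos_of_pos hN0 _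
  have hqe : N ^ (-q) ≤ N ^ (-e) := Real.rpow_le_rpow_of_exponent_le hN (by linarith)
  have hm0 : 0 < m := by
    have : (0 : ℝ) < m := lt_of_lt_of_le (by positivity) hm
    exact_mod_cast this
  -- truncate at level `N`, or at `m` if this is smaller
  set J := min m ⌊N⌋₊
  have hJm : J ≤ m := min_le_left _ _
  have hJN : (J : ℝ) ≤ N := by
    have h1 : (J : ℝ) ≤ (⌊N⌋₊ : ℕ) := by exact_mod_cast min_le_right _ _
    exact h1.trans (Nat.floor_le hN0.le)
  have hJa : a * N ≤ J + 1 := by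
    rcases min_choice m ⌊N⌋₊ with h | h
    · simp only [J, h]
      linarith
    · simp only [J, h]
      have := Nat.lt_floor_add_one N
      nlinarith
  refine ⟨S.truncation f₀ J m, ?_⟩
  have hT := sum_posterior_variance_le hq hpos S.lam_summable hC hu hσ hN hn m
  have hV := sum_truncation_div_sq_le (m := m) heb (by linarith : e ≤ 2 + 2 * q) hc hlow hf hJN
  have hA := norm_synth_truncation_sub_sq_le hb hf hJm
  have hL := tsum_tail_le hq (fun j => (hpos j).le) hC hu hm0
  have hT' : 4 * ∑ j : Fin m, ((S.lam j)⁻¹ + n / (2 * σ ^ 2))⁻¹ ≤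
      4 * (4 * σ ^ 2 + C) * N ^ (-e) := by
    have := mul_le_mul_of_nonneg_left hqe (by positivity : 0 ≤ 4 * σ ^ 2 + C)
    linarith
  have hV' : 48 * σ ^ 4 / n ^ 2 * ∑ j : Fin m, (S.truncation f₀ J m j / S.lam j) ^ 2 ≤
      48 * σ ^ 4 * ((c ^ 2)⁻¹ * B) * N ^ (-e) := by
    refine (mul_le_mul_of_nonneg_left hV (by positivity)).trans_eq ?_
    have h1 : N ^ (2 + 2 * q - e) = n ^ 2 * N ^ (-e) := by
      rw [← hn, ← Real.rpow_mul_natCast hN0.le, ← Real.rpow_add hN0]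
      congr 1
      push_cast
      ring
    rw [h1]
    change _ * (_ * _ * B) = _
    field_simp
  have hA' : 15 * ‖S.synth m (S.truncation f₀ J m) - f₀‖ ^ 2 ≤ 15 * (a ^ (-e) * B) * N ^ (-e) := by
    have h1 : ((J : ℝ) + 1) ^ (-b) ≤ a ^ (-e) * N ^ (-e) := by
      rw [← Real.mul_rpow ha.le hN0.le]
      refine (Real.rpow_le_rpow_of_exponent_le (by
        have : (0 : ℝ) ≤ J := Nat.cast_nonneg _
        linarith) (by linarith : -b ≤ -e)).trans ?_
      exact Real.rpow_le_rpow_of_nonpos (by positivity) hJa (by linarith)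
    have := mul_le_mul_of_nonneg_right h1 hB
    linarith
  have hL' : 2 * ∑' j, S.lam (j + m) ≤ 2 * (C * a ^ (-q)) * N ^ (-e) := by
    have h1 : (m : ℝ) ^ (-q) ≤ a ^ (-q) * N ^ (-e) := by
      refine (Real.rpow_le_rpow_of_nonpos (by positivity) hm (by linarith)).trans ?_
      rw [Real.mul_rpow ha.le hN0.le]
      gcongr
    have := mul_le_mul_of_nonneg_left h1 hC
    linarith
  linarith

/-- With `m ≍ n^r`, `1/(1+q) ≤ r < 1/2`, features the variational posterior contracts at the
rate `n^{-min(b, q) / (2 (1 + q))}`. -/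
theorem contractsAtRate_variationalPosterior (hC : ∀ j x, |S.φ j x| ≤ C) (hPr : IsGPPrior S Pr)
    (hpos : ∀ j, 0 < S.lam j) (hsum : Summable fun j => √(S.lam j)) {c C' q b : ℝ} (hq : 1 ≤ q)
    (hb : 0 ≤ b) (hc : 0 < c) (hC' : 0 ≤ C')
    (hlow : ∀ j : ℕ, c * ((j : ℝ) + 1) ^ (-1 - q) ≤ S.lam j)
    (hu : ∀ j : ℕ, S.lam j ≤ C' * ((j : ℝ) + 1) ^ (-1 - q)) {σ : ℝ≥0} (hσ : 0 < σ) {m : ℕ → ℕ}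
    {r : ℝ} (hm : (fun n => (m n : ℝ)) =Θ[atTop] fun n : ℕ => (n : ℝ) ^ r)
    (hr : (1 + q)⁻¹ ≤ r) (hr2 : r < 1 / 2) {f₀ : L2 μ}
    (hf : Summable fun j : ℕ => ((j : ℝ) + 1) ^ b * S.coeff f₀ j ^ 2) {ε : ℕ → ℝ}
    (hε : ∀ n, 0 < n → 0 < ε n ∧ ε n ^ 2 = (n : ℝ) ^ (-(min b q / (1 + q)))) :
    ContractsAtRate σ (fun n z => variationalPosterior S Pr σ (m n) z) f₀ ε := by
  intro M hM
  obtain ⟨A, hA, hmA⟩ := hm.1.exists_pos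
  obtain ⟨A', hA', hmA'⟩ := hm.2.exists_pos
  rw [isBigOWith_iff] at hmA hmA'
  set a := min A'⁻¹ 1
  have ha : 0 < a := lt_min (inv_pos.2 hA') one_pos
  obtain ⟨K, hK, hKb⟩ := exists_oracle_bound hq hb ha (min_le_right _ _) hC' hc hpos hlow hu
    (σ := (σ : ℝ)) hσ hf
  have hev : ∀ᶠ n : ℕ in atTop, ∫⁻ z, variationalPosterior S Pr σ (m n) z
      {f | M n * ε n ≤ ‖f - f₀‖} ∂(dataLaw σ f₀ n) ≤
      ENNReal.ofReal (4 * A ^ 2 * C ^ 4 * (n : ℝ) ^ (2 * r - 1)) +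
        ENNReal.ofReal (K * ((M n) ^ 2)⁻¹) := by
    filter_upwards [hmA, hmA', eventually_gt_atTop 0, hM.eventually_gt_atTop 0]
      with n hn hn2 hn0 hMn
    have hn' : (0 : ℝ) < n := by exact_mod_cast hn0
    have hn1 : (1 : ℝ) ≤ n := by exact_mod_cast hn0
    rw [Real.norm_of_nonneg (by positivity), Real.norm_of_nonneg (by positivity)] at hn hn2
    have hεn := hε n hn0
    have hq0 : 0 < 1 + q := by linarith
    -- the effective dimension, at which `N / n = N^{-q}`
    set N : ℝ := (n : ℝ) ^ (1 + q)⁻¹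
    have hN : 1 ≤ N := Real.one_le_rpow hn1 (by positivity)
    have hNn : N ^ (1 + q) = n := by
      rw [← Real.rpow_mul hn'.le, inv_mul_cancel₀ hq0.ne', Real.rpow_one]
    have haN : a * N ≤ m n := by
      calc a * N ≤ A'⁻¹ * (n : ℝ) ^ r :=
            mul_le_mul (min_le_left _ _) (Real.rpow_le_rpow_of_exponent_le hn1 hr)
              (by positivity) (by positivity)
        _ ≤ m n := by rwa [inv_mul_le_iff₀ hA']
    obtain ⟨u, hub⟩ := hKb (m n) n N hN hNn haN
    refine (lintegral_variationalPosterior_le hC hPr hpos hsum hσ (m n) hn0 f₀ u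
      (mul_pos hMn hεn.1)).trans (add_le_add (ENNReal.ofReal_le_ofReal ?_)
        (ENNReal.ofReal_le_ofReal ?_))
    · have h1 : (m n : ℝ) ^ 2 ≤ A ^ 2 * (n : ℝ) ^ (2 * r) := by
        have := pow_le_pow_left₀ (by positivity) hn 2
        rwa [mul_pow, ← Real.rpow_mul_natCast hn'.le, mul_comm r, Nat.cast_ofNat] at this
      rw [Real.rpow_sub hn', Real.rpow_one]
      have hC4 : 0 ≤ C ^ 4 := by positivity
      calc 4 * (m n : ℝ) ^ 2 * C ^ 4 / n ≤ 4 * (A ^ 2 * (n : ℝ) ^ (2 * r)) * C ^ 4 / n := by gcongr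
        _ = _ := by ring
    · refine (mul_le_mul_of_nonneg_left hub (by positivity)).trans_eq ?_
      have h1 : N ^ (-min b q) = ε n ^ 2 := by
        rw [hεn.2, ← Real.rpow_mul hn'.le]
        congr 1
        field_simp
      have hε0 := hεn.1
      rw [h1]
      field_simp
  have h1 : Tendsto (fun n : ℕ => 4 * A ^ 2 * C ^ 4 * (n : ℝ) ^ (2 * r - 1)) atTop (𝓝 0) := by
    have h2 : Tendsto (fun n : ℕ => (n : ℝ) ^ (-(1 - 2 * r))) atTop (𝓝 0) :=
      (tendsto_rpow_neg_atTop (by linarith)).comp tendsto_natCast_atTop_atTop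
    have := h2.const_mul (4 * A ^ 2 * C ^ 4)
    simpa using this
  have h2 : Tendsto (fun n => K * ((M n) ^ 2)⁻¹) atTop (𝓝 0) := by
    have := (((tendsto_pow_atTop two_ne_zero).comp hM).inv_tendsto_atTop).const_mul K
    simpa using this
  have h3 := (ENNReal.tendsto_ofReal h1).add (ENNReal.tendsto_ofReal h2)
  simp only [ENNReal.ofReal_zero, add_zero] at h3
  exact tendsto_of_tendsto_of_tendsto_of_le_of_le' tendsto_const_nhds h3
    (Eventually.of_forall fun _ => zero_le) hev

end Rate

/-! ### The minimax risk: upper bound -/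

section MinimaxUpper

variable {𝒳 : Type*} [TopologicalSpace 𝒳] [MeasurableSpace 𝒳] {μ : Measure 𝒳}
  [IsProbabilityMeasure μ] [IsSeparable μ] {S : MercerKernel μ} {C : ℝ}

lemma enorm_sq_eq_ofReal {E : Type*} [SeminormedAddCommGroup E] (x : E) :
    ‖x‖ₑ ^ 2 = ENNReal.ofReal (‖x‖ ^ 2) := by
  rw [ENNReal.ofReal_pow (norm_nonneg _), ofReal_norm]

lemma memLp_mul_φ (hC : ∀ j x, |S.φ j x| ≤ C) (f : L2 μ) (j : ℕ) :
    MemLp (fun x => f x * S.φ j x) 2 μ := by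
  refine MemLp.of_le_mul (g := f) (c := C) (Lp.memLp f)
    ((Lp.aestronglyMeasurable f).mul (S.φ_measurable j).aestronglyMeasurable)
    (ae_of_all _ fun x => ?_)
  rw [norm_mul, mul_comm]
  exact mul_le_mul_of_nonneg_right (hC j x) (norm_nonneg _)

lemma integral_mul_φ (f : L2 μ) (j : ℕ) : ∫ x, f x * S.φ j x ∂μ = S.coeff f j := by
  rw [MercerKernel.coeff, L2.inner_def]
  refine integral_congr_ae ?_
  filter_upwards [S.basis_ae_eq j] with x hx
  simp [hx]

lemma integral_sq_mul_φ_le (hC : ∀ j x, |S.φ j x| ≤ C) (f : L2 μ) (j : ℕ) :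
    ∫ x, (f x * S.φ j x - S.coeff f j) ^ 2 ∂μ ≤ C ^ 2 * ‖f‖ ^ 2 := by
  have hm := memLp_mul_φ hC f j
  rw [← integral_mul_φ, ← variance_eq_integral hm.aemeasurable]
  refine (variance_le_expectation_sq hm.aestronglyMeasurable).trans ?_
  rw [← real_inner_self_eq_norm_sq, L2.inner_def, ← integral_const_mul]
  refine integral_mono hm.integrable_sq ((L2.integrable_inner f f).const_mul _) fun x => ?_
  simp only [real_inner_self_eq_norm_sq, Real.norm_eq_abs, sq_abs, Pi.pow_apply]
  rw [mul_pow, mul_comm]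
  refine mul_le_mul_of_nonneg_right ?_ (sq_nonneg _)
  rw [← sq_abs]
  exact pow_le_pow_left₀ (abs_nonneg _) (hC j x) 2

/-- The empirical coefficients `n⁻¹ ∑ᵢ yᵢ φⱼ(xᵢ)`, `j < J`. -/
noncomputable def MercerKernel.empCoeff (S : MercerKernel μ) (J : ℕ) {n : ℕ} (z : Data 𝒳 n) :
    Fin J → ℝ :=
  fun j => (n : ℝ)⁻¹ * ∑ i, z.2 i * S.φ j (z.1 i)

lemma measurable_empCoeff (J n : ℕ) : Measurable fun z : Data 𝒳 n => S.empCoeff J z := by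
  have := S.φ_measurable
  unfold MercerKernel.empCoeff
  fun_prop

/-- The empirical coefficients are unbiased, with variance of the order `1 / n`. -/
lemma lintegral_empCoeff_sub_sq_le (hC : ∀ j x, |S.φ j x| ≤ C) {σ : ℝ≥0} {n : ℕ} (hn : 0 < n)
    (f : L2 μ) {J : ℕ} (j : Fin J) :
    ∫⁻ z, ENNReal.ofReal ((S.empCoeff J z j - S.coeff f j) ^ 2) ∂(dataLaw σ f n) ≤
      ENNReal.ofReal (2 * C ^ 2 * (‖f‖ ^ 2 + (σ : ℝ) ^ 2) / n) := by
  have hn' : (0 : ℝ) < n := by exact_mod_cast hn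
  set X : 𝒳 → ℝ := fun x => f x * S.φ j x - S.coeff f j
  have hX : MemLp X 2 μ := (memLp_mul_φ hC f j).sub (memLp_const _)
  have hX0 : ∫ x, X x ∂μ = 0 := by
    simp only [X]
    rw [integral_sub ((memLp_mul_φ hC f j).integrable (by simp)) (integrable_const _),
      integral_mul_φ]
    simp
  have h1 := integral_sq_sum_pi (ν := μ) (n := n) (X := fun _ => X) (fun _ => hX) fun _ => hX0
  have h1' : ∫⁻ x, ENNReal.ofReal ((∑ i, X (x i)) ^ 2) ∂(Measure.pi fun _ : Fin n => μ) ≤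
      ENNReal.ofReal (n * (C ^ 2 * ‖f‖ ^ 2)) := by
    rw [← ofReal_integral_eq_lintegral_ofReal h1.1 (ae_of_all _ fun x => sq_nonneg _), h1.2]
    refine ENNReal.ofReal_le_ofReal ?_
    simpa using mul_le_mul_of_nonneg_left (integral_sq_mul_φ_le hC f j) hn'.le
  have h2 : ∀ x : Fin n → 𝒳, ∫⁻ e, ENNReal.ofReal ((∑ i, S.φ j (x i) * e i) ^ 2)
      ∂(Measure.pi fun _ : Fin n => gaussianReal 0 (σ ^ 2)) ≤
        ENNReal.ofReal ((σ : ℝ) ^ 2 * (n * C ^ 2)) := fun x => by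
    have h3 := integral_sq_sum_mul_gaussian (fun i => S.φ j (x i)) (σ ^ 2)
    rw [← ofReal_integral_eq_lintegral_ofReal h3.1 (ae_of_all _ fun x => sq_nonneg _), h3.2]
    refine ENNReal.ofReal_le_ofReal ?_
    push_cast
    gcongr
    calc ∑ i, S.φ j (x i) ^ 2 ≤ ∑ _i : Fin n, C ^ 2 := by
          refine Finset.sum_le_sum fun i _ => ?_
          rw [← sq_abs]
          exact pow_le_pow_left₀ (abs_nonneg _) (hC _ _) 2
      _ = n * C ^ 2 := by simp
  set k : ℝ := 2 * ((n : ℝ)⁻¹) ^ 2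
  have hk : 0 ≤ k := by positivity
  have hpt : ∀ (x : Fin n → 𝒳) (e : Fin n → ℝ),
      ENNReal.ofReal ((S.empCoeff J ((x, fun i => f (x i) + e i) : Data 𝒳 n) j -
        S.coeff f j) ^ 2) ≤ ENNReal.ofReal k * ENNReal.ofReal ((∑ i, X (x i)) ^ 2) +
          ENNReal.ofReal k * ENNReal.ofReal ((∑ i, S.φ j (x i) * e i) ^ 2) := fun x e => by
    rw [← ENNReal.ofReal_mul hk, ← ENNReal.ofReal_mul hk,
      ← ENNReal.ofReal_add (by positivity) (by positivity)]
    refine ENNReal.ofReal_le_ofReal ?_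
    have e1 : S.empCoeff J ((x, fun i => f (x i) + e i) : Data 𝒳 n) j - S.coeff f j =
        (n : ℝ)⁻¹ * (∑ i, X (x i) + ∑ i, S.φ j (x i) * e i) := by
      simp only [MercerKernel.empCoeff, X, Finset.sum_sub_distrib, add_mul,
        Finset.sum_add_distrib, Finset.sum_const, Finset.card_univ, Fintype.card_fin,
        nsmul_eq_mul, mul_comm (e _)]
      field_simp
      ring
    rw [e1, mul_pow]
    simp only [k]
    have := add_sq_le (a := ∑ i, X (x i)) (b := ∑ i, S.φ j (x i) * e i)
    calc _ ≤ ((n : ℝ)⁻¹) ^ 2 * (2 * ((∑ i, X (x i)) ^ 2 + (∑ i, S.φ j (x i) * e i) ^ 2)) := by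
          gcongr
      _ = _ := by ring
  refine (lintegral_map_le _ _).trans ((lintegral_prod_le _).trans ?_)
  calc _ ≤ ∫⁻ x, (ENNReal.ofReal k * ENNReal.ofReal ((∑ i, X (x i)) ^ 2) +
          ENNReal.ofReal k * ENNReal.ofReal ((σ : ℝ) ^ 2 * (n * C ^ 2)))
          ∂(Measure.pi fun _ : Fin n => μ) := by
        refine lintegral_mono fun x => (lintegral_mono fun e => hpt x e).trans ?_
        rw [lintegral_add_left measurable_const, lintegral_const, measure_univ, mul_one,
          lintegral_const_mul' _ _ (by simp)]
        gcongr
        exact h2 x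
    _ ≤ ENNReal.ofReal k * ENNReal.ofReal (n * (C ^ 2 * ‖f‖ ^ 2)) +
          ENNReal.ofReal k * ENNReal.ofReal ((σ : ℝ) ^ 2 * (n * C ^ 2)) := by
        rw [lintegral_add_right _ measurable_const, lintegral_const, measure_univ, mul_one,
          lintegral_const_mul' _ _ (by simp)]
        gcongr
    _ = _ := by
        rw [← ENNReal.ofReal_mul hk, ← ENNReal.ofReal_mul hk,
          ← ENNReal.ofReal_add (by positivity) (by positivity)]
        congr 1
        simp only [k]
        field_simp

/-- The risk of the projection estimator with `J` coefficients. -/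
lemma minimaxRisk_le (hC : ∀ j x, |S.φ j x| ≤ C) {σ : ℝ≥0} {n : ℕ} (hn : 0 < n) {b R : ℝ}
    (hb : 0 ≤ b) {F : Set (L2 μ)} (hF : ∀ f ∈ F,
      (Summable fun j : ℕ => ((j : ℝ) + 1) ^ b * S.coeff f j ^ 2) ∧
        ∑' j : ℕ, ((j : ℝ) + 1) ^ b * S.coeff f j ^ 2 ≤ R ^ 2) (J : ℕ) :
    minimaxRisk σ F n ≤ ENNReal.ofReal (J * (2 * C ^ 2 * (R ^ 2 + (σ : ℝ) ^ 2) / n) +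
      ((J : ℝ) + 1) ^ (-b) * R ^ 2) := by
  have hsyn : Continuous (S.synth J) := (S.synth J).continuous
  refine iInf₂_le_of_le (fun z => S.synth J (S.empCoeff J z))
    (hsyn.measurable.comp (measurable_empCoeff J n)) (iSup₂_le fun f hf => ?_)
  obtain ⟨hs, hR⟩ := hF f hf
  have hfR : ‖f‖ ^ 2 ≤ R ^ 2 := by
    refine le_trans ?_ hR
    rw [← (S.hasSum_sq_coeff f).tsum_eq]
    refine (S.hasSum_sq_coeff f).summable.tsum_le_tsum (fun j => ?_) hs
    refine le_mul_of_one_le_left (sq_nonneg _) (Real.one_le_rpow ?_ hb)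
    have : (0 : ℝ) ≤ j := Nat.cast_nonneg _
    linarith
  have htail : ‖S.tail J f‖ ^ 2 ≤ ((J : ℝ) + 1) ^ (-b) * R ^ 2 := by
    have h1 := norm_synth_truncation_sub_sq_le hb hs (le_refl J)
    have h2 : S.synth J (S.truncation f J J) - f = -S.tail J f := by
      rw [S.tail_apply, neg_sub]
      congr 2
      funext j
      simp [MercerKernel.truncation, MercerKernel.features]
    rw [h2, norm_neg] at h1
    exact h1.trans (mul_le_mul_of_nonneg_left hR (by positivity))
  have hpt : ∀ z : Data 𝒳 n, ‖S.synth J (S.empCoeff J z) - f‖ₑ ^ 2 =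
      ∑ j : Fin J, ENNReal.ofReal ((S.empCoeff J z j - S.coeff f j) ^ 2) +
        ENNReal.ofReal (‖S.tail J f‖ ^ 2) := fun z => by
    have h1 := S.norm_comb_sub_sq J (S.empCoeff J z) 0 f
    have h2 : S.comb J (S.empCoeff J z, 0) = S.synth J (S.empCoeff J z) := by
      simp [MercerKernel.comb]
    rw [h2, map_zero, zero_sub, norm_neg] at h1
    rw [enorm_sq_eq_ofReal, h1, ENNReal.ofReal_add (Finset.sum_nonneg fun _ _ => sq_nonneg _)
      (sq_nonneg _), ENNReal.ofReal_sum_of_nonneg fun _ _ => sq_nonneg _]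
  have hmeas : ∀ j : Fin J, Measurable fun z : Data 𝒳 n =>
      ENNReal.ofReal ((S.empCoeff J z j - S.coeff f j) ^ 2) := fun j => by
    have := (measurable_pi_apply j).comp (measurable_empCoeff (S := S) J n)
    exact ((this.sub_const _).pow_const 2).ennreal_ofReal
  simp_rw [hpt]
  rw [lintegral_add_right _ measurable_const, lintegral_const, measure_univ, mul_one,
    lintegral_finsetSum _ fun j _ => hmeas j,
    ENNReal.ofReal_add (by positivity) (by positivity)]
  refine add_le_add ?_ (ENNReal.ofReal_le_ofReal htail)
  calc _ ≤ ∑ _j : Fin J, ENNReal.ofReal (2 * C ^ 2 * (‖f‖ ^ 2 + (σ : ℝ) ^ 2) / n) :=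
        Finset.sum_le_sum fun j _ => lintegral_empCoeff_sub_sq_le hC hn f j
    _ ≤ ∑ _j : Fin J, ENNReal.ofReal (2 * C ^ 2 * (R ^ 2 + (σ : ℝ) ^ 2) / n) := by
        gcongr
    _ = _ := by
        rw [Finset.sum_const, Finset.card_univ, Fintype.card_fin, nsmul_eq_mul,
          ENNReal.ofReal_mul (by positivity), ENNReal.ofReal_natCast]

end MinimaxUpper

/-! ### The minimax risk: lower bound -/

section TwoPoint

/-- Two hypotheses `P` and `L • P` with `∫ L² ≤ K` cannot both be estimated well: the sum of the
squared errors is at least `(a - b)² / (1 + K)`. -/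
lemma two_point_lower_bound {Ω : Type*} [MeasurableSpace Ω] {P : Measure Ω}
    [IsProbabilityMeasure P] {L : Ω → ℝ} (hL0 : ∀ ω, 0 ≤ L ω) (hL : MemLp L 2 P)
    (hL1 : ∫ ω, L ω ∂P = 1) {K : ℝ} (hK : ∫ ω, L ω ^ 2 ∂P ≤ K) (X : Ω → ℝ) (a b : ℝ) :
    ENNReal.ofReal ((a - b) ^ 2 / (1 + K)) ≤
      ∫⁻ ω, (ENNReal.ofReal ((X ω - a) ^ 2) +
        ENNReal.ofReal (L ω) * ENNReal.ofReal ((X ω - b) ^ 2)) ∂P := by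
  have hK0 : 0 ≤ K := (integral_nonneg fun ω => sq_nonneg _).trans hK
  -- The minimum over `X` is attained at `D² L / (1 + L)`; it is bounded from below by
  -- linearising the harmonic mean at its value for `∫ L² = K`.
  set t : ℝ := (1 + K)⁻¹
  have hi1 := hL.integrable (by simp : (1 : ℝ≥0∞) ≤ 2)
  have hi2 := hL.integrable_sq
  set h : Ω → ℝ := fun ω => (a - b) ^ 2 * ((2 * t - t ^ 2) * L ω - t ^ 2 * L ω ^ 2)
  have hpt : ∀ ω, h ω ≤ (X ω - a) ^ 2 + L ω * (X ω - b) ^ 2 := fun ω => by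
    have hl := hL0 ω
    have hl1 : 0 < 1 + L ω := by linarith
    have h1 : (a - b) ^ 2 * (L ω / (1 + L ω)) ≤ (X ω - a) ^ 2 + L ω * (X ω - b) ^ 2 := by
      rw [← mul_div_assoc, div_le_iff₀ hl1]
      nlinarith [sq_nonneg (X ω - a + L ω * (X ω - b))]
    have h2 : (2 * t - t ^ 2) * L ω - t ^ 2 * L ω ^ 2 ≤ L ω / (1 + L ω) := by
      rw [le_div_iff₀ hl1]
      nlinarith [mul_nonneg hl (sq_nonneg (1 - t * (1 + L ω)))]
    exact (mul_le_mul_of_nonneg_left h2 (sq_nonneg _)).trans h1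
  have hih : Integrable h P := ((hi1.const_mul _).sub (hi2.const_mul _)).const_mul _
  have hint : (a - b) ^ 2 / (1 + K) ≤ ∫ ω, h ω ∂P := by
    simp only [h]
    rw [integral_const_mul, integral_sub (hi1.const_mul _) (hi2.const_mul _), integral_const_mul,
      integral_const_mul, hL1, div_eq_mul_inv]
    refine mul_le_mul_of_nonneg_left ?_ (sq_nonneg _)
    have h1 : t ^ 2 * ∫ ω, L ω ^ 2 ∂P ≤ t ^ 2 * K := by gcongr
    have h2 : (2 * t - t ^ 2) * 1 - t ^ 2 * K = (1 + K)⁻¹ := by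
      simp only [t]
      field_simp
      ring
    linarith
  calc ENNReal.ofReal ((a - b) ^ 2 / (1 + K)) ≤ ENNReal.ofReal (∫ ω, h ω ∂P) :=
        ENNReal.ofReal_le_ofReal hint
    _ ≤ ∫⁻ ω, ENNReal.ofReal (h ω) ∂P := by
        rw [integral_eq_lintegral_pos_part_sub_lintegral_neg_part hih]
        exact (ENNReal.ofReal_le_ofReal (sub_le_self _ ENNReal.toReal_nonneg)).trans
          ENNReal.ofReal_toReal_le
    _ ≤ _ := by
        refine lintegral_mono fun ω => ?_
        rw [← ENNReal.ofReal_mul (hL0 ω), ← ENNReal.ofReal_add (sq_nonneg _)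
          (mul_nonneg (hL0 ω) (sq_nonneg _))]
        exact ENNReal.ofReal_le_ofReal (hpt ω)

lemma gaussianReal_eq_tilted_zero (h : ℝ) {v : ℝ≥0} (hv : v ≠ 0) :
    gaussianReal h v = (gaussianReal 0 v).tilted fun x => h / v * x := by
  have hv' : (v : ℝ) ≠ 0 := by exact_mod_cast hv
  have h0 := gaussianReal_eq_tilted 0 hv
  rw [gaussianReal_eq_tilted h hv, h0, tilted_tilted,
    ← tilted_add_const _ (fun x : ℝ => -(x - h) ^ 2 / (2 * v)) (h ^ 2 / (2 * v))]
  · congr 1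
    funext x
    simp only [Pi.add_apply]
    field_simp
    ring
  · by_contra hc
    rw [tilted_of_not_integrable hc] at h0
    exact IsProbabilityMeasure.ne_zero _ h0

variable {n : ℕ} {v : ℝ≥0}

lemma integral_exp_sum_pi_gaussianReal (c : Fin n → ℝ) :
    ∫ e, Real.exp (∑ i, c i * e i) ∂(Measure.pi fun _ : Fin n => gaussianReal 0 v) =
      Real.exp (v * (∑ i, c i ^ 2) / 2) := by
  simp_rw [Real.exp_sum]
  rw [integral_fintype_prod_eq_prod (μ := fun _ : Fin n => gaussianReal 0 v)
    (fun i x => Real.exp (c i * x)), Finset.mul_sum, Finset.sum_div, Real.exp_sum]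
  refine Finset.prod_congr rfl fun i _ => ?_
  have := congrFun (mgf_id_gaussianReal (μ := 0) (v := v)) (c i)
  simpa [mgf] using this

lemma integrable_exp_sum_pi_gaussianReal (c : Fin n → ℝ) :
    Integrable (fun e : Fin n → ℝ => Real.exp (∑ i, c i * e i))
      (Measure.pi fun _ : Fin n => gaussianReal 0 v) := by
  by_contra h
  have h1 := integral_exp_sum_pi_gaussianReal (v := v) c
  rw [integral_undef h] at h1
  exact (Real.exp_pos _).ne h1

/-- The two-point bound for Gaussian shifts: the `χ²`-divergence between the noise and its shift
by `Δ` is `exp (|Δ|² / v) - 1`. -/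
lemma gaussian_shift_lower_bound (hv : v ≠ 0) {K : ℝ} (Δ : Fin n → ℝ)
    (hΔ : (∑ i, Δ i ^ 2) / v ≤ K) {X : (Fin n → ℝ) → ℝ} (hX : Measurable X) (a b : ℝ) :
    ENNReal.ofReal ((a - b) ^ 2 / (1 + Real.exp K)) ≤
      ∫⁻ e, ENNReal.ofReal ((X e - a) ^ 2) ∂(Measure.pi fun _ : Fin n => gaussianReal 0 v) +
        ∫⁻ e, ENNReal.ofReal ((X (fun i => e i + Δ i) - b) ^ 2)
          ∂(Measure.pi fun _ : Fin n => gaussianReal 0 v) := by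
  have hv' : (v : ℝ) ≠ 0 := by exact_mod_cast hv
  set γ : Measure (Fin n → ℝ) := Measure.pi fun _ : Fin n => gaussianReal 0 v
  set g : (Fin n → ℝ) → ℝ := fun e => ∑ i, Δ i / v * e i
  have hshift : γ.map (fun e i => e i + Δ i) = γ.tilted g := by
    have h1 := Measure.pi_map_pi (μ := fun _ : Fin n => gaussianReal 0 v)
      (f := fun i x => x + Δ i) (hμ := fun i => by
        rw [gaussianReal_map_add_const]; infer_instance) (fun i => by fun_prop)
    refine h1.trans ?_
    rw [← pi_tilted]
    congr 1
    funext i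
    rw [gaussianReal_map_add_const, zero_add, gaussianReal_eq_tilted_zero _ hv]
  set Z : ℝ := ∫ e, Real.exp (g e) ∂γ
  have hZ : Z = Real.exp (v * (∑ i, (Δ i / v) ^ 2) / 2) := integral_exp_sum_pi_gaussianReal _
  have hZ0 : 0 < Z := hZ ▸ Real.exp_pos _
  set L : (Fin n → ℝ) → ℝ := fun e => Real.exp (g e) / Z
  have hg : Measurable g := by fun_prop
  have hLm : Measurable L := by fun_prop
  have hL0 : ∀ e, 0 ≤ L e := fun e => by positivity
  have hL2 : ∀ e, L e ^ 2 = Real.exp (∑ i, 2 * (Δ i / v) * e i) / Z ^ 2 := fun e => by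
    simp only [L, g]
    rw [div_pow, ← Real.exp_nat_mul, Finset.mul_sum]
    congr 2
    exact Finset.sum_congr rfl fun i _ => by push_cast; ring
  have hLp : MemLp L 2 γ := by
    rw [memLp_two_iff_integrable_sq hLm.aestronglyMeasurable]
    simp_rw [hL2]
    exact (integrable_exp_sum_pi_gaussianReal _).div_const _
  have hL1 : ∫ e, L e ∂γ = 1 := by
    simp only [L]
    rw [integral_div]
    exact div_self hZ0.ne'
  have hLK : ∫ e, L e ^ 2 ∂γ ≤ Real.exp K := by
    simp_rw [hL2]
    rw [integral_div, integral_exp_sum_pi_gaussianReal, hZ, ← Real.exp_nat_mul, ← Real.exp_sub]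
    refine Real.exp_le_exp.2 (le_trans (le_of_eq ?_) hΔ)
    simp_rw [mul_pow, div_pow]
    rw [← Finset.mul_sum, ← Finset.sum_div]
    push_cast
    field_simp
    ring
  have h2 : ∫⁻ e, ENNReal.ofReal ((X (fun i => e i + Δ i) - b) ^ 2) ∂γ =
      ∫⁻ e, ENNReal.ofReal (L e) * ENNReal.ofReal ((X e - b) ^ 2) ∂γ := by
    have h3 : Measurable fun e => ENNReal.ofReal ((X e - b) ^ 2) := by fun_prop
    rw [← lintegral_map (f := fun e => ENNReal.ofReal ((X e - b) ^ 2)) h3 (by fun_prop), hshift,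
      lintegral_tilted]
  rw [h2, ← lintegral_add_left (by fun_prop)]
  exact two_point_lower_bound hL0 hLp hL1 hLK X a b

end TwoPoint

section MinimaxLower

variable {𝒳 : Type*} [TopologicalSpace 𝒳] [MeasurableSpace 𝒳] {μ : Measure 𝒳}
  [IsProbabilityMeasure μ] [IsSeparable μ] {S : MercerKernel μ} {C : ℝ}

lemma lintegral_dataLaw_synth {J n : ℕ} (σ : ℝ≥0) (u : Fin J → ℝ) {F : Data 𝒳 n → ℝ≥0∞}
    (hF : Measurable F) :
    ∫⁻ z, F z ∂(dataLaw σ (S.synth J u) n) =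
      ∫⁻ x, ∫⁻ e, F (x, fun i => S.headEval u (x i) + e i)
        ∂(Measure.pi fun _ : Fin n => gaussianReal 0 (σ ^ 2)) ∂(Measure.pi fun _ : Fin n => μ) := by
  have hm := measurable_dataMap (S.synth J u) n
  rw [dataLaw, lintegral_map hF hm]
  refine (lintegral_prod _ (hF.comp hm).aemeasurable).trans ?_
  have h1 : ∀ᵐ x ∂(Measure.pi fun _ : Fin n => μ), ∀ i, S.synth J u (x i) = S.headEval u (x i) :=
    ae_all_iff.2 fun i => (measurePreserving_eval (fun _ : Fin n => μ) i).quasiMeasurePreserving.ae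
      (synth_ae_eq_headEval u)
  refine lintegral_congr_ae ?_
  filter_upwards [h1] with x hx
  simp only [Function.comp_apply, hx]

/-- Vectors with entries `±δ`, indexed by the vertices of the hypercube. -/
def cubePoint {J : ℕ} (δ : ℝ) (s : Fin J → Bool) : Fin J → ℝ := fun j => if s j then δ else -δ

/-- The two-point bound for neighbouring vertices of the hypercube. -/
lemma cube_two_point_bound (hC : ∀ j x, |S.φ j x| ≤ C) {σ : ℝ≥0} (hσ : 0 < σ) {n J : ℕ} {δ K : ℝ}
    (hK : 4 * n * δ ^ 2 * C ^ 2 / (σ : ℝ) ^ 2 ≤ K) {T : Data 𝒳 n → ℝ} (hT : Measurable T)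
    (s : Fin J → Bool) (j : Fin J) :
    ENNReal.ofReal (4 * δ ^ 2 / (1 + Real.exp K)) ≤
      ∫⁻ z, ENNReal.ofReal ((T z - cubePoint δ s j) ^ 2)
        ∂(dataLaw σ (S.synth J (cubePoint δ s)) n) +
      ∫⁻ z, ENNReal.ofReal ((T z - cubePoint δ (Function.update s j (!s j)) j) ^ 2)
        ∂(dataLaw σ (S.synth J (cubePoint δ (Function.update s j (!s j)))) n) := by
  set u := cubePoint δ s
  set u' := cubePoint δ (Function.update s j (!s j))
  have hφ := S.φ_measurable
  have hG : ∀ (w : Fin J → ℝ) (a : ℝ), Measurable fun p : (Fin n → 𝒳) × (Fin n → ℝ) =>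
      ENNReal.ofReal ((T (p.1, fun i => S.headEval w (p.1 i) + p.2 i) - a) ^ 2) := fun w a => by
    unfold MercerKernel.headEval
    fun_prop
  rw [lintegral_dataLaw_synth σ u (by fun_prop), lintegral_dataLaw_synth σ u' (by fun_prop),
    ← lintegral_add_left (hG u (u j)).lintegral_prod_right']
  have hdiff : (u j - u' j) ^ 2 = 4 * δ ^ 2 := by
    simp only [u, u', cubePoint, Function.update_self]
    cases s j <;> simp <;> ring
  have hdiff' : ∀ k, k ≠ j → u' k = u k := fun k hk => by
    simp only [u, u', cubePoint, Function.update_of_ne hk]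
  calc ENNReal.ofReal (4 * δ ^ 2 / (1 + Real.exp K))
      = ∫⁻ _, ENNReal.ofReal (4 * δ ^ 2 / (1 + Real.exp K)) ∂(Measure.pi fun _ : Fin n => μ) := by
        simp
    _ ≤ _ := by
      refine lintegral_mono fun x => ?_
      set Δ : Fin n → ℝ := fun i => S.headEval u' (x i) - S.headEval u (x i)
      have hΔi : ∀ i, Δ i = (u' j - u j) * S.φ j (x i) := fun i => by
        simp only [Δ, MercerKernel.headEval]
        rw [← Finset.sum_sub_distrib, Finset.sum_eq_single j]
        · ring
        · intro k _ hk
          rw [hdiff' k hk, sub_self]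
        · simp
      have hΔ : (∑ i, Δ i ^ 2) / ((σ ^ 2 : ℝ≥0) : ℝ) ≤ K := by
        refine le_trans ?_ hK
        push_cast
        gcongr
        calc ∑ i, Δ i ^ 2 ≤ ∑ _i : Fin n, 4 * δ ^ 2 * C ^ 2 := by
              refine Finset.sum_le_sum fun i _ => ?_
              rw [hΔi, mul_pow, ← hdiff, ← neg_sub (u j), neg_sq]
              gcongr ?_ * ?_
              rw [← sq_abs]
              exact pow_le_pow_left₀ (abs_nonneg _) (hC _ _) 2
          _ = _ := by simp; ring
      have h := gaussian_shift_lower_bound (v := σ ^ 2) (pow_ne_zero 2 hσ.ne') Δ hΔ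
        (X := fun e => T (x, fun i => S.headEval u (x i) + e i)) (by fun_prop) (u j) (u' j)
      rw [hdiff] at h
      refine h.trans (le_of_eq ?_)
      congr 1
      refine lintegral_congr fun e => ?_
      congr 4
      refine Prod.ext rfl (funext fun i => ?_)
      simp only [Δ]
      ring

/-- Assouad's lemma on the hypercube `{±δ}^J` in the span of the first `J` eigenfunctions. -/
lemma le_minimaxRisk (hC : ∀ j x, |S.φ j x| ≤ C) {σ : ℝ≥0} (hσ : 0 < σ) {n J : ℕ} {δ K : ℝ}
    (hK : 4 * n * δ ^ 2 * C ^ 2 / (σ : ℝ) ^ 2 ≤ K) {F : Set (L2 μ)}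
    (hF : ∀ s : Fin J → Bool, S.synth J (cubePoint δ s) ∈ F) :
    ENNReal.ofReal (J * (2 * δ ^ 2 / (1 + Real.exp K))) ≤ minimaxRisk σ F n := by
  refine le_iInf₂ fun T hT => ?_
  set κ := ENNReal.ofReal (4 * δ ^ 2 / (1 + Real.exp K)) with hκ
  set M := ⨆ f ∈ F, ∫⁻ z, ‖T z - f‖ₑ ^ 2 ∂(dataLaw σ f n)
  set A : Fin J → (Fin J → Bool) → ℝ≥0∞ := fun j s =>
    ∫⁻ z, ENNReal.ofReal ((S.coeff (T z) j - cubePoint δ s j) ^ 2)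
      ∂(dataLaw σ (S.synth J (cubePoint δ s)) n)
  have hm : ∀ j : Fin J, Measurable fun z => S.coeff (T z) j := fun j =>
    (S.measurable_coeff j).comp hT
  have h1 : ∀ s, ∑ j, A j s ≤ M := fun s => by
    refine le_trans ?_ (le_iSup₂ (f := fun f (_ : f ∈ F) =>
      ∫⁻ z, ‖T z - f‖ₑ ^ 2 ∂(dataLaw σ f n)) _ (hF s))
    rw [← lintegral_finsetSum _ fun j _ => by
      have := hm j
      fun_prop]
    refine lintegral_mono fun z => ?_
    rw [enorm_sq_eq_ofReal, ← ENNReal.ofReal_sum_of_nonneg fun j _ => sq_nonneg _]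
    refine ENNReal.ofReal_le_ofReal ?_
    have h2 := sum_le_hasSum ((Finset.univ : Finset (Fin J)).map Fin.valEmbedding)
      (fun j _ => sq_nonneg (S.coeff (T z - S.synth J (cubePoint δ s)) j)) (S.hasSum_sq_coeff (T z - S.synth J (cubePoint δ s)))
    refine (le_of_eq ?_).trans h2
    rw [Finset.sum_map]
    exact Finset.sum_congr rfl fun j _ => by simp [S.coeff_sub, S.coeff_synth]
  -- pair every vertex with its neighbour in direction `j`
  have h2 : ∀ j : Fin J, Fintype.card (Fin J → Bool) * κ ≤ 2 * ∑ s, A j s := fun j => by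
    have hinv : Function.Involutive fun s : Fin J → Bool => Function.update s j (!s j) :=
      fun s => by simp
    have h3 : ∑ s, A j (Function.update s j (!s j)) = ∑ s, A j s :=
      Equiv.sum_comp hinv.toPerm (A j)
    rw [two_mul]
    nth_rewrite 2 [← h3]
    rw [← Finset.sum_add_distrib, ← nsmul_eq_mul, ← Finset.card_univ, ← Finset.sum_const]
    exact Finset.sum_le_sum fun s _ => cube_two_point_bound hC hσ hK (hm j) s j
  have h3 : (Fintype.card (Fin J → Bool) : ℝ≥0∞) * (J * κ) ≤
      Fintype.card (Fin J → Bool) * (2 * M) := by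
    calc (Fintype.card (Fin J → Bool) : ℝ≥0∞) * (J * κ)
        = ∑ _j : Fin J, Fintype.card (Fin J → Bool) * κ := by
          rw [Finset.sum_const, Finset.card_univ, Fintype.card_fin, nsmul_eq_mul]
          ring
      _ ≤ ∑ j, 2 * ∑ s, A j s := Finset.sum_le_sum fun j _ => h2 j
      _ = 2 * ∑ s, ∑ j, A j s := by rw [← Finset.mul_sum, Finset.sum_comm]
      _ ≤ 2 * ∑ _s : Fin J → Bool, M := by
          gcongr with s
          exact h1 s
      _ = _ := by
          rw [Finset.sum_const, Finset.card_univ, nsmul_eq_mul]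
          ring
  have h4 : (J : ℝ≥0∞) * κ ≤ 2 * M :=
    (ENNReal.mul_le_mul_iff_right (by simp) (by simp)).1 h3
  have h5 : (2 : ℝ≥0∞) * ENNReal.ofReal (J * (2 * δ ^ 2 / (1 + Real.exp K))) = J * κ := by
    rw [hκ, ← ENNReal.ofReal_natCast, show (2 : ℝ≥0∞) = ENNReal.ofReal 2 by simp,
      ← ENNReal.ofReal_mul (by norm_num), ← ENNReal.ofReal_mul (by positivity)]
    congr 1
    ring
  rw [← h5] at h4
  exact (ENNReal.mul_le_mul_iff_right (by simp) (by simp)).1 h4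

end MinimaxLower

section MinimaxRate

variable {𝒳 : Type*} [TopologicalSpace 𝒳] [MeasurableSpace 𝒳] {μ : Measure 𝒳}
  [IsProbabilityMeasure μ] [IsSeparable μ] {S : MercerKernel μ} {C : ℝ}

lemma synth_cubePoint_mem_sobolevBall {d : ℕ} {β R δ : ℝ} (hβ : 0 ≤ 2 * β / d) {J : ℕ}
    (hδ : (J : ℝ) ^ (1 + 2 * β / d) * δ ^ 2 ≤ R ^ 2) (s : Fin J → Bool) :
    S.synth J (cubePoint δ s) ∈ sobolevBall S d β R := by
  have hcoeff : ∀ j, S.coeff (S.synth J (cubePoint δ s)) j ^ 2 = if j < J then δ ^ 2 else 0 :=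
    fun j => by
      rw [S.coeff_synth]
      split_ifs with h
      · simp only [cubePoint]
        split_ifs <;> simp
      · simp
  have hzero : ∀ j ∉ Finset.range J,
      ((j : ℝ) + 1) ^ (2 * β / d) * S.coeff (S.synth J (cubePoint δ s)) j ^ 2 = 0 := fun j hj => by
    rw [hcoeff, if_neg (by simpa using hj), mul_zero]
  refine ⟨summable_of_ne_finset_zero hzero, ?_⟩
  rw [tsum_eq_sum hzero]
  refine le_trans ?_ hδ
  calc _ ≤ ∑ _j ∈ Finset.range J, (J : ℝ) ^ (2 * β / d) * δ ^ 2 := by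
        refine Finset.sum_le_sum fun j hj => ?_
        have hj' := Finset.mem_range.1 hj
        rw [hcoeff, if_pos hj']
        gcongr
        exact_mod_cast hj'
    _ = (J : ℝ) ^ (1 + 2 * β / d) * δ ^ 2 := by
        rcases Nat.eq_zero_or_pos J with rfl | hJ
        · simp [Real.zero_rpow (by linarith : 1 + 2 * β / d ≠ 0)]
        · have hJ' : (0 : ℝ) < J := by exact_mod_cast hJ
          rw [Finset.sum_const, Finset.card_range, nsmul_eq_mul, Real.rpow_add hJ', Real.rpow_one,
            mul_assoc]

/-- The minimax rate over Sobolev balls. -/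
theorem exists_minimaxRisk_bounds (hC : ∀ j x, |S.φ j x| ≤ C) {σ : ℝ≥0} (hσ : 0 < σ) {d : ℕ}
    {β R : ℝ} (hβ : 0 ≤ 2 * β / d) (hR : 0 < R) :
    ∃ c C' : ℝ, 0 < c ∧ 0 < C' ∧ ∀ n : ℕ, 1 ≤ n →
      ENNReal.ofReal (c * (n : ℝ) ^ (-(2 * β / d / (1 + 2 * β / d)))) ≤
          minimaxRisk σ (sobolevBall S d β R) n ∧
        minimaxRisk σ (sobolevBall S d β R) n ≤
          ENNReal.ofReal (C' * (n : ℝ) ^ (-(2 * β / d / (1 + 2 * β / d)))) := by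
  have hσ' : (0 : ℝ) < σ := hσ
  set b := 2 * β / d
  have hb1 : 0 < 1 + b := by linarith
  -- with `J ≤ 2 N` and `δ² = k / n` the hypercube is contained in the Sobolev ball, while
  -- neighbouring vertices stay at bounded divergence `K`
  set k : ℝ := R ^ 2 / 2 ^ (1 + b)
  have hk : 0 < k := by positivity
  set K : ℝ := 4 * k * C ^ 2 / (σ : ℝ) ^ 2
  refine ⟨2 * k / (1 + Real.exp K), 4 * C ^ 2 * (R ^ 2 + (σ : ℝ) ^ 2) + R ^ 2, by positivity,
    by positivity, fun n hn => ?_⟩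
  have hn1 : (1 : ℝ) ≤ n := by exact_mod_cast hn
  have hn0 : (0 : ℝ) < n := by linarith
  set N : ℝ := (n : ℝ) ^ (1 + b)⁻¹
  have hN : 1 ≤ N := Real.one_le_rpow hn1 (by positivity)
  have hN0 : 0 < N := by linarith
  have hNn : N ^ (1 + b) = n := by
    rw [← Real.rpow_mul hn0.le, inv_mul_cancel₀ hb1.ne', Real.rpow_one]
  have hNb : (n : ℝ) ^ (-(b / (1 + b))) = N ^ (-b) := by
    rw [← Real.rpow_mul hn0.le]
    congr 1
    field_simp
  have hNn' : N / n = N ^ (-b) := by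
    rw [← hNn, Real.rpow_add hN0, Real.rpow_one, Real.rpow_neg hN0.le]
    field_simp
  set J := ⌈N⌉₊
  have hJ : N ≤ J := Nat.le_ceil N
  have hJ2 : (J : ℝ) ≤ 2 * N := (Nat.ceil_lt_add_one hN0.le).le.trans (by linarith)
  rw [hNb]
  constructor
  · set δ : ℝ := √(k / n)
    have hδ : δ ^ 2 = k / n := Real.sq_sqrt (by positivity)
    have hmem := synth_cubePoint_mem_sobolevBall (S := S) (d := d) (β := β) (R := R) (δ := δ)
      (J := J) hβ (by
        rw [hδ]
        calc (J : ℝ) ^ (1 + b) * (k / n) ≤ (2 * N) ^ (1 + b) * (k / n) := by gcongr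
          _ = R ^ 2 := by
            rw [Real.mul_rpow (by norm_num) hN0.le, hNn]
            simp only [k]
            field_simp)
    refine le_trans (ENNReal.ofReal_le_ofReal ?_) (le_minimaxRisk hC hσ (n := n) (δ := δ) (K := K)
      (by
        rw [hδ]
        refine le_of_eq ?_
        simp only [K]
        field_simp) hmem)
    rw [hδ, ← hNn']
    calc 2 * k / (1 + Real.exp K) * (N / n) = N * (2 * (k / n) / (1 + Real.exp K)) := by ring
      _ ≤ _ := by gcongr
  · refine (minimaxRisk_le hC hn hβ (fun f hf => hf) J).trans (ENNReal.ofReal_le_ofReal ?_)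
    have h1 : ((J : ℝ) + 1) ^ (-b) ≤ N ^ (-b) :=
      Real.rpow_le_rpow_of_nonpos hN0 (by linarith) (by linarith)
    calc (J : ℝ) * (2 * C ^ 2 * (R ^ 2 + (σ : ℝ) ^ 2) / n) + ((J : ℝ) + 1) ^ (-b) * R ^ 2
        ≤ 2 * N * (2 * C ^ 2 * (R ^ 2 + (σ : ℝ) ^ 2) / n) + N ^ (-b) * R ^ 2 := by gcongr
      _ = 4 * C ^ 2 * (R ^ 2 + (σ : ℝ) ^ 2) * (N / n) + N ^ (-b) * R ^ 2 := by ring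
      _ = _ := by rw [hNn']; ring

end MinimaxRate

/-! ### Basis functions in the Sobolev spaces -/

section Basis

variable {𝒳 : Type*} [TopologicalSpace 𝒳] [MeasurableSpace 𝒳] {μ : Measure 𝒳}
  {S : MercerKernel μ} {C : ℝ}

lemma isBoundedFun_basis (hC : ∀ j x, |S.φ j x| ≤ C) (j : ℕ) : IsBoundedFun (S.basis j) :=
  ⟨C, by filter_upwards [S.basis_ae_eq j] with x hx; rw [hx]; exact hC j x⟩

lemma memSobolev_basis (d : ℕ) (β : ℝ) (i : ℕ) : MemSobolev S d β (S.basis i) :=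
  summable_of_ne_finset_zero (s := {i}) fun j hj => by
    rw [S.coeff_basis, if_neg fun h => hj (by simp [h])]
    simp

end Basis

end SparseGP

theorem corollary5p1
    {d : ℕ} (hd : 0 < d) {X : Set (EuclideanSpace ℝ (Fin d))}
    (μ : Measure X) [IsProbabilityMeasure μ]
    (S : SparseGP.MercerKernel μ)
    (hφ : ∃ C : ℝ, ∀ j x, |S.φ j x| ≤ C)
    {α β : ℝ} (hα : (d : ℝ) / 2 < α) (hβ : 0 < β)
    (hlam : S.lam =Θ[⊤] fun j : ℕ => ((j : ℝ) + 1) ^ (-1 - 2 * α / d))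
    (Pr : Measure (SparseGP.L2 μ)) [IsProbabilityMeasure Pr] (hPr : SparseGP.IsGPPrior S Pr)
    {σ : ℝ≥0} (hσ : 0 < σ)
    {m : ℕ → ℕ} {r : ℝ} (hm : (fun n => (m n : ℝ)) =Θ[atTop] fun n : ℕ => (n : ℝ) ^ r) :
    -- the variational posterior is well defined
    (∀ n (z : SparseGP.Data X n),
      ∃! Ψ, SparseGP.IsVariationalPosterior S Pr σ (m n) z Ψ) ∧
    -- contraction at rate `n ^ (-(β ∧ α) / (d + 2α))`
    ((d : ℝ) / (d + 2 * α) ≤ r → r < 1 / 2 →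
      ∀ f₀ : SparseGP.L2 μ, SparseGP.IsBoundedFun f₀ → SparseGP.MemSobolev S d β f₀ →
        SparseGP.ContractsAtRate σ
          (fun n z => SparseGP.variationalPosterior S Pr σ (m n) z) f₀
          (fun n => (n : ℝ) ^ (-(min β α) / (d + 2 * α)))) ∧
    -- this rate is the minimax rate over Sobolev balls if `α = β`
    (α = β → ∀ R : ℝ, 0 < R → ∃ c C : ℝ, 0 < c ∧ 0 < C ∧ ∀ n : ℕ, 1 ≤ n →
      ENNReal.ofReal (c * ((n : ℝ) ^ (-(min β α) / (d + 2 * α))) ^ 2) ≤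
          SparseGP.minimaxRisk σ (SparseGP.sobolevBall S d β R) n ∧
        SparseGP.minimaxRisk σ (SparseGP.sobolevBall S d β R) n ≤
          ENNReal.ofReal (C * ((n : ℝ) ^ (-(min β α) / (d + 2 * α))) ^ 2)) ∧
    -- with fewer features, the contraction rate is suboptimal for some `f₀` if `α = β`
    (α = β → r < (d : ℝ) / (d + 2 * α) →
      ∃ f₀ : SparseGP.L2 μ, SparseGP.IsBoundedFun f₀ ∧ SparseGP.MemSobolev S d β f₀ ∧
        ∃ p : ℝ, p < β / (d + 2 * β) ∧
          (∀ M : ℝ, 0 < M →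
            Tendsto (fun n : ℕ =>
              ∫⁻ z, SparseGP.variationalPosterior S Pr σ (m n) z
                {f | ‖f - f₀‖ ≤ M * (n : ℝ) ^ (-p)} ∂(SparseGP.dataLaw σ f₀ n))
              atTop (𝓝 0)) ∧
          ∀ ε : ℕ → ℝ,
            SparseGP.ContractsAtRate σ
              (fun n z => SparseGP.variationalPosterior S Pr σ (m n) z) f₀ ε →
            (fun n : ℕ => (n : ℝ) ^ (-p)) =O[atTop] ε) := by
  obtain ⟨C, hC⟩ := hφ
  have hd' : (0 : ℝ) < d := by exact_mod_cast hd
  have hα0 : 0 < α := by linarith [half_pos hd']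
  obtain ⟨c, C', hc, hC', hlow, hu⟩ := SparseGP.exists_bounds_of_isTheta_top S.lam_nonneg
    (fun j => by positivity) hlam
  have hq : 1 < 2 * α / d := by
    rw [one_lt_div hd']
    linarith
  have hpos : ∀ j, 0 < S.lam j := fun j => lt_of_lt_of_le (by positivity) (hlow j)
  have hsum := SparseGP.summable_sqrt_of_le hq hu
  have hrate : (1 + 2 * α / d)⁻¹ = d / (d + 2 * α) := by
    rw [← inv_div]
    field_simp
  have hmin : min (2 * β / d) (2 * α / d) = 2 * min β α / d := by
    rw [mul_min_of_nonneg _ _ zero_le_two, min_div_div_right hd'.le]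
  have hsq : ∀ n : ℕ, ((n : ℝ) ^ (-(min β α) / (d + 2 * α))) ^ 2 =
      (n : ℝ) ^ (-(min (2 * β / d) (2 * α / d) / (1 + 2 * α / d))) := fun n => by
    rw [← Real.rpow_mul_natCast (Nat.cast_nonneg n), hmin]
    congr 1
    push_cast
    field_simp
  refine ⟨fun n z => ?_, fun hr hr2 f₀ _ hf => ?_, fun hαβ R hR => ?_, fun hαβ hr => ?_⟩
  · simp only [SparseGP.isVariationalPosterior_iff hC hPr hpos hsum]
    exact existsUnique_eq
  · refine SparseGP.contractsAtRate_variationalPosterior (b := 2 * β / d) hC hPr hpos hsum hq.le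
      (by positivity) hc hC'.le hlow hu hσ hm (hrate.trans_le hr) hr2 hf fun n hn => ⟨?_, hsq n⟩
    have : (0 : ℝ) < n := by exact_mod_cast hn
    positivity
  · subst hαβ
    simp only [min_self] at hsq ⊢
    simp only [hsq]
    exact SparseGP.exists_minimaxRisk_bounds hC hσ (by positivity) hR
  · subst hαβ
    -- any exponent strictly between `α r⁺ / d` and `α / (d + 2 α)` will do
    have hr0 : max r 0 < d / (d + 2 * α) := max_lt hr (by positivity)
    have hgap : α / d * max r 0 < α / (d + 2 * α) := by
      calc α / d * max r 0 < α / d * (d / (d + 2 * α)) := by gcongr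
        _ = α / (d + 2 * α) := by field_simp
    obtain ⟨p, hp1, hp2⟩ := exists_between hgap
    have hmO : (fun n => (m n : ℝ)) =O[atTop] fun n : ℕ => (n : ℝ) ^ max r 0 := by
      refine hm.1.trans (IsBigO.of_bound 1 ?_)
      filter_upwards [eventually_ge_atTop 1] with n hn
      have hn1 : (1 : ℝ) ≤ n := by exact_mod_cast hn
      rw [Real.norm_of_nonneg (by positivity), Real.norm_of_nonneg (by positivity), one_mul]
      exact Real.rpow_le_rpow_of_exponent_le hn1 (le_max_left _ _)
    refine ⟨S.basis 0, SparseGP.isBoundedFun_basis hC 0, SparseGP.memSobolev_basis d α 0, p, hp2,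
      SparseGP.variationalPosterior_suboptimal hC hPr hpos hsum hc (by linarith) hlow σ
        (le_max_right r 0) hmO ?_ _⟩
    calc 2 * α / d * max r 0 = 2 * (α / d * max r 0) := by ring
      _ < 2 * p := by gcongr
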